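/- **Setting.** Let $n\ge 2$, $k>0$, let $O\subset\mathbb{R}^n$ be compact with $\Omega:=\mathbb{R}^n\setminus O$ connected, let $\Gamma$ be compact with $\partial O\subset\Gamma\subset O$, and let $u^{\mathrm{inc}}\in H^{1,\mathrm{loc}}(\mathbb{R}^n)$ satisfy $\Delta u^{\mathrm{inc}}+k^2u^{\mathrm{inc}}=0$ (in the sense of distributions) in an open neighbourhood of $O$, where its continuous representative is taken. Let $\Phi(x,y)=\frac{\mathrm i}{4}\left(\frac{k}{2\pi|x-y|}\right)^{(n-2)/2}H^{(1)}_{(n-2)/2}(k|x-y|)$, let $\mathcal{A}$ be the acoustic Newtonian potential, $\mathcal{A}\psi(x)=\int_{\mathbb{R}^n}\Phi(x,y)\psi(y)\,\mathrm dy$, extended to compactly supported distributions, and let $\langle u,v\rangle=\int\hat u\,\overline{\hat v}\,\mathrm d\xi$ be the duality pairing of $H^{s}(\mathbb{R}^n)$ and $H^{-s}(\mathbb{R}^n)$, $s=\pm1$. Let $H^{-1}_\Gamma=\{\phi\in H^{-1}(\mathbb{R}^n):\operatorname{supp}\phi\subset\Gamma\}$, let $P$ be the orthogonal projection of $H^1(\mathbb{R}^n)$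 onto the orthogonal complement of the closure of $C_0^\infty(\mathbb{R}^n\setminus\Gamma)$ in $H^1(\mathbb{R}^n)$, let $\chi\in C_0^\infty(\mathbb{R}^n)$ equal $1$ in a neighbourhood of $\Gamma$, and put $A\phi:=P(\chi\mathcal{A}\phi)$ for $\phi\in H^{-1}_\Gamma$, $a(\phi,\psi):=\langle A\phi,\psi\rangle$, and $g:=-P(\chi u^{\mathrm{inc}})$. Let $\mu$ be a Radon measure with support $\Gamma$ such that, for some $C>0$, $$\|v|_\Gamma\|_{L^2(\Gamma,\mu)}\le C\|v\|_{H^1(\mathbb{R}^n)},\qquad v\in\mathcal{S}(\mathbb{R}^n). \tag{1}$$ Let $T:H^1(\mathbb{R}^n)\to L^2(\Gamma,\mu)$ be the continuous extension of $v\mapsto v|_\Gamma$, and $T^*:L^2(\Gamma,\mu)\to H^{-1}(\mathbb{R}^n)$ its adjoint, $\langle T^*f,v\rangle=(f,Tv)_{L^2(\Gamma,\mu)}$. Let $\mathbb{H}(\Gamma,\mu)$ be the range of $T$ with the norm $\|h\|=\min\{\|v\|_{H^1(\mathbb{R}^n)}:Tv=h\}$, let $\mathbb{H}^*(\Gamma,\mu)\supset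 L^2(\Gamma,\mu)$ be its (antilinear) dual space, let $T_{\mathbb{H}}^*:\mathbb{H}^*(\Gamma,\mu)\to H^{-1}_\Gamma$ be the adjoint of $T:H^1(\mathbb{R}^n)\to\mathbb{H}(\Gamma,\mu)$, and let $\mathbb{A}:=TAT_{\mathbb{H}}^*:\mathbb{H}^*(\Gamma,\mu)\to\mathbb{H}(\Gamma,\mu)$ and $\mathfrak{g}:=Tg$. Let $T_1,\dots,T_M\subset\Gamma$ be $\mu$-measurable with $\mu(\Gamma\setminus\bigcup_jT_j)=0$, $\mu(T_j)>0$, and $\mu(T_i\cap T_j)=0$ for $i\ne j$; let $f_1,\dots,f_M$ be a basis of the space of functions in $L^\infty(\Gamma,\mu)$ that are constant on each $T_j$, and let $e_j:=T^*f_j$, $a_{ij}:=a(e_j,e_i)$, $b_i:=\langle g,e_i\rangle$. For coefficients $c_1,\dots,c_M\in\mathbb{C}$ let $\phi_N:=\sum_jc_je_j$ and $u_N:=\mathcal{A}\phi_N|_\Omega$. **Proposition.** These objects are well defined: $\chi\mathcal{A}\phi\in H^1(\mathbb{R}^n)$ for all $\phi\in H^{-1}_\Gamma$, and $T^*$ maps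 into $H^{-1}_\Gamma$. For $i,j=1,\dots,M$, $$a_{ij}=(\mathbb{A}f_j,f_i)_{L^2(\Gamma,\mu)},\qquad b_i=(\mathfrak{g},f_i)_{L^2(\Gamma,\mu)}=-\int_\Gamma u^{\mathrm{inc}}\,\overline{f_i}\,\mathrm d\mu .$$ For all $c_1,\dots,c_M$ (in particular for those of a Galerkin solution) the distribution $u_N$ on $\Omega$ is a continuous function, and $$u_N(x)=\sum_{j=1}^Mc_j\int_\Gamma\Phi(x,y)f_j(y)\,\mathrm d\mu(y),\qquad x\in\Omega .$$ If also $$\sup_{x\in\mathbb{R}^n}\int_{|x-y|\le r}F_n(|x-y|)\,\mathrm d\mu(y)\to0\quad\text{as } r\to0^+,$$ where $F_2(r):=|\log r|$ and $F_n(r):=r^{2-n}$ for $n>2$, with $F_n(0):=\infty$, then $$a_{ij}=\int_\Gamma\int_\Gamma\Phi(x,y)f_j(y)\overline{f_i(x)}\,\mathrm d\mu(y)\,\mathrm d\mu(x),\qquad i,j=1,\dots,M .$$ All the integrals over $\Gamma$ and $\Gamma\times\Gamma$ in these formulas converge absolutely. -/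

import Mathlib

open MeasureTheory Filter Topology Set
open scoped SchwartzMap FourierTransform Laplacian ENNReal ComplexConjugate

noncomputable section

namespace Scattering

/-- Euclidean space of dimension `n`. -/
abbrev E (n : ℕ) : Type := EuclideanSpace ℝ (Fin n)

/-! ### The fundamental solution of the Helmholtz equation -/

/-- The Hankel function of the first kind `H_ν^{(1)}(z)`, for real `ν` and `z > 0`, by the
Schläfli-Sommerfeld integral `(1 / (π i)) ∫ exp (z sinh t - ν t) dt` over the path from `-∞` to
`∞ + π i` that runs along the real axis from `-∞` to `0`, along the imaginary axis from `0` to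
`π i`, and parallel to the real axis from `π i` to `∞ + π i`. The three integrals below are the
contributions of the three pieces, parametrised by `-t`, `i t` and `t + π i`. -/
def hankel1 (ν z : ℝ) : ℂ :=
  1 / (Real.pi * Complex.I) *
    ((∫ t in Ioi (0 : ℝ), Complex.exp (-z * Real.sinh t + ν * t))
      + Complex.I * (∫ t in (0 : ℝ)..Real.pi, Complex.exp (Complex.I * (z * Real.sin t - ν * t)))
      + Complex.exp (-Complex.I * ν * Real.pi) *
          ∫ t in Ioi (0 : ℝ), Complex.exp (-z * Real.sinh t - ν * t))

/-- The outgoing fundamental solution `Φ(x, y)` of `Δ u + k² u = 0`. Only its values for `x ≠ y`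
are meaningful. -/
def Phi {n : ℕ} (k : ℝ) (x y : E n) : ℂ :=
  Complex.I / 4 * (((k / (2 * Real.pi * ‖x - y‖)) ^ (((n : ℝ) - 2) / 2) : ℝ) : ℂ)
    * hankel1 (((n : ℝ) - 2) / 2) (k * ‖x - y‖)

/-! ### The Sobolev spaces `H^s(ℝⁿ)`

With `û(ξ) = (2π)^{-n/2} ∫ exp (-i ξ·x) u(x) dx` the norm of `H^s(ℝⁿ)` is
`‖u‖² = ∫ |û(ξ)|² (1 + |ξ|²)^s dξ`. Mathlib's Fourier transform is
`(𝓕 u)(η) = ∫ exp (-2π i η·x) u(x) dx = (2π)^{n/2} û(2πη)`, so that, substituting `ξ = 2πη`,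
`‖u‖² = ∫ |(𝓕 u)(η)|² (1 + |2πη|²)^s dη` and `∫ û conj(v̂) dξ = ∫ (𝓕 u) conj(𝓕 v) dη`. -/

/-- The weight `(1 + |2πη|²)^{s/2}`. -/
def weight (n : ℕ) (s : ℝ) (η : E n) : ℂ :=
  (((1 + ‖(2 * Real.pi) • η‖ ^ 2) ^ (s / 2) : ℝ) : ℂ)

theorem weight_hasTemperateGrowth (n : ℕ) (s : ℝ) : (weight n s).HasTemperateGrowth := by
  have h1 := Function.hasTemperateGrowth_one_add_norm_sq_rpow (E n) (s / 2)
  have h2 : (fun η : E n => (2 * Real.pi) • η).HasTemperateGrowth :=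
    ((2 * Real.pi) • ContinuousLinearMap.id ℝ (E n)).hasTemperateGrowth
  have h3 := h1.comp h2
  exact (Complex.ofRealCLM.hasTemperateGrowth).comp h3

theorem weight_mul (n : ℕ) (s t : ℝ) : weight n s * weight n t = weight n (s + t) := by
  funext η
  simp only [weight, Pi.mul_apply]
  norm_cast
  rw [← Real.rpow_add (by positivity)]
  congr 1
  ring

theorem weight_zero (n : ℕ) : weight n 0 = fun _ => 1 := by
  funext η
  simp [weight]

/-- Multiplication of a tempered distribution by the weight `(1 + |2πη|²)^{s/2}`. -/
def mulWeight (n : ℕ) (s : ℝ) : 𝓢'(E n, ℂ) →L[ℂ] 𝓢'(E n, ℂ) :=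
  TemperedDistribution.smulLeftCLM ℂ (weight n s)

theorem mulWeight_mulWeight (n : ℕ) (s t : ℝ) (u : 𝓢'(E n, ℂ)) :
    mulWeight n t (mulWeight n s u) = mulWeight n (s + t) u := by
  rw [mulWeight, mulWeight, TemperedDistribution.smulLeftCLM_smulLeftCLM_apply
    (weight_hasTemperateGrowth n s) (weight_hasTemperateGrowth n t), weight_mul]
  rfl

theorem mulWeight_zero (n : ℕ) (u : 𝓢'(E n, ℂ)) : mulWeight n 0 u = u := by
  rw [mulWeight, weight_zero, TemperedDistribution.smulLeftCLM_const, one_smul]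

/-- `L²(ℝⁿ)`. -/
abbrev L2 (n : ℕ) : Type := Lp ℂ 2 (volume : Measure (E n))

/-- The tempered distributions `u` for which `(1 + |2πη|²)^{s/2} (𝓕 u)(η)` is in `L²(ℝⁿ)`. -/
def sobolevSubmodule (n : ℕ) (s : ℝ) : Submodule ℂ 𝓢'(E n, ℂ) :=
  (LinearMap.range (Lp.toTemperedDistributionCLM ℂ (volume : Measure (E n)) 2).toLinearMap).comap
    ((mulWeight n s).toLinearMap ∘ₗ (FourierTransform.fourierCLM ℂ 𝓢'(E n, ℂ)).toLinearMap)

/-- The Sobolev space `H^s(ℝⁿ)`, a space of tempered distributions (as a type of its own, since it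
carries its own norm and not the topology of the tempered distributions). -/
def H (n : ℕ) (s : ℝ) : Type := sobolevSubmodule n s

instance (n : ℕ) (s : ℝ) : AddCommGroup (H n s) := inferInstanceAs (AddCommGroup (sobolevSubmodule n s))

instance (n : ℕ) (s : ℝ) : Module ℂ (H n s) := inferInstanceAs (Module ℂ (sobolevSubmodule n s))

/-- The tempered distribution underlying an element of `H^s(ℝⁿ)`. -/
def H.dist {n : ℕ} {s : ℝ} : H n s →ₗ[ℂ] 𝓢'(E n, ℂ) := (sobolevSubmodule n s).subtype

theorem mem_sobolevSubmodule {n : ℕ} {s : ℝ} {u : 𝓢'(E n, ℂ)} :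
    u ∈ sobolevSubmodule n s ↔ ∃ f : L2 n, (f : 𝓢'(E n, ℂ)) = mulWeight n s (𝓕 u) := by
  rfl

theorem coe_L2_injective {n : ℕ} {f g : L2 n} (h : (f : 𝓢'(E n, ℂ)) = g) : f = g := by
  have hk := Lp.ker_toTemperedDistributionCLM_eq_bot (F := ℂ) (μ := (volume : Measure (E n))) (p := 2)
  exact LinearMap.ker_eq_bot.mp hk h

/-- The tempered distribution `u` with `(1 + |2πη|²)^{s/2} (𝓕 u)(η) = f(η)`. -/
def distOfWeightedFourier (n : ℕ) (s : ℝ) : L2 n →ₗ[ℂ] 𝓢'(E n, ℂ) :=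
  (FourierTransform.fourierInvCLM ℂ 𝓢'(E n, ℂ)).toLinearMap ∘ₗ (mulWeight n (-s)).toLinearMap ∘ₗ
    (Lp.toTemperedDistributionCLM ℂ (volume : Measure (E n)) 2).toLinearMap

theorem mulWeight_fourier_dist (n : ℕ) (s : ℝ) (f : L2 n) :
    mulWeight n s (𝓕 (distOfWeightedFourier n s f)) = (f : 𝓢'(E n, ℂ)) := by
  change mulWeight n s (𝓕 (𝓕⁻ (mulWeight n (-s) (f : 𝓢'(E n, ℂ))))) = _
  rw [FourierTransform.fourier_fourierInv_eq, mulWeight_mulWeight, neg_add_cancel, mulWeight_zero]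

/-- `distOfWeightedFourier` as a map onto `H^s(ℝⁿ)`. -/
def ofWeightedFourier (n : ℕ) (s : ℝ) : L2 n →ₗ[ℂ] H n s :=
  LinearMap.codRestrict (sobolevSubmodule n s) (distOfWeightedFourier n s) fun f =>
    mem_sobolevSubmodule.mpr ⟨f, (mulWeight_fourier_dist n s f).symm⟩

theorem dist_ofWeightedFourier (n : ℕ) (s : ℝ) (f : L2 n) :
    (ofWeightedFourier n s f).dist = distOfWeightedFourier n s f := rfl

theorem ofWeightedFourier_bijective (n : ℕ) (s : ℝ) :
    Function.Bijective (ofWeightedFourier n s) := by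
  constructor
  · intro f g h
    have h' := congrArg (fun u : H n s => mulWeight n s (𝓕 u.dist)) h
    simp only [dist_ofWeightedFourier, mulWeight_fourier_dist] at h'
    exact coe_L2_injective h'
  · intro u
    obtain ⟨f, hf⟩ := mem_sobolevSubmodule.mp u.2
    refine ⟨f, Subtype.ext ?_⟩
    change 𝓕⁻ (mulWeight n (-s) (f : 𝓢'(E n, ℂ))) = u.1
    rw [hf, mulWeight_mulWeight, add_neg_cancel, mulWeight_zero,
      FourierTransform.fourierInv_fourier_eq]

/-- For `u ∈ H^s(ℝⁿ)` the function `(1 + |2πη|²)^{s/2} (𝓕 u)(η)` in `L²(ℝⁿ)`. -/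
def weightedFourier {n : ℕ} {s : ℝ} : H n s ≃ₗ[ℂ] L2 n :=
  (LinearEquiv.ofBijective (ofWeightedFourier n s) (ofWeightedFourier_bijective n s)).symm

theorem weightedFourier_spec {n : ℕ} {s : ℝ} (u : H n s) :
    ((weightedFourier u : L2 n) : 𝓢'(E n, ℂ)) = mulWeight n s (𝓕 u.dist) := by
  obtain ⟨f, rfl⟩ := (ofWeightedFourier_bijective n s).2 u
  have h : weightedFourier (ofWeightedFourier n s f) = f :=
    (LinearEquiv.ofBijective _ (ofWeightedFourier_bijective n s)).symm_apply_apply f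
  rw [h, dist_ofWeightedFourier, mulWeight_fourier_dist]

instance (n : ℕ) (s : ℝ) : NormedAddCommGroup (H n s) :=
  NormedAddCommGroup.induced (H n s) (L2 n) weightedFourier.toLinearMap weightedFourier.injective

/-- The inner product `(u, v) ↦ ∫ û conj(v̂) (1 + |ξ|²)^s dξ` of `H^s(ℝⁿ)`; as everywhere in
Mathlib, `inner ℂ v u` is linear in `u` and antilinear in `v`. -/
instance (n : ℕ) (s : ℝ) : InnerProductSpace ℂ (H n s) where
  norm_smul_le c u := by
    change ‖weightedFourier (c • u)‖ ≤ ‖c‖ * ‖weightedFourier u‖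
    rw [map_smul, norm_smul]
  inner u v := inner ℂ (weightedFourier u) (weightedFourier v)
  norm_sq_eq_re_inner u := norm_sq_eq_re_inner (𝕜 := ℂ) (weightedFourier u)
  conj_inner_symm u v := inner_conj_symm (weightedFourier u) (weightedFourier v)
  add_left u v w := by
    change inner ℂ (weightedFourier (u + v)) (weightedFourier w) = _
    rw [map_add, inner_add_left]
  smul_left u v c := by
    change inner ℂ (weightedFourier (c • u)) (weightedFourier v) = _
    rw [map_smul, inner_smul_left]

/-- `weightedFourier` as a unitary isomorphism `H^s(ℝⁿ) → L²(ℝⁿ)`. -/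
def weightedFourierIsometry (n : ℕ) (s : ℝ) : H n s ≃ₗᵢ[ℂ] L2 n where
  toLinearEquiv := weightedFourier
  norm_map' _ := rfl

instance (n : ℕ) (s : ℝ) : CompleteSpace (H n s) :=
  (weightedFourierIsometry n s).toIsometryEquiv.completeSpace

/-- The Fourier transform `𝓕 u` of `u ∈ H^s(ℝⁿ)`, as a function. -/
def fourierFun {n : ℕ} {s : ℝ} (u : H n s) (η : E n) : ℂ :=
  weight n (-s) η * (weightedFourier u : L2 n) η

/-- The duality pairing `⟨u, v⟩ = ∫ û(ξ) conj(v̂(ξ)) dξ` of `u ∈ H^s(ℝⁿ)` with `v ∈ H^t(ℝⁿ)`, used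
for `t = -s`. -/
def pairing {n : ℕ} {s t : ℝ} (u : H n s) (v : H n t) : ℂ :=
  ∫ η, fourierFun u η * conj (fourierFun v η)

/-- The embedding of the Schwartz space in `H^s(ℝⁿ)`. -/
def ofSchwartz (n : ℕ) (s : ℝ) : 𝓢(E n, ℂ) →ₗ[ℂ] H n s :=
  LinearMap.codRestrict (sobolevSubmodule n s)
    (SchwartzMap.toTemperedDistributionCLM (E n) ℂ volume).toLinearMap fun v => by
      refine mem_sobolevSubmodule.mpr ⟨(SchwartzMap.smulLeftCLM ℂ (weight n s) (𝓕 v)).toLp 2, ?_⟩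
      change _ = mulWeight n s (𝓕 (v : 𝓢'(E n, ℂ)))
      rw [Lp.toTemperedDistribution_toLp_eq, TemperedDistribution.fourier_toTemperedDistributionCLM_eq]
      ext g
      simp only [mulWeight, TemperedDistribution.smulLeftCLM_apply_apply,
        SchwartzMap.toTemperedDistributionCLM_apply_apply]
      refine integral_congr_ae (Eventually.of_forall fun x => ?_)
      simp only [SchwartzMap.smulLeftCLM_apply_apply (weight_hasTemperateGrowth n s), smul_eq_mul]
      ring

/-- The realisation of `H^{-1}(ℝⁿ)` as the space of continuous antilinear functionals on
`H¹(ℝⁿ)`: the element `φ` with `⟨φ, v⟩ = ℓ v` for all `v ∈ H¹(ℝⁿ)`. It is built from the Riesz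
representative `w` of `ℓ` in `H¹(ℝⁿ)` as the element with `φ̂ = (1 + |ξ|²) ŵ`; see
`pairing_ofAntidual`. -/
def ofAntidual {n : ℕ} (ℓ : H n 1 →L⋆[ℂ] ℂ) : H n (-1) :=
  weightedFourier.symm <| weightedFourier <| (InnerProductSpace.toDual ℂ (H n 1)).symm
    ((starL ℂ : ℂ ≃L⋆[ℂ] ℂ).toContinuousLinearMap.comp ℓ)

theorem pairing_ofAntidual {n : ℕ} (ℓ : H n 1 →L⋆[ℂ] ℂ) (v : H n 1) :
    pairing (ofAntidual ℓ) v = ℓ v := by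
  set w := (InnerProductSpace.toDual ℂ (H n 1)).symm
    ((starL ℂ : ℂ ≃L⋆[ℂ] ℂ).toContinuousLinearMap.comp ℓ) with hw
  have h1 : inner ℂ w v = conj (ℓ v) := by
    rw [hw, InnerProductSpace.toDual_symm_apply]
    rfl
  have h2 : inner ℂ v w = ℓ v := by
    rw [← inner_conj_symm, h1, Complex.conj_conj]
  rw [← h2]
  change ∫ η, _ = inner ℂ (weightedFourier v) (weightedFourier w)
  rw [L2.inner_def]
  refine integral_congr_ae (Eventually.of_forall fun η => ?_)
  have h3 : weightedFourier (ofAntidual ℓ) = weightedFourier w := by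
    rw [ofAntidual, LinearEquiv.apply_symm_apply]
  have h4 : weight n (-(-1)) η * conj (weight n (-1) η) = 1 := by
    have := congrFun (weight_mul n (-(-1)) (-1)) η
    rw [neg_add_cancel, weight_zero] at this
    refine Eq.trans ?_ this
    simp [weight]
  simp only [fourierFun, h3, map_mul, RCLike.inner_apply]
  linear_combination ((weightedFourier w : Scattering.L2 n) η *
    conj ((weightedFourier v : Scattering.L2 n) η)) * h4

/-! ### Subspaces of Sobolev spaces -/

/-- `H^{-1}_Γ`, the elements of `H^{-1}(ℝⁿ)` that are supported in `Γ`. -/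
def HGamma {n : ℕ} (Γ : Set (E n)) : Set (H n (-1)) :=
  {φ | Distribution.dsupport (φ.dist : 𝓢(E n, ℂ) → ℂ) ⊆ Γ}

/-- The space `H̃¹(G)`: the closure of `C₀^∞(G)` in `H¹(ℝⁿ)`. -/
def HTilde {n : ℕ} (G : Set (E n)) : Submodule ℂ (H n 1) :=
  (Submodule.span ℂ {u | ∃ v : 𝓢(E n, ℂ), HasCompactSupport v ∧ tsupport v ⊆ G ∧
    ofSchwartz n 1 v = u}).topologicalClosure

/-- The space `V₁(Γᶜ)`: the orthogonal complement of `H̃¹(Γᶜ)` in `H¹(ℝⁿ)`. -/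
def V1 {n : ℕ} (Γ : Set (E n)) : Submodule ℂ (H n 1) := (HTilde Γᶜ)ᗮ

instance {n : ℕ} (Γ : Set (E n)) : CompleteSpace (V1 Γ) :=
  (Submodule.isClosed_orthogonal (HTilde Γᶜ)).completeSpace_coe

/-- The orthogonal projection `P` of `H¹(ℝⁿ)` onto `V₁(Γᶜ)`. -/
def projV1 {n : ℕ} (Γ : Set (E n)) : H n 1 →L[ℂ] H n 1 := (V1 Γ).starProjection

/-- The set `C^∞_{0,K}` of functions in `C₀^∞(ℝⁿ)` that equal `1` in a neighbourhood of `K`. -/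
def IsCutoff {n : ℕ} (K : Set (E n)) (χ : 𝓢(E n, ℂ)) : Prop :=
  HasCompactSupport χ ∧ ∀ᶠ x in 𝓝ˢ K, χ x = 1

/-! ### The incident field -/

/-- `u ∈ H^{1,loc}(ℝⁿ)`: `χ u ∈ L²(ℝⁿ)` and `χ u ∈ H¹(ℝⁿ)` for all `χ ∈ C₀^∞(ℝⁿ)`. -/
def MemH1loc {n : ℕ} (u : E n → ℂ) : Prop :=
  ∀ χ : 𝓢(E n, ℂ), HasCompactSupport χ →
    ∃ h : MemLp (fun x => χ x * u x) 2 volume,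
      (h.toLp (fun x => χ x * u x) : 𝓢'(E n, ℂ)) ∈ sobolevSubmodule n 1

/-- The element `χ u` of `H¹(ℝⁿ)`, for `u ∈ H^{1,loc}(ℝⁿ)` and `χ ∈ C₀^∞(ℝⁿ)`. -/
def MemH1loc.cutoff {n : ℕ} {u : E n → ℂ} (hu : MemH1loc u) {χ : 𝓢(E n, ℂ)}
    (hχ : HasCompactSupport χ) : H n 1 :=
  ⟨_, (hu χ hχ).choose_spec⟩

/-- `u` satisfies `Δ u + k² u = 0` in the open set `U`, in the sense of distributions. -/
def HelmholtzOn {n : ℕ} (k : ℝ) (U : Set (E n)) (u : E n → ℂ) : Prop :=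
  ∀ ψ : 𝓢(E n, ℂ), HasCompactSupport ψ → tsupport ψ ⊆ U →
    ∫ x, u x * ((Δ ψ) x + (k : ℂ) ^ 2 * ψ x) = 0

/-! ### The acoustic Newtonian potential -/

/-- `(𝒜 ψ)(x) = ∫ Φ(x, y) ψ(y) dy`, for a function `ψ`. -/
def newtonFun {n : ℕ} (k : ℝ) (ψ : E n → ℂ) (x : E n) : ℂ := ∫ y, Phi k x y * ψ y

open Classical in
/-- The value `φ(g)` of a distribution `φ` with compact support at a function `g` that is smooth
but not necessarily rapidly decreasing: the value of `φ` at any Schwartz function that equals `g`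
in a neighbourhood of the support of `φ`. -/
def evalNearSupport {n : ℕ} (φ : 𝓢'(E n, ℂ)) (g : E n → ℂ) : ℂ :=
  if h : ∃ s : 𝓢(E n, ℂ), ∀ᶠ x in 𝓝ˢ (Distribution.dsupport (φ : 𝓢(E n, ℂ) → ℂ)), s x = g x
    then φ h.choose else 0

/-- The acoustic Newtonian potential `𝒜 φ` of a distribution `φ` with compact support (that is,
the convolution of `φ` with `Φ(·, 0)`), as a distribution: for a test function `ψ ∈ C₀^∞(ℝⁿ)`,
`(𝒜 φ)(ψ) = φ(𝒜 ψ)`, by the symmetry of `Φ`. -/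
def newton {n : ℕ} (k : ℝ) (φ : 𝓢'(E n, ℂ)) (ψ : E n → ℂ) : ℂ :=
  evalNearSupport φ (newtonFun k ψ)

/-- `v ∈ H¹(ℝⁿ)` equals the product of `χ ∈ C₀^∞(ℝⁿ)` and the Newtonian potential `𝒜 φ`, as
distributions. -/
def IsCutoffNewton {n : ℕ} (k : ℝ) (χ : 𝓢(E n, ℂ)) (φ : 𝓢'(E n, ℂ)) (v : H n 1) : Prop :=
  ∀ ψ : 𝓢(E n, ℂ), v.dist ψ = newton k φ (fun x => χ x * ψ x)

open Classical in
/-- The element `χ 𝒜 φ` of `H¹(ℝⁿ)`. -/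
def cutoffNewton {n : ℕ} (k : ℝ) (χ : 𝓢(E n, ℂ)) (φ : 𝓢'(E n, ℂ)) : H n 1 :=
  if h : ∃ v : H n 1, IsCutoffNewton k χ φ v then h.choose else 0

/-- On the set `G`, the distribution `𝒜 φ` is given by the function `u`, continuous on `G`. -/
def IsContinuousRepOn {n : ℕ} (k : ℝ) (φ : 𝓢'(E n, ℂ)) (G : Set (E n)) (u : E n → ℂ) : Prop :=
  ContinuousOn u G ∧ ∀ ψ : 𝓢(E n, ℂ), HasCompactSupport ψ → tsupport ψ ⊆ G →
    newton k φ ψ = ∫ x, u x * ψ x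

/-- The operator `A : H^{-1}_Γ → V₁(Γᶜ)`, `A φ = P(χ 𝒜 φ)`. -/
def opA {n : ℕ} (k : ℝ) (Γ : Set (E n)) (χ : 𝓢(E n, ℂ)) (φ : H n (-1)) : H n 1 :=
  projV1 Γ (cutoffNewton k χ φ.dist)

/-- The sesquilinear form `a(φ, ψ) = ⟨A φ, ψ⟩`. -/
def formA {n : ℕ} (k : ℝ) (Γ : Set (E n)) (χ : 𝓢(E n, ℂ)) (φ ψ : H n (-1)) : ℂ :=
  pairing (opA k Γ χ φ) ψ

/-- The right-hand side `g = -P(χ uinc)`. -/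
def rhsG {n : ℕ} (Γ : Set (E n)) {u : E n → ℂ} (hu : MemH1loc u) {χ : 𝓢(E n, ℂ)}
    (hχ : IsCutoff Γ χ) : H n 1 :=
  -projV1 Γ (hu.cutoff hχ.1)

/-! ### Traces on the support of a measure

Since `μ` is supported on `Γ`, the space `L²(Γ, μ)` is `Lp ℂ 2 μ`. -/

section Trace

variable {n : ℕ} (μ : Measure (E n)) [IsFiniteMeasure μ]

/-- The trace operator on Schwartz functions, `v ↦ v|_Γ ∈ L²(Γ, μ)`. -/
def traceSchwartz : 𝓢(E n, ℂ) →ₗ[ℂ] Lp ℂ 2 μ := (SchwartzMap.toLpCLM ℂ ℂ 2 μ).toLinearMap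

/-- The trace operator is bounded from the Schwartz functions with the norm of `H¹(ℝⁿ)` to
`L²(Γ, μ)`. -/
def TraceBounded : Prop :=
  ∃ C : ℝ, 0 < C ∧ ∀ v : 𝓢(E n, ℂ), ‖traceSchwartz μ v‖ ≤ C * ‖ofSchwartz n 1 v‖

/-- The trace operator `Tr̃ : H¹(ℝⁿ) → L²(Γ, μ)`, the continuous extension of `traceSchwartz` that
exists if `TraceBounded μ`. -/
def trace : H n 1 →L[ℂ] Lp ℂ 2 μ := (traceSchwartz μ).extendOfNorm (ofSchwartz n 1)

/-- The inner product `(f, g) = ∫ f conj(g) dμ` of `L²(Γ, μ)`, linear in `f`. -/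
def l2inner (f g : Lp ℂ 2 μ) : ℂ := inner ℂ g f

/-- The adjoint `Tr̃* : L²(Γ, μ) → H^{-1}(ℝⁿ)`: `⟨Tr̃* f, v⟩ = (f, Tr̃ v)` for all
`v ∈ H¹(ℝⁿ)`. -/
def traceAdj (f : Lp ℂ 2 μ) : H n (-1) :=
  ofAntidual (((innerSL ℂ).flip f).comp (trace μ))

/-- The space `ℍ(Γ, μ)`: the range of the trace operator. -/
def HH : Submodule ℂ (Lp ℂ 2 μ) := LinearMap.range (trace μ).toLinearMap

/-- The norm of `ℍ(Γ, μ)`: the least norm in `H¹(ℝⁿ)` of an extension. -/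
def normHH (h : HH μ) : ℝ := sInf {r | ∃ v : H n 1, trace μ v = h ∧ ‖v‖ = r}

/-- The dual space `ℍ*(Γ, μ)`: the antilinear functionals that are bounded on `ℍ(Γ, μ)`. -/
structure HHDual where
  /-- the functional -/
  toFun : HH μ →ₛₗ[starRingEnd ℂ] ℂ
  bound : ∃ C : ℝ, ∀ h, ‖toFun h‖ ≤ C * normHH μ h

theorem normHH_nonneg (h : HH μ) : 0 ≤ normHH μ h := by
  apply Real.sInf_nonneg
  rintro r ⟨v, -, rfl⟩
  exact norm_nonneg v

theorem normHH_trace_le (v : H n 1) :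
    normHH μ ⟨trace μ v, LinearMap.mem_range_self _ v⟩ ≤ ‖v‖ := by
  refine csInf_le ⟨0, ?_⟩ ⟨v, rfl, rfl⟩
  rintro r ⟨w, -, rfl⟩
  exact norm_nonneg w

theorem norm_le_normHH (h : HH μ) : ‖(h : Lp ℂ 2 μ)‖ ≤ (‖trace μ‖ + 1) * normHH μ h := by
  have hc : 0 < ‖trace μ‖ + 1 := by positivity
  rw [← div_le_iff₀' hc]
  obtain ⟨v, hv⟩ := h.2
  refine le_csInf ⟨‖v‖, v, hv, rfl⟩ ?_
  rintro r ⟨w, hw, rfl⟩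
  rw [div_le_iff₀' hc, ← hw]
  exact ((trace μ).le_opNorm w).trans
    (mul_le_mul_of_nonneg_right (by linarith) (norm_nonneg w))

/-- The embedding of `L²(Γ, μ)` in `ℍ*(Γ, μ)`, `f ↦ (f, ·)`. -/
def embedHHDual (f : Lp ℂ 2 μ) : HHDual μ where
  toFun := ((innerSL ℂ).flip f).toLinearMap.comp (HH μ).subtype
  bound := by
    refine ⟨‖f‖ * (‖trace μ‖ + 1), fun h => ?_⟩
    change ‖inner ℂ (h : Lp ℂ 2 μ) f‖ ≤ _
    refine (norm_inner_le_norm _ _).trans ?_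
    rw [mul_comm, mul_assoc]
    exact mul_le_mul_of_nonneg_left (norm_le_normHH μ h) (norm_nonneg f)

/-- The functional `v ↦ ℓ(Tr̃ v)` on `H¹(ℝⁿ)`, for `ℓ ∈ ℍ*(Γ, μ)`. -/
def HHDual.compTrace {μ : Measure (E n)} [IsFiniteMeasure μ] (ℓ : HHDual μ) : H n 1 →L⋆[ℂ] ℂ :=
  LinearMap.mkContinuousOfExistsBound (ℓ.toFun.comp (trace μ).toLinearMap.rangeRestrict) <| by
    obtain ⟨C, hC⟩ := ℓ.bound
    refine ⟨|C|, fun v => (hC _).trans ?_⟩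
    exact (mul_le_mul_of_nonneg_right (le_abs_self C) (normHH_nonneg μ _)).trans
      (mul_le_mul_of_nonneg_left (normHH_trace_le μ v) (abs_nonneg C))

/-- The adjoint `ℍ*(Γ, μ) → H^{-1}_Γ` of the trace operator regarded as a map to `ℍ(Γ, μ)`:
`⟨adjHH ℓ, v⟩ = ℓ(Tr̃ v)`. -/
def adjHH (ℓ : HHDual μ) : H n (-1) := ofAntidual ℓ.compTrace

/-- The operator `𝔸 : ℍ*(Γ, μ) → ℍ(Γ, μ)`: the composition of the trace operator, `A`, and the
adjoint of the trace operator. -/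
def opAA (k : ℝ) (Γ : Set (E n)) (χ : 𝓢(E n, ℂ)) (ℓ : HHDual μ) : HH μ :=
  ⟨trace μ (opA k Γ χ (adjHH μ ℓ)), LinearMap.mem_range_self _ _⟩

end Trace

/-! ### The assumption on singular integrals -/

/-- The function `f_n`, with the value `∞` at `r = 0`. -/
def singFun (n : ℕ) (r : ℝ) : ℝ≥0∞ :=
  if r = 0 then ∞
  else if n = 2 then ENNReal.ofReal |Real.log r| else ENNReal.ofReal (r ^ (2 - (n : ℝ)))

/-- `sup_x ∫_{B_r(x)} f_n(|x - y|) dμ(y) → 0` as `r → 0⁺`. -/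
def UniformlySmallPotential {n : ℕ} (μ : Measure (E n)) : Prop :=
  Tendsto (fun r : ℝ => ⨆ x : E n, ∫⁻ y in Metric.closedBall x r, singFun n ‖x - y‖ ∂μ)
    (𝓝[>] 0) (𝓝 0)

/-! ### Piecewise constant Galerkin discretisation -/

/-- `T_1, …, T_M` is a mesh of `Γ`. -/
structure IsMesh {n : ℕ} (μ : Measure (E n)) (Γ : Set (E n)) {M : ℕ} (T : Fin M → Set (E n)) :
    Prop where
  measurable : ∀ j, NullMeasurableSet (T j) μ
  subset : ∀ j, T j ⊆ Γ
  cover : μ (Γ \ ⋃ j, T j) = 0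
  pos : ∀ j, 0 < μ (T j)
  disjoint : ∀ i j, i ≠ j → μ (T i ∩ T j) = 0

/-- The space of the functions in `L^∞(Γ, μ)` that are constant on each element of the mesh. -/
def meshSpace {n : ℕ} (μ : Measure (E n)) {M : ℕ} (T : Fin M → Set (E n)) :
    Submodule ℂ (Lp ℂ 2 μ) where
  carrier := {f | MemLp f ∞ μ ∧ ∃ c : Fin M → ℂ, ∀ j, ∀ᵐ x ∂μ, x ∈ T j → f x = c j}
  zero_mem' := by
    refine ⟨(memLp_congr_ae (Lp.coeFn_zero ℂ 2 μ)).mpr MemLp.zero, 0, fun j => ?_⟩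
    filter_upwards [Lp.coeFn_zero ℂ 2 μ] with x hx _
    simpa using hx
  add_mem' := by
    rintro f g ⟨hf, c, hc⟩ ⟨hg, d, hd⟩
    refine ⟨(memLp_congr_ae (Lp.coeFn_add f g)).mpr (hf.add hg), c + d, fun j => ?_⟩
    filter_upwards [Lp.coeFn_add f g, hc j, hd j] with x hx h1 h2 hxT
    rw [Pi.add_apply, ← h1 hxT, ← h2 hxT]
    exact hx
  smul_mem' := by
    rintro a f ⟨hf, c, hc⟩
    refine ⟨(memLp_congr_ae (Lp.coeFn_smul a f)).mpr (hf.const_smul a), a • c, fun j => ?_⟩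
    filter_upwards [Lp.coeFn_smul a f, hc j] with x hx h1 hxT
    simp [hx, h1 hxT]

end Scattering

end

open Scattering

/-! The formulas say that, on densities f against μ, the abstract operators are integral operators
with kernel Φ. The adjoint T* sends f to the distribution f μ (`dist_traceAdj`), so χ𝒜T*f should be
χ times the potential ∫ Φ(·, y) f(y) dμ(y). The projection P is invisible to the trace: T vanishes
on the closure of C₀^∞(Γᶜ), which is the kernel of P, hence TP = T (`trace_projV1`). The entries b_i
and a_ij therefore only require the traces of χ u^inc and of χ𝒜T*f. If an element of H¹ is given by
an integrable, compactly supported function continuous at the points of Γ, its mollifications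
converge to it in H¹, hence their traces converge in L²(μ), and they also converge pointwise on Γ.
So the trace is the restriction (`trace_eq_of_continuousAt`).

The analytic core is that χ𝒜 maps H⁻¹_Γ into H¹. Only bounded |x - y| matter, so Φ may be replaced
by an even, compactly supported, integrable kernel K (`exists_truncated_kernel`), and it suffices
that |K̂(ξ)| ≤ D / (1 + |2πξ|²). As a function φ of s = |x - y|², Φ is a constant times (k²s)^{-ν/2}
H_ν(k√s), ν = (n - 2)/2, and differentiation in s merely raises ν. The contour integral for H_ν
yields smoothness, bounds at the origin, and the equation 4sφ'' + 2nφ' + k²φ = 0. When |x|² is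
regularised to |x|² + δ², the Laplacian stays bounded in L¹ uniformly in δ: the equation leaves a
term of size |x|^{1-n}, and the remainder is dominated by an approximate identity of fixed mass.
Hence the decay of K̂, with no need to identify the Dirac mass in the limit
(`IsRadialParametrix.exists_norm_fourier_le`).

With 𝒜 transposed onto test functions, Fubini identifies 𝒜T*f with the potential of f μ
(`newton_traceAdj`). Off Γ the kernel is continuous, so the potential is continuous on Ω, and a
distribution has at most one continuous representative. Under the smallness condition the potentials
of bounded densities are uniform limits of potentials with continuous kernels, hence continuous
everywhere (`UniformlySmallPotential.continuous_potential`). The trace is then the potential itself,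
which gives the double integral. -/

noncomputable section

namespace Scattering

/-! ### The Hankel function -/

/-- The contribution of a half line to the Schläfli-Sommerfeld integral. -/
def expInt (ν z : ℝ) : ℂ := ∫ t in Ioi (0 : ℝ), Complex.exp (-z * Real.sinh t + ν * t)

/-- The contribution of the segment from `0` to `π i` to the Schläfli-Sommerfeld integral. -/
def arcInt (ν z : ℝ) : ℂ :=
  ∫ t in (0 : ℝ)..Real.pi, Complex.exp (Complex.I * (z * Real.sin t - ν * t))

theorem hankel1_eq (ν z : ℝ) : hankel1 ν z = 1 / (Real.pi * Complex.I) *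
    (expInt ν z + Complex.I * arcInt ν z
      + Complex.exp (-Complex.I * ν * Real.pi) * expInt (-ν) z) := by
  simp only [hankel1, expInt, arcInt, Complex.ofReal_neg, neg_mul, sub_eq_add_neg]

theorem sq_div_four_le_sinh {t : ℝ} (ht : 0 ≤ t) : t ^ 2 / 4 ≤ Real.sinh t := by
  rw [Real.sinh_eq]
  have h1 := Real.quadratic_le_exp_of_nonneg ht
  have h2 : Real.exp (-t) ≤ 1 := Real.exp_le_one_iff.mpr (by linarith)
  nlinarith

/-- Since sinh t ≥ t²/4 for t ≥ 0, completing the square bounds the integrand by a Gaussian: the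
slack in the exponent is (2/z)(ν - zt/4)². -/
theorem integrableOn_exp_sinh {z : ℝ} (hz : 0 < z) (ν : ℝ) :
    IntegrableOn (fun t => Real.exp (-z * Real.sinh t + ν * t)) (Ioi 0) := by
  have h := ((integrable_exp_neg_mul_sq (b := z / 8) (by positivity)).const_mul
    (Real.exp (2 * ν ^ 2 / z))).integrableOn (s := Ioi (0 : ℝ))
  refine h.mono' (by fun_prop) ?_
  filter_upwards [self_mem_ae_restrict measurableSet_Ioi] with t ht
  rw [Real.norm_eq_abs, Real.abs_exp, ← Real.exp_add]
  apply Real.exp_le_exp.mpr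
  have h1 := mul_le_mul_of_nonneg_left (sq_div_four_le_sinh (le_of_lt ht)) hz.le
  have h2 : 2 * ν ^ 2 / z + -(z / 8) * t ^ 2 - (-z * (t ^ 2 / 4) + ν * t)
      = 2 / z * (ν - z / 4 * t) ^ 2 := by
    field_simp
    ring
  have h3 : 0 ≤ 2 / z * (ν - z / 4 * t) ^ 2 := by positivity
  linarith

theorem norm_expInt_integrand (ν z t : ℝ) :
    ‖Complex.exp (-z * Real.sinh t + ν * t)‖ = Real.exp (-z * Real.sinh t + ν * t) := by
  rw [Complex.norm_exp]
  norm_cast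

theorem integrableOn_cexp_sinh {z : ℝ} (hz : 0 < z) (ν : ℝ) :
    IntegrableOn (fun t : ℝ => Complex.exp (-z * Real.sinh t + ν * t)) (Ioi 0) := by
  refine (integrableOn_exp_sinh hz ν).mono' ?_ ?_
  · exact (by fun_prop : Continuous fun t : ℝ =>
      Complex.exp (-z * Real.sinh t + ν * t)).aestronglyMeasurable
  · exact Eventually.of_forall fun t => (norm_expInt_integrand ν z t).le

theorem cexp_mul_sinh (ν z t : ℝ) :
    -(Real.sinh t : ℂ) * Complex.exp (-z * Real.sinh t + ν * t) =
      -(1 / 2) * (Complex.exp (-z * Real.sinh t + (ν + 1 : ℝ) * t)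
        - Complex.exp (-z * Real.sinh t + (ν - 1 : ℝ) * t)) := by
  have h1 : (-z * Real.sinh t + (ν + 1 : ℝ) * t : ℂ) = (-z * Real.sinh t + ν * t) + t := by
    push_cast; ring
  have h2 : (-z * Real.sinh t + (ν - 1 : ℝ) * t : ℂ) = (-z * Real.sinh t + ν * t) + -t := by
    push_cast; ring
  rw [h1, h2, Complex.exp_add _ (t : ℂ), Complex.exp_add _ (-t : ℂ), Complex.ofReal_sinh,
    Complex.sinh]
  ring

theorem cexp_mul_cosh (ν z t : ℝ) :
    (Real.cosh t : ℂ) * Complex.exp (-z * Real.sinh t + ν * t) =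
      (1 / 2) * (Complex.exp (-z * Real.sinh t + (ν + 1 : ℝ) * t)
        + Complex.exp (-z * Real.sinh t + (ν - 1 : ℝ) * t)) := by
  have h1 : (-z * Real.sinh t + (ν + 1 : ℝ) * t : ℂ) = (-z * Real.sinh t + ν * t) + t := by
    push_cast; ring
  have h2 : (-z * Real.sinh t + (ν - 1 : ℝ) * t : ℂ) = (-z * Real.sinh t + ν * t) + -t := by
    push_cast; ring
  rw [h1, h2, Complex.exp_add _ (t : ℂ), Complex.exp_add _ (-t : ℂ), Complex.ofReal_cosh,
    Complex.cosh]
  ring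

/-- Differentiation in z brings down -sinh t = -(eᵗ - e⁻ᵗ)/2, and the factors e^{±t} shift the order
by ±1. For w > z/2 the estimate sinh t ≤ eᵗ supplies an integrable majorant of order ν + 1. -/
theorem hasDerivAt_expInt (ν : ℝ) {z : ℝ} (hz : 0 < z) :
    HasDerivAt (expInt ν) (-(1 / 2) * (expInt (ν + 1) z - expInt (ν - 1) z)) z := by
  have key := hasDerivAt_integral_of_dominated_loc_of_deriv_le (μ := volume.restrict (Ioi (0 : ℝ)))
    (F := fun (w : ℝ) (t : ℝ) => Complex.exp (-w * Real.sinh t + ν * t))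
    (F' := fun (w : ℝ) (t : ℝ) => -(Real.sinh t : ℂ) * Complex.exp (-w * Real.sinh t + ν * t))
    (x₀ := z) (s := Ioi (z / 2))
    (bound := fun t => Real.exp (-(z / 2) * Real.sinh t + (ν + 1) * t))
    (Ioi_mem_nhds (by linarith)) (Eventually.of_forall fun w =>
      (by fun_prop : Continuous fun t : ℝ =>
        Complex.exp (-w * Real.sinh t + ν * t)).aestronglyMeasurable)
    (integrableOn_cexp_sinh hz ν)
    (by fun_prop : Continuous fun t : ℝ =>
      -(Real.sinh t : ℂ) * Complex.exp (-z * Real.sinh t + ν * t)).aestronglyMeasurable ?_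
    (integrableOn_exp_sinh (by positivity) _) ?_
  · refine HasDerivAt.congr_deriv (f := expInt ν) key.2 ?_
    simp only [cexp_mul_sinh]
    rw [integral_const_mul, integral_sub (integrableOn_cexp_sinh hz _)
      (integrableOn_cexp_sinh hz _)]
    rfl
  · filter_upwards [self_mem_ae_restrict measurableSet_Ioi] with t ht w hw
    rw [norm_mul, norm_neg, norm_expInt_integrand, Complex.norm_real, Real.norm_eq_abs,
      abs_of_nonneg (Real.sinh_nonneg_iff.mpr (le_of_lt ht))]
    have h0 : 0 ≤ Real.sinh t := Real.sinh_nonneg_iff.mpr (le_of_lt ht)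
    have h1 : Real.sinh t ≤ Real.exp t := by
      rw [Real.sinh_eq]
      linarith [Real.exp_pos t, Real.exp_pos (-t)]
    calc Real.sinh t * Real.exp (-w * Real.sinh t + ν * t)
        ≤ Real.exp t * Real.exp (-(z / 2) * Real.sinh t + ν * t) := by
          gcongr
          exact le_of_lt hw
      _ = _ := by rw [← Real.exp_add]; ring_nf
  · refine Eventually.of_forall fun t w _ => ?_
    have h : HasDerivAt (fun w : ℝ => (-w * Real.sinh t + ν * t : ℂ)) (-(Real.sinh t : ℂ)) w := by
      have := (((hasDerivAt_id w).ofReal_comp).neg.mul_const (Real.sinh t : ℂ)).add_const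
        (ν * t : ℂ)
      simpa using this
    simpa [mul_comm] using h.cexp

/-- The left side is the integral of the t-derivative of the integrand. Only the boundary value 1 at
t = 0 survives, with a minus sign. -/
theorem expInt_recurrence (ν : ℝ) {z : ℝ} (hz : 0 < z) :
    -z / 2 * (expInt (ν + 1) z + expInt (ν - 1) z) + ν * expInt ν z = -1 := by
  set F : ℝ → ℂ := fun t => Complex.exp (-z * Real.sinh t + ν * t) with hF
  set F' : ℝ → ℂ := fun t => -z / 2 * (Complex.exp (-z * Real.sinh t + (ν + 1 : ℝ) * t)
        + Complex.exp (-z * Real.sinh t + (ν - 1 : ℝ) * t)) +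
      ν * Complex.exp (-z * Real.sinh t + ν * t) with hF'
  have hd : ∀ t ∈ Ici (0 : ℝ), HasDerivAt F (F' t) t := by
    intro t _
    have h : HasDerivAt (fun t : ℝ => (-z * Real.sinh t + ν * t : ℂ))
        (-z * Real.cosh t + ν * 1) t := by
      exact (((Real.hasDerivAt_sinh t).ofReal_comp).const_mul (-z : ℂ)).add
        (((hasDerivAt_id t).ofReal_comp).const_mul (ν : ℂ))
    have h2 := h.cexp
    have h3 := cexp_mul_cosh ν z t
    convert h2 using 1
    simp only [hF']
    linear_combination z * h3
  have hi1 := integrableOn_cexp_sinh hz (ν + 1)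
  have hi2 := integrableOn_cexp_sinh hz (ν - 1)
  have hi3 := integrableOn_cexp_sinh hz ν
  have hi : IntegrableOn F' (Ioi 0) := ((hi1.add hi2).const_mul _).add (hi3.const_mul _)
  -- A function that is integrable together with its derivative tends to 0, so no separate estimate
  -- at infinity is needed.
  have ht := tendsto_zero_of_hasDerivAt_of_integrableOn_Ioi
    (fun x hx => hd x (Ioi_subset_Ici_self hx)) hi hi3
  have h := integral_Ioi_of_hasDerivAt_of_tendsto' hd hi ht
  have h2 : ∫ t in Ioi (0 : ℝ), F' t =
      -z / 2 * (expInt (ν + 1) z + expInt (ν - 1) z) + ν * expInt ν z := by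
    refine (integral_add ((hi1.add hi2).const_mul _) (hi3.const_mul _)).trans ?_
    rw [integral_const_mul, integral_const_mul]
    exact congrArg (fun w : ℂ => -(z : ℂ) / 2 * w + ν * expInt ν z)
      (integral_add (μ := volume.restrict (Ioi (0 : ℝ))) hi1 hi2)
  rw [← h2, h]
  simp [hF]

theorem cexp_mul_sin (ν z t : ℝ) :
    Complex.I * Real.sin t * Complex.exp (Complex.I * (z * Real.sin t - ν * t)) =
      (1 / 2) * (Complex.exp (Complex.I * (z * Real.sin t - (ν - 1 : ℝ) * t))
        - Complex.exp (Complex.I * (z * Real.sin t - (ν + 1 : ℝ) * t))) := by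
  have h1 : Complex.I * (z * Real.sin t - (ν - 1 : ℝ) * t : ℂ) =
      Complex.I * (z * Real.sin t - ν * t) + t * Complex.I := by
    push_cast; ring
  have h2 : Complex.I * (z * Real.sin t - (ν + 1 : ℝ) * t : ℂ) =
      Complex.I * (z * Real.sin t - ν * t) + -t * Complex.I := by
    push_cast; ring
  rw [h1, h2, Complex.exp_add _ (t * Complex.I), Complex.exp_add _ (-t * Complex.I),
    Complex.ofReal_sin]
  have h3 : Complex.sin t = (Complex.exp (-t * Complex.I) - Complex.exp (t * Complex.I)) *
    Complex.I / 2 := rfl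
  linear_combination (Complex.I * Complex.exp (Complex.I * (z * Complex.sin t - ν * t))) * h3 +
    (Complex.exp (-t * Complex.I) - Complex.exp (t * Complex.I)) / 2 *
    Complex.exp (Complex.I * (z * Complex.sin t - ν * t)) * Complex.I_sq

theorem cexp_mul_cos (ν z t : ℝ) :
    Real.cos t * Complex.exp (Complex.I * (z * Real.sin t - ν * t)) =
      (1 / 2) * (Complex.exp (Complex.I * (z * Real.sin t - (ν - 1 : ℝ) * t))
        + Complex.exp (Complex.I * (z * Real.sin t - (ν + 1 : ℝ) * t))) := by
  have h1 : Complex.I * (z * Real.sin t - (ν - 1 : ℝ) * t : ℂ) =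
      Complex.I * (z * Real.sin t - ν * t) + t * Complex.I := by
    push_cast; ring
  have h2 : Complex.I * (z * Real.sin t - (ν + 1 : ℝ) * t : ℂ) =
      Complex.I * (z * Real.sin t - ν * t) + -t * Complex.I := by
    push_cast; ring
  rw [h1, h2, Complex.exp_add _ (t * Complex.I), Complex.exp_add _ (-t * Complex.I),
    Complex.ofReal_cos, Complex.cos]
  ring

theorem norm_arcInt_integrand (ν z t : ℝ) :
    ‖Complex.exp (Complex.I * (z * Real.sin t - ν * t))‖ = 1 := by
  rw [mul_comm]
  exact_mod_cast Complex.norm_exp_ofReal_mul_I (z * Real.sin t - ν * t)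

theorem continuous_arcInt_integrand (ν z : ℝ) :
    Continuous fun t : ℝ => Complex.exp (Complex.I * (z * Real.sin t - ν * t)) := by
  fun_prop

theorem hasDerivAt_arcInt (ν z : ℝ) :
    HasDerivAt (arcInt ν) ((1 / 2) * (arcInt (ν - 1) z - arcInt (ν + 1) z)) z := by
  have key := intervalIntegral.hasDerivAt_integral_of_dominated_loc_of_deriv_le (μ := volume)
    (a := 0) (b := Real.pi)
    (F := fun (w : ℝ) (t : ℝ) => Complex.exp (Complex.I * (w * Real.sin t - ν * t)))
    (F' := fun (w : ℝ) (t : ℝ) =>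
      Complex.I * Real.sin t * Complex.exp (Complex.I * (w * Real.sin t - ν * t)))
    (x₀ := z) (s := univ) (bound := fun t => 1) univ_mem
    (Eventually.of_forall fun w => (continuous_arcInt_integrand ν w).aestronglyMeasurable)
    ((continuous_arcInt_integrand ν z).intervalIntegrable _ _)
    (by fun_prop : Continuous fun t : ℝ => Complex.I * Real.sin t *
      Complex.exp (Complex.I * (z * Real.sin t - ν * t))).aestronglyMeasurable ?_
    (continuous_const.intervalIntegrable _ _) ?_
  · refine HasDerivAt.congr_deriv (f := arcInt ν) key.2 ?_
    simp only [cexp_mul_sin]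
    rw [intervalIntegral.integral_const_mul, intervalIntegral.integral_sub
      ((continuous_arcInt_integrand _ z).intervalIntegrable _ _)
      ((continuous_arcInt_integrand _ z).intervalIntegrable _ _)]
    rfl
  · refine Eventually.of_forall fun t _ w _ => ?_
    rw [norm_mul, norm_arcInt_integrand, norm_mul, Complex.norm_I, Complex.norm_real]
    simpa using Real.abs_sin_le_one t
  · refine Eventually.of_forall fun t _ w _ => ?_
    have h : HasDerivAt (fun w : ℝ => Complex.I * (w * Real.sin t - ν * t : ℂ))
        (Complex.I * Real.sin t) w := by
      have := ((((hasDerivAt_id w).ofReal_comp).mul_const (Real.sin t : ℂ)).sub_const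
        (ν * t : ℂ)).const_mul Complex.I
      simpa using this
    simpa [mul_comm] using h.cexp

theorem arcInt_recurrence (ν z : ℝ) :
    Complex.I * (z / 2 * (arcInt (ν - 1) z + arcInt (ν + 1) z) - ν * arcInt ν z) =
      Complex.exp (-Complex.I * ν * Real.pi) - 1 := by
  have hc := fun ν => (continuous_arcInt_integrand ν z).intervalIntegrable
    (μ := volume) 0 Real.pi
  have h := intervalIntegral.integral_eq_sub_of_hasDerivAt (a := 0) (b := Real.pi)
    (f := fun t : ℝ => Complex.exp (Complex.I * (z * Real.sin t - ν * t)))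
    (f' := fun t : ℝ => Complex.I * (z / 2 *
      (Complex.exp (Complex.I * (z * Real.sin t - (ν - 1 : ℝ) * t))
        + Complex.exp (Complex.I * (z * Real.sin t - (ν + 1 : ℝ) * t)))
        - ν * Complex.exp (Complex.I * (z * Real.sin t - ν * t)))) ?_ ?_
  · rw [intervalIntegral.integral_const_mul, intervalIntegral.integral_sub
      (((hc _).add (hc _)).const_mul _) ((hc _).const_mul _), intervalIntegral.integral_const_mul,
      intervalIntegral.integral_const_mul, intervalIntegral.integral_add (hc _) (hc _)] at h
    refine Eq.trans h ?_
    simp [mul_assoc]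
  · intro t _
    have h : HasDerivAt (fun t : ℝ => Complex.I * (z * Real.sin t - ν * t : ℂ))
        (Complex.I * (z * Real.cos t - ν * 1)) t := by
      exact ((((Real.hasDerivAt_sin t).ofReal_comp).const_mul (z : ℂ)).sub
        (((hasDerivAt_id t).ofReal_comp).const_mul (ν : ℂ))).const_mul Complex.I
    refine h.cexp.congr_deriv ?_
    linear_combination (Complex.I * z) * cexp_mul_cos ν z t
  · exact ((((hc _).add (hc _)).const_mul _).sub ((hc _).const_mul _)).const_mul _

theorem cexp_neg_I_mul_pi_add_one (ν : ℝ) :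
    Complex.exp (-Complex.I * (ν + 1 : ℝ) * Real.pi) = -Complex.exp (-Complex.I * ν * Real.pi) := by
  have : -Complex.I * (ν + 1 : ℝ) * Real.pi
      = -Complex.I * ν * Real.pi - Real.pi * Complex.I := by
    push_cast; ring
  rw [this, Complex.exp_sub_pi_mul_I]

theorem cexp_neg_I_mul_pi_sub_one (ν : ℝ) :
    Complex.exp (-Complex.I * (ν - 1 : ℝ) * Real.pi) = -Complex.exp (-Complex.I * ν * Real.pi) := by
  have h := cexp_neg_I_mul_pi_add_one (ν - 1)
  rw [sub_add_cancel] at h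
  rw [h, neg_neg]

theorem hasDerivAt_hankel1 (ν : ℝ) {z : ℝ} (hz : 0 < z) :
    HasDerivAt (hankel1 ν) ((1 / 2) * (hankel1 (ν - 1) z - hankel1 (ν + 1) z)) z := by
  have h := (((hasDerivAt_expInt ν hz).add ((hasDerivAt_arcInt ν z).const_mul Complex.I)).add
    ((hasDerivAt_expInt (-ν) hz).const_mul
      (Complex.exp (-Complex.I * ν * Real.pi)))).const_mul (1 / (Real.pi * Complex.I))
  refine (h.congr_of_eventuallyEq (Eventually.of_forall fun w => hankel1_eq ν w)).congr_deriv ?_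
  rw [hankel1_eq, hankel1_eq, cexp_neg_I_mul_pi_sub_one, cexp_neg_I_mul_pi_add_one,
    show -(ν - 1) = -ν + 1 by ring, show -(ν + 1) = -ν - 1 by ring]
  ring

/-- The recurrences of the three pieces of the contour carry boundary terms from its two corners.
They cancel because consecutive pieces share their end points, the last piece carrying the factor
e^{-iνπ}. -/
theorem hankel1_recurrence (ν : ℝ) {z : ℝ} (hz : 0 < z) :
    (z : ℂ) * (hankel1 (ν - 1) z + hankel1 (ν + 1) z) = 2 * ν * hankel1 ν z := by
  have h1 := expInt_recurrence ν hz
  have h2 := arcInt_recurrence ν z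
  have h3 := expInt_recurrence (-ν) hz
  rw [hankel1_eq, hankel1_eq, hankel1_eq, cexp_neg_I_mul_pi_sub_one, cexp_neg_I_mul_pi_add_one,
    show -(ν - 1) = -ν + 1 by ring, show -(ν + 1) = -ν - 1 by ring]
  push_cast at h3
  linear_combination (1 / (Real.pi * Complex.I)) * (-2 * h1 + 2 * h2 +
    2 * Complex.exp (-Complex.I * ν * Real.pi) * h3)

/-! ### Bounds near the origin -/

theorem integrable_exp_sub_exp {ν : ℝ} (hν : 0 < ν) :
    Integrable fun t : ℝ => Real.exp (ν * t - Real.exp t) := by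
  rw [← integrableOn_univ, ← Iic_union_Ioi (a := (0 : ℝ)), integrableOn_union]
  constructor
  · refine (integrableOn_exp_mul_Iic hν 0).mono' (by fun_prop) ?_
    refine Eventually.of_forall fun t => ?_
    rw [Real.norm_eq_abs, Real.abs_exp]
    exact Real.exp_le_exp.mpr (by linarith [Real.exp_pos t])
  · refine (integrableOn_exp_sinh one_pos ν).mono' (by fun_prop) ?_
    refine Eventually.of_forall fun t => ?_
    rw [Real.norm_eq_abs, Real.abs_exp]
    apply Real.exp_le_exp.mpr
    rw [Real.sinh_eq]
    linarith [Real.exp_pos t, Real.exp_pos (-t)]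

theorem norm_expInt_le (ν z : ℝ) :
    ‖expInt ν z‖ ≤ ∫ t in Ioi (0 : ℝ), Real.exp (-z * Real.sinh t + ν * t) := by
  refine (norm_integral_le_integral_norm _).trans (le_of_eq ?_)
  simp only [norm_expInt_integrand]

/-- For t ≥ 0 one has z sinh t ≥ (z/2)eᵗ - z/2. The translation t ↦ t + log(z/2) then extracts the
power (z/2)^{-ν} and leaves the Gamma integral in logarithmic form. -/
theorem integral_exp_sinh_le {ν z : ℝ} (hν : 0 < ν) (hz : 0 < z) :
    ∫ t in Ioi (0 : ℝ), Real.exp (-z * Real.sinh t + ν * t) ≤ Real.exp (z / 2) * (z / 2) ^ (-ν) *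
      ∫ t, Real.exp (ν * t - Real.exp t) := by
  have hsh : Integrable fun t : ℝ =>
      Real.exp (ν * (t + Real.log (z / 2)) - Real.exp (t + Real.log (z / 2))) :=
    (integrable_exp_sub_exp hν).comp_add_right (Real.log (z / 2))
  calc ∫ t in Ioi (0 : ℝ), Real.exp (-z * Real.sinh t + ν * t)
      ≤ ∫ t in Ioi (0 : ℝ), Real.exp (z / 2) * (z / 2) ^ (-ν) *
          Real.exp (ν * (t + Real.log (z / 2)) - Real.exp (t + Real.log (z / 2))) := by
        refine setIntegral_mono_on (integrableOn_exp_sinh hz ν) (hsh.const_mul _).integrableOn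
          measurableSet_Ioi fun t ht => ?_
        rw [Real.rpow_def_of_pos (by positivity), ← Real.exp_add, ← Real.exp_add]
        apply Real.exp_le_exp.mpr
        rw [Real.exp_add t, Real.exp_log (by positivity), Real.sinh_eq]
        have : Real.exp (-t) ≤ 1 := Real.exp_le_one_iff.mpr (by linarith [mem_Ioi.mp ht])
        nlinarith
    _ ≤ ∫ t, Real.exp (z / 2) * (z / 2) ^ (-ν) *
          Real.exp (ν * (t + Real.log (z / 2)) - Real.exp (t + Real.log (z / 2))) := by
        refine setIntegral_le_integral (hsh.const_mul _) (Eventually.of_forall fun t => ?_)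
        positivity
    _ = _ := by
        rw [integral_const_mul, integral_add_right_eq_self
          (fun t => Real.exp (ν * t - Real.exp t)) (Real.log (z / 2))]

theorem norm_expInt_neg_le {ν z : ℝ} (hν : 0 ≤ ν) (hz : 0 < z) :
    ‖expInt (-ν) z‖ ≤ ∫ t in Ioi (0 : ℝ), Real.exp (-z * Real.sinh t + ν * t) := by
  refine (norm_expInt_le _ _).trans ?_
  refine setIntegral_mono_on (integrableOn_exp_sinh hz _) (integrableOn_exp_sinh hz _)
    measurableSet_Ioi fun t ht => ?_
  apply Real.exp_le_exp.mpr
  nlinarith [mem_Ioi.mp ht]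

theorem norm_arcInt_le (ν z : ℝ) : ‖arcInt ν z‖ ≤ Real.pi := by
  have h := intervalIntegral.norm_integral_le_of_norm_le_const (a := 0) (b := Real.pi) (C := 1)
    (f := fun t : ℝ => Complex.exp (Complex.I * (z * Real.sin t - ν * t)))
    (fun t _ => (norm_arcInt_integrand ν z t).le)
  simpa [arcInt, abs_of_pos Real.pi_pos] using h

theorem exists_norm_hankel1_le {ν : ℝ} (hν : 0 < ν) (B : ℝ) :
    ∃ C, 0 ≤ C ∧ ∀ z, 0 < z → z ≤ B → ‖hankel1 ν z‖ ≤ C * z ^ (-ν) := by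
  rcases le_or_gt B 0 with hB | hB
  · exact ⟨0, le_rfl, fun z h1 h2 => absurd h1 (by linarith)⟩
  set K := ∫ t, Real.exp (ν * t - Real.exp t)
  have hK : 0 ≤ K := integral_nonneg fun t => (Real.exp_pos _).le
  -- The factor 2 counts the two half lines. The arc contributes at most π, which is absorbed
  -- through 1 ≤ B^ν z^{-ν} for z ≤ B.
  refine ⟨1 / Real.pi * (2 * (Real.exp (B / 2) * 2 ^ ν * K) + Real.pi * B ^ ν), by positivity,
    fun z hz hzB => ?_⟩
  have h1 : ∫ t in Ioi (0 : ℝ), Real.exp (-z * Real.sinh t + ν * t) ≤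
      Real.exp (B / 2) * 2 ^ ν * K * z ^ (-ν) := by
    refine (integral_exp_sinh_le hν hz).trans ?_
    have : (z / 2) ^ (-ν) = 2 ^ ν * z ^ (-ν) := by
      rw [Real.div_rpow hz.le (by norm_num), Real.rpow_neg (x := 2) (by norm_num), div_inv_eq_mul,
        mul_comm]
    rw [this]
    calc Real.exp (z / 2) * (2 ^ ν * z ^ (-ν)) * K ≤ Real.exp (B / 2) * (2 ^ ν * z ^ (-ν)) * K := by
          gcongr
      _ = _ := by ring
  have h2 : 1 ≤ B ^ ν * z ^ (-ν) := by
    rw [Real.rpow_neg hz.le, ← div_eq_mul_inv, one_le_div (by positivity)]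
    exact Real.rpow_le_rpow hz.le hzB hν.le
  have h3 : ‖Complex.exp (-Complex.I * ν * Real.pi)‖ = 1 := by
    have h := Complex.norm_exp_ofReal_mul_I (-(ν * Real.pi))
    rw [← h]
    congr 2
    push_cast
    ring
  have h4 : ‖(1 / (Real.pi * Complex.I) : ℂ)‖ = 1 / Real.pi := by
    simp [abs_of_pos Real.pi_pos]
  rw [hankel1_eq, norm_mul, h4, mul_assoc (1 / Real.pi)]
  refine mul_le_mul_of_nonneg_left ?_ (one_div_nonneg.mpr Real.pi_pos.le)
  refine norm_add₃_le.trans ?_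
  rw [norm_mul, norm_mul, h3, Complex.norm_I, one_mul, one_mul]
  have h5 := (norm_expInt_le ν z).trans h1
  have h6 := (norm_expInt_neg_le hν.le hz).trans h1
  have h7 := norm_arcInt_le ν z
  have h8 : Real.pi ≤ Real.pi * (B ^ ν * z ^ (-ν)) := le_mul_of_one_le_right Real.pi_pos.le h2
  nlinarith

/-! ### The fundamental solution as a function of the squared distance -/

/-- `s ↦ s^{-ν/2} H_ν^{(1)}(√s)`. -/
def hankelSq (ν s : ℝ) : ℂ := ((s ^ (-(ν / 2)) : ℝ) : ℂ) * hankel1 ν (√s)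

theorem rpow_neg_add_one_div_two (ν : ℝ) {s : ℝ} (hs : 0 < s) :
    s ^ (-((ν + 1) / 2)) = s ^ (-(ν / 2)) * (√s)⁻¹ := by
  rw [show -((ν + 1) / 2) = -(ν / 2) + -(1 / 2) by ring, Real.rpow_add hs,
    Real.rpow_neg hs.le (1 / 2), ← Real.sqrt_eq_rpow]

/-- The product rule gives H_{ν-1}, H_ν and H_{ν+1}. The three-term recurrence eliminates the first
two, so that differentiation in s only raises the order. -/
theorem hasDerivAt_hankelSq (ν : ℝ) {s : ℝ} (hs : 0 < s) :
    HasDerivAt (hankelSq ν) (-(1 / 2) * hankelSq (ν + 1) s) s := by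
  have hq : 0 < √s := Real.sqrt_pos.mpr hs
  have h1 : HasDerivAt (fun s : ℝ => ((s ^ (-(ν / 2)) : ℝ) : ℂ))
      ((-(ν / 2) * s ^ (-(ν / 2) - 1) : ℝ) : ℂ) s :=
    (Real.hasDerivAt_rpow_const (Or.inl hs.ne')).ofReal_comp
  have h2 : HasDerivAt (fun s : ℝ => hankel1 ν (√s))
      ((1 / (2 * √s) : ℝ) • ((1 / 2) * (hankel1 (ν - 1) (√s) - hankel1 (ν + 1) (√s)))) s :=
    (hasDerivAt_hankel1 ν hq).scomp s (Real.hasDerivAt_sqrt hs.ne')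
  refine (h1.mul h2).congr_deriv ?_
  have hrec := hankel1_recurrence ν hq
  have e1 : s ^ (-(ν / 2) - 1) = s ^ (-(ν / 2)) * (√s)⁻¹ * (√s)⁻¹ := by
    rw [Real.rpow_sub_one hs.ne', mul_assoc, ← mul_inv, Real.mul_self_sqrt hs.le, div_eq_mul_inv]
  have e2 := rpow_neg_add_one_div_two ν hs
  simp only [hankelSq, e1, e2]
  set q := √s
  have hq' : (q : ℂ) ≠ 0 := by exact_mod_cast hq.ne'
  rw [Complex.real_smul]
  push_cast
  field_simp
  linear_combination ((s ^ (-(ν / 2)) : ℝ) : ℂ) * hrec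

/-- Because derivatives raise the order, the recurrence at order ν + 1 is Bessel's equation in the
variable s. -/
theorem hankelSq_recurrence (ν : ℝ) {s : ℝ} (hs : 0 < s) :
    (s : ℂ) * hankelSq (ν + 2) s - 2 * (ν + 1) * hankelSq (ν + 1) s + hankelSq ν s = 0 := by
  have hq : 0 < √s := Real.sqrt_pos.mpr hs
  have hrec := hankel1_recurrence (ν + 1) hq
  rw [add_sub_cancel_right, add_assoc, one_add_one_eq_two] at hrec
  have e2 := rpow_neg_add_one_div_two ν hs
  have e3 : s ^ (-((ν + 2) / 2)) = s ^ (-(ν / 2)) * s⁻¹ := by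
    rw [show -((ν + 2) / 2) = -(ν / 2) + -1 by ring, Real.rpow_add hs, Real.rpow_neg_one]
  simp only [hankelSq, e2, e3]
  have hs' : (s : ℂ) ≠ 0 := by exact_mod_cast hs.ne'
  have hq' : (√s : ℂ) ≠ 0 := by exact_mod_cast hq.ne'
  push_cast at hrec ⊢
  field_simp
  linear_combination ((s ^ (-(ν / 2)) : ℝ) : ℂ) * hrec

theorem contDiffOn_hankelSq (ν : ℝ) : ContDiffOn ℝ (↑(⊤ : ℕ∞)) (hankelSq ν) (Ioi 0) := by
  rw [contDiffOn_infty]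
  intro m
  induction m generalizing ν with
  | zero =>
    exact contDiffOn_zero.mpr fun s hs =>
      (hasDerivAt_hankelSq ν hs).continuousAt.continuousWithinAt
  | succ m ih =>
    rw [Nat.cast_add, Nat.cast_one, contDiffOn_succ_iff_deriv_of_isOpen isOpen_Ioi]
    refine ⟨fun s hs => (hasDerivAt_hankelSq ν hs).differentiableAt.differentiableWithinAt,
      fun h => absurd h (by simp), ?_⟩
    exact ((ih (ν + 1)).const_smul (-(1 / 2) : ℂ)).congr fun s hs =>
      (hasDerivAt_hankelSq ν hs).deriv

theorem exists_norm_hankelSq_le {ν : ℝ} (hν : 0 < ν) (B : ℝ) :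
    ∃ C, 0 ≤ C ∧ ∀ s, 0 < s → s ≤ B → ‖hankelSq ν s‖ ≤ C * s ^ (-ν) := by
  obtain ⟨C, hC, h⟩ := exists_norm_hankel1_le hν (√B)
  refine ⟨C, hC, fun s hs hsB => ?_⟩
  have h1 := h (√s) (Real.sqrt_pos.mpr hs) (Real.sqrt_le_sqrt hsB)
  rw [hankelSq, norm_mul, Complex.norm_real, Real.norm_eq_abs, abs_of_pos (by positivity)]
  calc s ^ (-(ν / 2)) * ‖hankel1 ν √s‖ ≤ s ^ (-(ν / 2)) * (C * √s ^ (-ν)) := by gcongr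
    _ = C * s ^ (-ν) := by
      rw [Real.sqrt_eq_rpow, ← Real.rpow_mul hs.le, mul_left_comm, ← Real.rpow_add hs]
      ring_nf

/-- The Gamma integral diverges for ν = 0. Instead, the derivative is -1/2 times the function of
order 1, of size O(1/t), and integrating it from s to B produces the logarithm. -/
theorem exists_norm_hankelSq_zero_le (B : ℝ) :
    ∃ C, 0 ≤ C ∧ ∀ s, 0 < s → s ≤ B → ‖hankelSq 0 s‖ ≤ C * (1 + |Real.log s|) := by
  rcases le_or_gt B 0 with hB | hB
  · exact ⟨0, le_rfl, fun z h1 h2 => absurd h1 (by linarith)⟩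
  obtain ⟨C, hC, h⟩ := exists_norm_hankelSq_le one_pos B
  refine ⟨‖hankelSq 0 B‖ + C * |Real.log B| + C, by positivity, fun s hs hsB => ?_⟩
  have h1 : ∀ t ∈ uIcc s B, HasDerivAt (hankelSq 0) (-(1 / 2) * hankelSq 1 t) t := by
    intro t ht
    rw [uIcc_of_le hsB] at ht
    simpa using hasDerivAt_hankelSq 0 (hs.trans_le ht.1)
  have h2 : ContinuousOn (fun t => -(1 / 2) * hankelSq 1 t) (uIcc s B) := by
    intro t ht
    rw [uIcc_of_le hsB] at ht
    exact ((hasDerivAt_hankelSq 1 (hs.trans_le ht.1)).continuousAt.const_mul _).continuousWithinAt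
  have h3 := intervalIntegral.integral_eq_sub_of_hasDerivAt h1 h2.intervalIntegrable
  have h0 : (0 : ℝ) ∉ uIcc s B := by
    rw [uIcc_of_le hsB]
    exact fun h => absurd h.1 (by linarith)
  have h4 : ‖∫ t in s..B, -(1 / 2) * hankelSq 1 t‖ ≤ ∫ t in s..B, C * t⁻¹ := by
    refine intervalIntegral.norm_integral_le_of_norm_le hsB (Eventually.of_forall fun t ht => ?_)
      ((intervalIntegral.intervalIntegrable_inv (fun t ht => ?_) continuousOn_id).const_mul _)
    · have h5 := h t (hs.trans ht.1) ht.2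
      rw [Real.rpow_neg_one] at h5
      rw [norm_mul]
      have : ‖(-(1 / 2) : ℂ)‖ = 1 / 2 := by simp
      rw [this]
      linarith [norm_nonneg (hankelSq 1 t)]
    · rintro rfl
      exact h0 ht
  rw [h3, intervalIntegral.integral_const_mul, integral_inv h0,
    Real.log_div hB.ne' hs.ne'] at h4
  have h5 : ‖hankelSq 0 s‖ ≤ ‖hankelSq 0 B‖ + ‖hankelSq 0 B - hankelSq 0 s‖ := by
    have := norm_sub_le (hankelSq 0 B) (hankelSq 0 B - hankelSq 0 s)
    rwa [sub_sub_cancel] at this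
  have h6 : C * (Real.log B - Real.log s) ≤ C * (|Real.log B| + |Real.log s|) := by
    gcongr
    linarith [le_abs_self (Real.log B), neg_abs_le (Real.log s)]
  have h7 : 0 ≤ (‖hankelSq 0 B‖ + C * |Real.log B|) * |Real.log s| := by positivity
  nlinarith

/-- The fundamental solution is `Φ(x, y) = phiSq n k (|x - y|²)`. -/
def phiSq (n : ℕ) (k s : ℝ) : ℂ :=
  Complex.I / 4 * (((k ^ 2 / (2 * Real.pi)) ^ (((n : ℝ) - 2) / 2) : ℝ) : ℂ) *
    hankelSq (((n : ℝ) - 2) / 2) (k ^ 2 * s)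

theorem Phi_eq_phiSq {n : ℕ} {k : ℝ} (hk : 0 < k) {x y : E n} (h : x ≠ y) :
    Phi k x y = phiSq n k (‖x - y‖ ^ 2) := by
  have hr : 0 < ‖x - y‖ := norm_pos_iff.mpr (sub_ne_zero.mpr h)
  set r := ‖x - y‖ with hrdef
  set ν := ((n : ℝ) - 2) / 2
  have h1 : √(k ^ 2 * r ^ 2) = k * r := by
    rw [← mul_pow, Real.sqrt_sq (by positivity)]
  have h2 : (k / (2 * Real.pi * r)) ^ ν =
      (k ^ 2 / (2 * Real.pi)) ^ ν * (k ^ 2 * r ^ 2) ^ (-(ν / 2)) := by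
    rw [← mul_pow, ← Real.rpow_natCast (k * r), ← Real.rpow_mul (by positivity),
      show ((2 : ℕ) : ℝ) * -(ν / 2) = -ν by push_cast; ring, Real.rpow_neg (by positivity),
      ← div_eq_mul_inv, ← Real.div_rpow (by positivity) (by positivity)]
    congr 1
    field_simp
  simp only [Phi, phiSq, hankelSq, ← hrdef, h1]
  rw [h2]
  push_cast
  ring

/-- The first derivative of `phiSq`. -/
def phiSq' (n : ℕ) (k s : ℝ) : ℂ :=
  Complex.I / 4 * (((k ^ 2 / (2 * Real.pi)) ^ (((n : ℝ) - 2) / 2) : ℝ) : ℂ) *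
    (-(k ^ 2 / 2) * hankelSq (((n : ℝ) - 2) / 2 + 1) (k ^ 2 * s))

/-- The second derivative of `phiSq`. -/
def phiSq'' (n : ℕ) (k s : ℝ) : ℂ :=
  Complex.I / 4 * (((k ^ 2 / (2 * Real.pi)) ^ (((n : ℝ) - 2) / 2) : ℝ) : ℂ) *
    (k ^ 4 / 4 * hankelSq (((n : ℝ) - 2) / 2 + 2) (k ^ 2 * s))

theorem hasDerivAt_hankelSq_mul (ν : ℝ) {k s : ℝ} (hk : 0 < k) (hs : 0 < s) :
    HasDerivAt (fun s => hankelSq ν (k ^ 2 * s)) (-(k ^ 2 / 2) * hankelSq (ν + 1) (k ^ 2 * s)) s := by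
  have h := (hasDerivAt_hankelSq ν (s := k ^ 2 * s) (by positivity)).scomp s
    ((hasDerivAt_id s).const_mul (k ^ 2))
  refine h.congr_deriv ?_
  rw [mul_one, Complex.real_smul]
  push_cast
  ring

theorem hasDerivAt_phiSq (n : ℕ) {k s : ℝ} (hk : 0 < k) (hs : 0 < s) :
    HasDerivAt (phiSq n k) (phiSq' n k s) s :=
  (hasDerivAt_hankelSq_mul _ hk hs).const_mul _

theorem hasDerivAt_phiSq' (n : ℕ) {k s : ℝ} (hk : 0 < k) (hs : 0 < s) :
    HasDerivAt (phiSq' n k) (phiSq'' n k s) s := by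
  refine (((hasDerivAt_hankelSq_mul _ hk hs).const_mul _).const_mul _).congr_deriv ?_
  rw [phiSq'', add_assoc, one_add_one_eq_two]
  ring

/-- This is the Helmholtz equation for radial functions, since Δ(g(|x|²)) = 4|x|² g'' + 2n g'. -/
theorem phiSq_ode (n : ℕ) {k s : ℝ} (hk : 0 < k) (hs : 0 < s) :
    4 * s * phiSq'' n k s + 2 * n * phiSq' n k s + k ^ 2 * phiSq n k s = 0 := by
  have h := hankelSq_recurrence (((n : ℝ) - 2) / 2) (s := k ^ 2 * s) (by positivity)
  simp only [phiSq, phiSq', phiSq'']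
  push_cast at h ⊢
  linear_combination (Complex.I / 4 * ((((k ^ 2 / (2 * Real.pi)) ^ (((n : ℝ) - 2) / 2) : ℝ) : ℂ))
    * k ^ 2) * h

theorem contDiffOn_phiSq (n : ℕ) {k : ℝ} (hk : 0 < k) :
    ContDiffOn ℝ (↑(⊤ : ℕ∞)) (phiSq n k) (Ioi 0) := by
  refine ContDiffOn.mul contDiffOn_const ?_
  refine (contDiffOn_hankelSq _).comp (g := hankelSq _) (f := fun s => k ^ 2 * s) ?_ ?_
  · exact (contDiff_const.mul contDiff_id).contDiffOn
  · intro s hs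
    exact mul_pos (pow_pos hk 2) hs

theorem exists_norm_hankelSq_mul_le {ν : ℝ} (hν : 0 < ν) {k : ℝ} (hk : 0 < k) (c : ℂ) (B : ℝ) :
    ∃ C, 0 ≤ C ∧ ∀ s, 0 < s → s ≤ B → ‖c * hankelSq ν (k ^ 2 * s)‖ ≤ C * s ^ (-ν) := by
  obtain ⟨C, hC, h⟩ := exists_norm_hankelSq_le hν (k ^ 2 * B)
  refine ⟨‖c‖ * C * (k ^ 2) ^ (-ν), by positivity, fun s hs hsB => ?_⟩
  have := h (k ^ 2 * s) (by positivity) (mul_le_mul_of_nonneg_left hsB (by positivity))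
  rw [Real.mul_rpow (by positivity) hs.le] at this
  rw [norm_mul]
  calc ‖c‖ * ‖hankelSq ν (k ^ 2 * s)‖ ≤ ‖c‖ * (C * ((k ^ 2) ^ (-ν) * s ^ (-ν))) :=
        mul_le_mul_of_nonneg_left this (norm_nonneg c)
    _ = _ := by ring

theorem exists_norm_phiSq'_le {n : ℕ} (hn : 2 ≤ n) {k : ℝ} (hk : 0 < k) (B : ℝ) :
    ∃ C, 0 ≤ C ∧ ∀ s, 0 < s → s ≤ B → ‖phiSq' n k s‖ ≤ C * s ^ (-((n : ℝ) / 2)) := by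
  have hn' : (2 : ℝ) ≤ n := by exact_mod_cast hn
  obtain ⟨C, hC, h⟩ := exists_norm_hankelSq_mul_le (ν := ((n : ℝ) - 2) / 2 + 1) (by linarith) hk
    (Complex.I / 4 * (((k ^ 2 / (2 * Real.pi)) ^ (((n : ℝ) - 2) / 2) : ℝ) : ℂ) * -(k ^ 2 / 2)) B
  refine ⟨C, hC, fun s h0 hB => ?_⟩
  have := h s h0 hB
  rwa [mul_assoc, show -(((n : ℝ) - 2) / 2 + 1) = -((n : ℝ) / 2) by ring] at this

theorem exists_norm_phiSq''_le {n : ℕ} (hn : 2 ≤ n) {k : ℝ} (hk : 0 < k) (B : ℝ) :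
    ∃ C, 0 ≤ C ∧ ∀ s, 0 < s → s ≤ B → ‖phiSq'' n k s‖ ≤ C * s ^ (-((n : ℝ) / 2 + 1)) := by
  have hn' : (2 : ℝ) ≤ n := by exact_mod_cast hn
  obtain ⟨C, hC, h⟩ := exists_norm_hankelSq_mul_le (ν := ((n : ℝ) - 2) / 2 + 2) (by linarith) hk
    (Complex.I / 4 * (((k ^ 2 / (2 * Real.pi)) ^ (((n : ℝ) - 2) / 2) : ℝ) : ℂ) * (k ^ 4 / 4)) B
  refine ⟨C, hC, fun s h0 hB => ?_⟩
  have := h s h0 hB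
  rwa [mul_assoc, show -(((n : ℝ) - 2) / 2 + 2) = -((n : ℝ) / 2 + 1) by ring] at this

/-- The size of the fundamental solution at distance `r`. -/
def singSize (n : ℕ) (r : ℝ) : ℝ :=
  1 + if n = 2 then |Real.log r| else r ^ (2 - (n : ℝ))

theorem exists_norm_phiSq_le {n : ℕ} (hn : 2 ≤ n) {k : ℝ} (hk : 0 < k) (B : ℝ) :
    ∃ C, 0 ≤ C ∧ ∀ r, 0 < r → r ≤ B → ‖phiSq n k (r ^ 2)‖ ≤ C * singSize n r := by
  rcases le_or_gt B 0 with hB | hB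
  · exact ⟨0, le_rfl, fun z h1 h2 => absurd h1 (by linarith)⟩
  rcases eq_or_lt_of_le hn with rfl | hn3
  · obtain ⟨C, hC, h⟩ := exists_norm_hankelSq_zero_le (k ^ 2 * B ^ 2)
    set c := Complex.I / 4 * (((k ^ 2 / (2 * Real.pi)) ^ ((((2 : ℕ) : ℝ) - 2) / 2) : ℝ) : ℂ) with hc
    refine ⟨‖c‖ * C * (2 + |Real.log (k ^ 2)|), by positivity, fun r hr hrB => ?_⟩
    have h1 := h (k ^ 2 * r ^ 2) (by positivity) (by gcongr)
    rw [Real.log_mul (by positivity) (by positivity), Real.log_pow r] at h1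
    have h2 : |Real.log (k ^ 2) + (2 : ℕ) * Real.log r| ≤
        |Real.log (k ^ 2)| + 2 * |Real.log r| := by
      refine (abs_add_le _ _).trans (le_of_eq ?_)
      rw [abs_mul]
      simp
    have h3 : 1 + |Real.log (k ^ 2) + (2 : ℕ) * Real.log r| ≤
        (2 + |Real.log (k ^ 2)|) * (1 + |Real.log r|) := by
      nlinarith [mul_nonneg (abs_nonneg (Real.log (k ^ 2))) (abs_nonneg (Real.log r))]
    have h4 : phiSq 2 k (r ^ 2) = c * hankelSq 0 (k ^ 2 * r ^ 2) := by
      simp [phiSq, hc]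
    rw [h4, norm_mul]
    simp only [singSize, if_true]
    calc ‖c‖ * ‖hankelSq 0 (k ^ 2 * r ^ 2)‖
        ≤ ‖c‖ * (C * ((2 + |Real.log (k ^ 2)|) * (1 + |Real.log r|))) := by
          gcongr
          exact h1.trans (by gcongr)
      _ = _ := by ring
  · have hn' : (2 : ℝ) < n := by exact_mod_cast hn3
    obtain ⟨C, hC, h⟩ := exists_norm_hankelSq_mul_le (ν := ((n : ℝ) - 2) / 2) (by linarith) hk
      (Complex.I / 4 * (((k ^ 2 / (2 * Real.pi)) ^ (((n : ℝ) - 2) / 2) : ℝ) : ℂ)) (B ^ 2)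
    refine ⟨C, hC, fun r hr hrB => (h (r ^ 2) (by positivity) (by gcongr)).trans ?_⟩
    rw [singSize, if_neg (by omega), ← Real.rpow_natCast, ← Real.rpow_mul hr.le,
      show ((2 : ℕ) : ℝ) * -(((n : ℝ) - 2) / 2) = 2 - n by push_cast; ring]
    gcongr
    linarith

/-- A deliberately weak bound, |x|^{1-n} in terms of s = |x|². It covers the logarithm of n = 2 and
the power of n > 2 at once and is still locally integrable. -/
theorem exists_norm_phiSq_le_rpow {n : ℕ} (hn : 2 ≤ n) {k : ℝ} (hk : 0 < k) (B : ℝ) :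
    ∃ C, 0 ≤ C ∧ ∀ s, 0 < s → s ≤ B → ‖phiSq n k s‖ ≤ C * s ^ (-(((n : ℝ) - 1) / 2)) := by
  rcases le_or_gt B 0 with hB | hB
  · exact ⟨0, le_rfl, fun z h1 h2 => absurd h1 (by linarith)⟩
  have hn' : (2 : ℝ) ≤ n := by exact_mod_cast hn
  obtain ⟨C, hC, h⟩ := exists_norm_phiSq_le hn hk (√B)
  obtain ⟨D, hD, hD'⟩ : ∃ D, 0 ≤ D ∧ ∀ r, 0 < r → r ≤ √B →
      singSize n r ≤ D * r ^ (-((n : ℝ) - 1)) := by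
    have hone : ∀ r, 0 < r → r ≤ √B → 1 ≤ √B ^ ((n : ℝ) - 1) * r ^ (-((n : ℝ) - 1)) := by
      intro r hr hrB
      rw [Real.rpow_neg hr.le, ← div_eq_mul_inv, one_le_div (by positivity)]
      exact Real.rpow_le_rpow hr.le hrB (by linarith)
    rcases eq_or_lt_of_le hn with rfl | hn3
    · refine ⟨(1 + √B) * √B ^ (((2 : ℕ) : ℝ) - 1) + 1, by positivity, fun r hr hrB => ?_⟩
      have h1 := hone r hr hrB
      have h2 : |Real.log r| ≤ r⁻¹ + r := by
        rw [abs_le]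
        have := Real.log_le_sub_one_of_pos (inv_pos.mpr hr)
        rw [Real.log_inv] at this
        constructor
        · linarith
        · linarith [Real.log_le_sub_one_of_pos hr, inv_pos.mpr hr]
      have h3 : r ^ (-(((2 : ℕ) : ℝ) - 1)) = r⁻¹ := by
        rw [← Real.rpow_neg_one]; norm_num
      simp only [singSize, if_true]
      rw [h3] at h1 ⊢
      have : (1 + √B) * 1 ≤ (1 + √B) * (√B ^ (((2 : ℕ) : ℝ) - 1) * r⁻¹) := by gcongr
      nlinarith
    · refine ⟨√B ^ ((n : ℝ) - 1) + √B, by positivity, fun r hr hrB => ?_⟩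
      have h1 := hone r hr hrB
      rw [singSize, if_neg (by omega)]
      have h2 : r ^ (2 - (n : ℝ)) = r * r ^ (-((n : ℝ) - 1)) := by
        rw [mul_comm, ← Real.rpow_add_one hr.ne']
        ring_nf
      rw [h2, add_mul]
      gcongr
  refine ⟨C * D, by positivity, fun s hs hsB => ?_⟩
  have hq := Real.sqrt_pos.mpr hs
  have h1 := h (√s) hq (Real.sqrt_le_sqrt hsB)
  rw [Real.sq_sqrt hs.le] at h1
  refine h1.trans ?_
  rw [mul_assoc]
  have h2 := hD' (√s) hq (Real.sqrt_le_sqrt hsB)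
  refine (mul_le_mul_of_nonneg_left h2 hC).trans (le_of_eq ?_)
  rw [Real.sqrt_eq_rpow, ← Real.rpow_mul hs.le]
  ring_nf

/-! ### The Fourier transform of the truncated fundamental solution -/

theorem fourier_laplacian_apply {n : ℕ} (f : 𝓢(E n, ℂ)) (ξ : E n) :
    𝓕 (Δ f) ξ = -((‖(2 * Real.pi) • ξ‖ ^ 2 : ℝ) : ℂ) * 𝓕 f ξ := by
  have hg : (fun x : E n => ‖x‖ ^ 2).HasTemperateGrowth := by fun_prop
  have hg' : (‖·‖ ^ 2 : E n → ℝ).HasTemperateGrowth := hg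
  rw [SchwartzMap.laplacian_eq_fourierMultiplierCLM, SchwartzMap.fourierMultiplierCLM_apply,
    FourierTransform.fourier_smul, FourierTransform.fourier_fourierInv_eq, smul_apply,
    SchwartzMap.smulLeftCLM_apply_apply hg', norm_smul, Real.norm_eq_abs,
    abs_of_pos Real.two_pi_pos]
  simp only [Complex.real_smul]
  push_cast
  ring

/-- The majorant `|x|^{1-n}`, cut off at radius `b`. -/
def cutPower (n : ℕ) (b : ℝ) (x : E n) : ℝ :=
  (Iic b).indicator (fun r : ℝ => r ^ (-((n : ℝ) - 1))) ‖x‖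

theorem integrable_cutPower {n : ℕ} (hn : 2 ≤ n) (b : ℝ) : Integrable (cutPower n b) := by
  have hn0 : n ≠ 0 := by omega
  have : Nonempty (Fin n) := ⟨⟨0, by omega⟩⟩
  have : Nontrivial (E n) := inferInstance
  refine (integrable_fun_norm_addHaar (μ := (volume : Measure (E n)))
    (f := (Iic b).indicator (fun r : ℝ => r ^ (-((n : ℝ) - 1))))).mpr ?_
  have h : IntegrableOn ((Iic b).indicator fun _ : ℝ => (1 : ℝ)) (Ioi 0) := by
    rw [IntegrableOn, integrable_indicator_iff measurableSet_Iic, IntegrableOn,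
      Measure.restrict_restrict measurableSet_Iic, Set.inter_comm, Ioi_inter_Iic]
    exact integrableOn_const (by simp)
  refine h.congr_fun (fun r hr => ?_) measurableSet_Ioi
  have hr0 : (0 : ℝ) < r := hr
  simp only [indicator, finrank_euclideanSpace_fin, smul_eq_mul]
  split_ifs
  · rw [← Real.rpow_natCast, ← Real.rpow_add hr0, Nat.cast_sub (by omega)]
    simp
  · simp

theorem cutPower_of_le {n : ℕ} {b : ℝ} {x : E n} (h : ‖x‖ ≤ b) :
    cutPower n b x = ‖x‖ ^ (-((n : ℝ) - 1)) := indicator_of_mem (s := Iic b) h _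

theorem cutPower_nonneg (n : ℕ) (b : ℝ) (x : E n) : 0 ≤ cutPower n b x :=
  indicator_apply_nonneg fun _ => Real.rpow_nonneg (norm_nonneg x) _

/-- The function is δ⁻ⁿ F(x/δ) with F(x) = (1 + |x|²)^{-(n/2+1)}, so its mass does not depend on δ.
-/
theorem integrable_dilated_power {n : ℕ} {δ : ℝ} (hδ : 0 < δ) :
    Integrable (fun x : E n => δ ^ 2 * (‖x‖ ^ 2 + δ ^ 2) ^ (-((n : ℝ) / 2 + 1))) ∧
    ∫ x : E n, δ ^ 2 * (‖x‖ ^ 2 + δ ^ 2) ^ (-((n : ℝ) / 2 + 1)) =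
      ∫ x : E n, (1 + ‖x‖ ^ 2) ^ (-((n : ℝ) / 2 + 1)) := by
  set f : E n → ℝ := fun x => (1 + ‖x‖ ^ 2) ^ (-((n : ℝ) / 2 + 1)) with hf
  have hfi : Integrable f := by
    have h := integrable_rpow_neg_one_add_norm_sq (E := E n) (μ := volume) (r := (n : ℝ) + 2)
      (by rw [finrank_euclideanSpace_fin]; linarith)
    simpa only [show -((n : ℝ) + 2) / 2 = -((n : ℝ) / 2 + 1) by ring] using h
  have h1 : (fun x : E n => δ ^ 2 * (‖x‖ ^ 2 + δ ^ 2) ^ (-((n : ℝ) / 2 + 1))) =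
      fun x => (δ ^ n)⁻¹ * f (δ⁻¹ • x) := by
    funext x
    have e1 : ‖x‖ ^ 2 + δ ^ 2 = δ ^ 2 * (1 + ‖δ⁻¹ • x‖ ^ 2) := by
      rw [norm_smul, Real.norm_eq_abs, abs_of_pos (inv_pos.mpr hδ)]
      field_simp
      ring
    have e2 : (δ ^ 2) ^ (-((n : ℝ) / 2 + 1)) = (δ ^ 2)⁻¹ * (δ ^ n)⁻¹ := by
      rw [← Real.rpow_natCast δ 2, ← Real.rpow_natCast δ n, ← Real.rpow_mul hδ.le,
        ← Real.rpow_neg hδ.le, ← Real.rpow_neg hδ.le, ← Real.rpow_add hδ]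
      congr 1
      push_cast
      ring
    rw [e1, Real.mul_rpow (by positivity) (by positivity), e2]
    simp only [hf]
    field_simp
  rw [h1]
  refine ⟨(hfi.comp_smul (inv_ne_zero hδ.ne')).const_mul _, ?_⟩
  rw [integral_const_mul, Measure.integral_comp_smul, finrank_euclideanSpace_fin,
    abs_of_pos (by positivity), smul_eq_mul, inv_pow, inv_inv, ← mul_assoc,
    inv_mul_cancel₀ (by positivity), one_mul]

/-- The hypotheses on `g₀` under which `g₀(|x|²)` has a Fourier transform that decays like the
one of the fundamental solution of an elliptic operator of second order. -/
structure IsRadialParametrix (n : ℕ) (g₀ g₁ g₂ : ℝ → ℂ) (b C : ℝ) : Prop where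
  smooth : ContDiffOn ℝ (↑(⊤ : ℕ∞)) g₀ (Ioi 0)
  deriv : ∀ s, 0 < s → HasDerivAt g₀ (g₁ s) s
  deriv₂ : ∀ s, 0 < s → HasDerivAt g₁ (g₂ s) s
  b_pos : 0 < b
  nonneg : 0 ≤ C
  zero₀ : ∀ s, b ^ 2 < s → g₀ s = 0
  zero₁ : ∀ s, b ^ 2 < s → g₁ s = 0
  zero₂ : ∀ s, b ^ 2 < s → g₂ s = 0
  bound₀ : ∀ s, 0 < s → s ≤ b ^ 2 → ‖g₀ s‖ ≤ C * s ^ (-(((n : ℝ) - 1) / 2))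
  bound₁ : ∀ s, 0 < s → s ≤ b ^ 2 → ‖4 * s * g₂ s + 2 * n * g₁ s‖ ≤ C * s ^ (-(((n : ℝ) - 1) / 2))
  bound₂ : ∀ s, 0 < s → s ≤ b ^ 2 → ‖g₂ s‖ ≤ C * s ^ (-((n : ℝ) / 2 + 1))

/-! ### Fourier decay of radial parametrices. -/

namespace IsRadialParametrix

variable {n : ℕ} {g₀ g₁ g₂ : ℝ → ℂ} {b C : ℝ}

theorem contDiff_regularization (h : IsRadialParametrix n g₀ g₁ g₂ b C) {δ : ℝ} (hδ : 0 < δ) :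
    ContDiff ℝ (↑(⊤ : ℕ∞)) fun x : E n => g₀ (‖x‖ ^ 2 + δ ^ 2) := by
  rw [← contDiffOn_univ]
  refine h.smooth.comp (g := g₀) (f := fun x : E n => ‖x‖ ^ 2 + δ ^ 2) ?_ ?_
  · exact ((contDiff_norm_sq ℝ).add contDiff_const).contDiffOn
  · intro x _
    exact add_pos_of_nonneg_of_pos (sq_nonneg _) (pow_pos hδ 2)

theorem hasCompactSupport_regularization (h : IsRadialParametrix n g₀ g₁ g₂ b C) (δ : ℝ) :
    HasCompactSupport fun x : E n => g₀ (‖x‖ ^ 2 + δ ^ 2) := by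
  refine HasCompactSupport.intro (isCompact_closedBall (0 : E n) b) fun x hx => ?_
  apply h.zero₀
  rw [mem_closedBall_zero_iff, not_le] at hx
  nlinarith [h.b_pos, sq_nonneg δ]

/-- The regularisation `g₀(|x|² + δ²)` as a Schwartz function. -/
def regularization (h : IsRadialParametrix n g₀ g₁ g₂ b C) {δ : ℝ} (hδ : 0 < δ) : 𝓢(E n, ℂ) :=
  (h.hasCompactSupport_regularization δ).toSchwartzMap (h.contDiff_regularization hδ)

theorem hasFDerivAt_norm_sq_add (δ : ℝ) (x : E n) :
    HasFDerivAt (fun x : E n => ‖x‖ ^ 2 + δ ^ 2) (2 • innerSL ℝ x) x :=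
  (hasStrictFDerivAt_norm_sq x).hasFDerivAt.add_const _

open LineDeriv in
theorem laplacian_regularization (h : IsRadialParametrix n g₀ g₁ g₂ b C) {δ : ℝ} (hδ : 0 < δ)
    (x : E n) : (Δ (h.regularization hδ)) x =
      4 * (‖x‖ ^ 2 : ℝ) * g₂ (‖x‖ ^ 2 + δ ^ 2) + 2 * n * g₁ (‖x‖ ^ 2 + δ ^ 2) := by
  have hpos : ∀ x : E n, 0 < ‖x‖ ^ 2 + δ ^ 2 := fun x =>
    add_pos_of_nonneg_of_pos (sq_nonneg _) (pow_pos hδ 2)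
  have h1 : ∀ (i : Fin n) (x : E n), ∂_{EuclideanSpace.basisFun (Fin n) ℝ i}
      (h.regularization hδ) x = (2 * x i : ℝ) * g₁ (‖x‖ ^ 2 + δ ^ 2) := by
    intro i x
    rw [SchwartzMap.lineDerivOp_apply_eq_fderiv]
    have hd := HasFDerivAt.comp (f := fun x : E n => ‖x‖ ^ 2 + δ ^ 2) x
      (h.deriv _ (hpos x)).hasFDerivAt (hasFDerivAt_norm_sq_add δ x)
    have : fderiv ℝ (h.regularization hδ) x = _ := hd.fderiv
    rw [this]
    simp [EuclideanSpace.inner_single_right]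
    ring
  rw [SchwartzMap.laplacian_eq_sum (EuclideanSpace.basisFun (Fin n) ℝ), sum_apply]
  have h2 : ∀ i : Fin n, ∂_{EuclideanSpace.basisFun (Fin n) ℝ i}
      (∂_{EuclideanSpace.basisFun (Fin n) ℝ i} (h.regularization hδ)) x =
      2 * g₁ (‖x‖ ^ 2 + δ ^ 2) + 4 * ((x i ^ 2 : ℝ) : ℂ) * g₂ (‖x‖ ^ 2 + δ ^ 2) := by
    intro i
    rw [SchwartzMap.lineDerivOp_apply_eq_fderiv]
    have e : (⇑(∂_{EuclideanSpace.basisFun (Fin n) ℝ i} (h.regularization hδ) : 𝓢(E n, ℂ)) : E n → ℂ) =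
      fun x : E n => ((2 * x i : ℝ) : ℂ) * g₁ (‖x‖ ^ 2 + δ ^ 2) := funext (h1 i)
    rw [e]
    have hd1 := HasFDerivAt.comp (f := fun x : E n => ‖x‖ ^ 2 + δ ^ 2) x
      (h.deriv₂ _ (hpos x)).hasFDerivAt (hasFDerivAt_norm_sq_add δ x)
    have hd0 : HasFDerivAt (fun x : E n => 2 * x i)
        ((2 : ℝ) • (EuclideanSpace.proj i : E n →L[ℝ] ℝ)) x :=
      ((EuclideanSpace.proj i : E n →L[ℝ] ℝ).hasFDerivAt).const_mul 2
    have hd2 : HasFDerivAt (fun x : E n => ((2 * x i : ℝ) : ℂ))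
        (Complex.ofRealCLM.comp ((2 : ℝ) • (EuclideanSpace.proj i : E n →L[ℝ] ℝ))) x :=
      Complex.ofRealCLM.hasFDerivAt.comp x hd0
    have hd3 : fderiv ℝ (fun x : E n => ((2 * x i : ℝ) : ℂ) * g₁ (‖x‖ ^ 2 + δ ^ 2)) x = _ :=
      (hd2.mul hd1).fderiv
    rw [hd3]
    simp [EuclideanSpace.inner_single_right]
    ring
  simp only [h2]
  rw [Finset.sum_add_distrib, Finset.sum_const, Finset.card_univ, Fintype.card_fin,
    ← Finset.sum_mul, ← Finset.mul_sum, EuclideanSpace.norm_sq_eq]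
  simp
  ring

theorem rpow_neg_add_le {a s δ : ℝ} (ha : 0 ≤ a) (hs : 0 < s) :
    (s ^ 2 + δ ^ 2) ^ (-(a / 2)) ≤ s ^ (-a) := by
  calc (s ^ 2 + δ ^ 2) ^ (-(a / 2)) ≤ (s ^ 2) ^ (-(a / 2)) :=
        Real.rpow_le_rpow_of_nonpos (by positivity) (by nlinarith [sq_nonneg δ]) (by linarith)
    _ = s ^ (-a) := by
        rw [← Real.rpow_natCast, ← Real.rpow_mul hs.le]
        congr 1
        push_cast
        ring

theorem norm_comp_le (h : IsRadialParametrix n g₀ g₁ g₂ b C) (hn : 2 ≤ n) {x : E n} (hx : x ≠ 0)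
    (δ : ℝ) : ‖g₀ (‖x‖ ^ 2 + δ ^ 2)‖ ≤ C * cutPower n b x := by
  have hn' : (2 : ℝ) ≤ n := by exact_mod_cast hn
  have hx' : 0 < ‖x‖ := norm_pos_iff.mpr hx
  rcases le_or_gt (‖x‖ ^ 2 + δ ^ 2) (b ^ 2) with hb | hb
  · refine (h.bound₀ _ (by positivity) hb).trans ?_
    have : ‖x‖ ≤ b := abs_le_of_sq_le_sq' (by nlinarith [sq_nonneg δ]) h.b_pos.le |>.2
    rw [cutPower_of_le this]
    exact mul_le_mul_of_nonneg_left (rpow_neg_add_le (by linarith) hx') h.nonneg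
  · rw [h.zero₀ _ hb, norm_zero]
    exact mul_nonneg h.nonneg (cutPower_nonneg _ _ _)

/-- With σ = |x|² + δ² the Laplacian is (4σg₂ + 2ng₁)(σ) - 4δ²g₂(σ). The first combination is the
one in which the leading singularities cancel. The second term is the error of replacing |x|² by σ
and behaves like an approximate identity. -/
theorem norm_laplacian_regularization_le (h : IsRadialParametrix n g₀ g₁ g₂ b C) (hn : 2 ≤ n)
    {δ : ℝ} (hδ : 0 < δ) {x : E n} (hx : x ≠ 0) : ‖(Δ (h.regularization hδ)) x‖ ≤
      C * cutPower n b x + 4 * C * (δ ^ 2 * (‖x‖ ^ 2 + δ ^ 2) ^ (-((n : ℝ) / 2 + 1))) := by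
  have hn' : (2 : ℝ) ≤ n := by exact_mod_cast hn
  have hx' : 0 < ‖x‖ := norm_pos_iff.mpr hx
  rw [h.laplacian_regularization hδ]
  set σ := ‖x‖ ^ 2 + δ ^ 2 with hσ
  have hσ0 : 0 < σ := by positivity
  have hC := h.nonneg
  have hcut := cutPower_nonneg n b x
  rcases le_or_gt σ (b ^ 2) with hb | hb
  · have e : 4 * ((‖x‖ ^ 2 : ℝ) : ℂ) * g₂ σ + 2 * n * g₁ σ =
        (4 * σ * g₂ σ + 2 * n * g₁ σ) - 4 * ((δ ^ 2 : ℝ) : ℂ) * g₂ σ := by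
      rw [hσ]
      push_cast
      ring
    rw [e]
    refine (norm_sub_le _ _).trans (add_le_add ?_ ?_)
    · refine (h.bound₁ σ hσ0 hb).trans ?_
      have : ‖x‖ ≤ b := abs_le_of_sq_le_sq' (by nlinarith [sq_nonneg δ]) h.b_pos.le |>.2
      rw [cutPower_of_le this]
      exact mul_le_mul_of_nonneg_left (rpow_neg_add_le (by linarith) hx') hC
    · rw [norm_mul, norm_mul, Complex.norm_real, Real.norm_eq_abs, abs_of_pos (by positivity)]
      have := h.bound₂ σ hσ0 hb
      rw [Complex.norm_ofNat]
      calc 4 * δ ^ 2 * ‖g₂ σ‖ ≤ 4 * δ ^ 2 * (C * σ ^ (-((n : ℝ) / 2 + 1))) := by gcongr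
        _ = _ := by ring
  · rw [h.zero₁ _ hb, h.zero₂ _ hb]
    simp only [mul_zero, add_zero, norm_zero]
    positivity

theorem aestronglyMeasurable_comp (h : IsRadialParametrix n g₀ g₁ g₂ b C) :
    AEStronglyMeasurable fun x : E n => g₀ (‖x‖ ^ 2) := by
  have hc : ContinuousOn (fun x : E n => g₀ (‖x‖ ^ 2)) {0}ᶜ := by
    refine h.smooth.continuousOn.comp (by fun_prop) fun x hx => ?_
    have := norm_pos_iff.mpr hx
    exact pow_pos this 2
  exact (measurable_of_continuousOn_compl_singleton 0 hc).aestronglyMeasurable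

theorem ae_ne_zero (hn : 2 ≤ n) : ∀ᵐ x : E n, x ≠ 0 := by
  have : Nonempty (Fin n) := ⟨⟨0, by omega⟩⟩
  have : Nontrivial (E n) := inferInstance
  exact Measure.ae_ne _ _

theorem integrable_comp (h : IsRadialParametrix n g₀ g₁ g₂ b C) (hn : 2 ≤ n) :
    Integrable fun x : E n => g₀ (‖x‖ ^ 2) := by
  refine ((integrable_cutPower hn b).const_mul C).mono' h.aestronglyMeasurable_comp ?_
  filter_upwards [ae_ne_zero hn] with x hx
  simpa using h.norm_comp_le hn hx 0

/-- The Fourier transform is bounded because the function is integrable. Multiplied by |2πξ|², it is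
controlled by the L¹ norm of the Laplacian, which is uniformly bounded for the regularisations. The
bound survives the limit δ → 0 by dominated convergence. -/
theorem exists_norm_fourier_le (h : IsRadialParametrix n g₀ g₁ g₂ b C) (hn : 2 ≤ n) :
    ∃ D, 0 ≤ D ∧ ∀ ξ : E n, (1 + ‖(2 * Real.pi) • ξ‖ ^ 2) *
      ‖𝓕 (fun x : E n => g₀ (‖x‖ ^ 2)) ξ‖ ≤ D := by
  set I₁ := ∫ x : E n, C * cutPower n b x
  set I₂ := ∫ x : E n, (1 + ‖x‖ ^ 2) ^ (-((n : ℝ) / 2 + 1))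
  have hI₁ : 0 ≤ I₁ := integral_nonneg fun x => mul_nonneg h.nonneg (cutPower_nonneg n b x)
  have hI₂ : 0 ≤ I₂ := integral_nonneg fun x => by positivity
  have hC := h.nonneg
  refine ⟨I₁ + (I₁ + 4 * C * I₂), by positivity, fun ξ => ?_⟩
  have hdom := (integrable_cutPower hn b).const_mul C
  have h0 : ‖𝓕 (fun x : E n => g₀ (‖x‖ ^ 2)) ξ‖ ≤ I₁ := by
    rw [Real.fourier_eq]
    refine norm_integral_le_of_norm_le hdom ?_
    filter_upwards [ae_ne_zero hn] with x hx
    rw [Circle.norm_smul]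
    simpa using h.norm_comp_le hn hx 0
  have hreg : ∀ {δ : ℝ} (hδ : 0 < δ), ‖(2 * Real.pi) • ξ‖ ^ 2 * ‖𝓕 (h.regularization hδ) ξ‖ ≤
      I₁ + 4 * C * I₂ := by
    intro δ hδ
    have e : ‖(2 * Real.pi) • ξ‖ ^ 2 * ‖𝓕 (h.regularization hδ) ξ‖ =
        ‖𝓕 (Δ (h.regularization hδ)) ξ‖ := by
      rw [fourier_laplacian_apply, norm_mul, norm_neg, Complex.norm_real, Real.norm_eq_abs, abs_sq]
    rw [e, SchwartzMap.fourier_coe, Real.fourier_eq]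
    have hd := integrable_dilated_power (n := n) hδ
    calc _ ≤ ∫ x : E n, (C * cutPower n b x +
          4 * C * (δ ^ 2 * (‖x‖ ^ 2 + δ ^ 2) ^ (-((n : ℝ) / 2 + 1)))) := by
          refine norm_integral_le_of_norm_le (hdom.add (hd.1.const_mul _)) ?_
          filter_upwards [ae_ne_zero hn] with x hx
          rw [Circle.norm_smul]
          exact h.norm_laplacian_regularization_le hn hδ hx
      _ = I₁ + 4 * C * I₂ := by
          rw [integral_add hdom (hd.1.const_mul _), integral_const_mul (4 * C), hd.2]
  have hlim : Tendsto (fun m : ℕ => 𝓕 (h.regularization (δ := 1 / ((m : ℝ) + 1))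
      (by positivity)) ξ) atTop (𝓝 (𝓕 (fun x : E n => g₀ (‖x‖ ^ 2)) ξ)) := by
    simp only [SchwartzMap.fourier_coe, Real.fourier_eq]
    refine tendsto_integral_of_dominated_convergence (fun x => C * cutPower n b x) ?_ hdom ?_ ?_
    · intro m
      refine Continuous.aestronglyMeasurable ?_
      refine Continuous.smul ?_ (SchwartzMap.continuous _)
      simp only [Real.fourierChar_apply]
      fun_prop
    · intro m
      filter_upwards [ae_ne_zero hn] with x hx
      rw [Circle.norm_smul]
      exact h.norm_comp_le hn hx _
    · filter_upwards [ae_ne_zero hn] with x hx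
      refine Tendsto.const_smul ?_ _
      have hpos : 0 < ‖x‖ ^ 2 := pow_pos (norm_pos_iff.mpr hx) 2
      have h1 : Tendsto (fun m : ℕ => ‖x‖ ^ 2 + (1 / ((m : ℝ) + 1)) ^ 2) atTop (𝓝 (‖x‖ ^ 2)) := by
        have := (tendsto_one_div_add_atTop_nhds_zero_nat (𝕜 := ℝ)).pow 2
        simpa using this.const_add (‖x‖ ^ 2)
      exact (h.deriv _ hpos).continuousAt.tendsto.comp h1
  have h2 : ‖(2 * Real.pi) • ξ‖ ^ 2 * ‖𝓕 (fun x : E n => g₀ (‖x‖ ^ 2)) ξ‖ ≤ I₁ + 4 * C * I₂ :=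
    le_of_tendsto (hlim.norm.const_mul _) (Eventually.of_forall fun m => hreg _)
  rw [add_mul, one_mul]
  exact add_le_add h0 h2

end IsRadialParametrix

/-! ### Cutting off the fundamental solution at a finite distance. -/

theorem rpow_le_rpow_mul_rpow {s B a c : ℝ} (hs : 0 < s) (hsB : s ≤ B) (hac : a ≤ c) :
    s ^ (-a) ≤ B ^ (c - a) * s ^ (-c) := by
  have h : s ^ (-a) = s ^ (c - a) * s ^ (-c) := by
    rw [← Real.rpow_add hs]
    ring_nf
  rw [h]
  exact mul_le_mul_of_nonneg_right (Real.rpow_le_rpow hs.le hsB (by linarith)) (by positivity)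

/-- The profile is multiplied by a smooth cut-off θ(s), equal to 1 for s ≤ R² and to 0 for s ≥ R² +
1 = b². Derivatives falling on θ are bounded and multiply less singular terms. -/
theorem exists_isRadialParametrix_phiSq {n : ℕ} (hn : 2 ≤ n) {k : ℝ} (hk : 0 < k) (R : ℝ) :
    ∃ g₀ g₁ g₂ b C, IsRadialParametrix n g₀ g₁ g₂ b C ∧
      ∀ s, s ≤ R ^ 2 → g₀ s = phiSq n k s := by
  have hn' : (2 : ℝ) ≤ n := by exact_mod_cast hn
  set θ : ℝ → ℝ := fun s => Real.smoothTransition (R ^ 2 + 1 - s) with hθ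
  have hθs : ContDiff ℝ (↑(⊤ : ℕ∞)) θ :=
    Real.smoothTransition.contDiff.comp (contDiff_const.sub contDiff_id)
  have hθs' : ContDiff ℝ (↑(⊤ : ℕ∞)) (deriv θ) := by
    exact (contDiff_infty_iff_deriv.mp hθs).2
  have hθs'' : ContDiff ℝ (↑(⊤ : ℕ∞)) (deriv (deriv θ)) := by
    exact (contDiff_infty_iff_deriv.mp hθs').2
  have hd1 : ∀ s, HasDerivAt (fun s => (θ s : ℂ)) ((deriv θ s : ℝ) : ℂ) s := fun s =>
    (hθs.differentiable (by simp) s).hasDerivAt.ofReal_comp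
  have hd2 : ∀ s, HasDerivAt (fun s => ((deriv θ s : ℝ) : ℂ)) ((deriv (deriv θ) s : ℝ) : ℂ) s := fun s =>
    (hθs'.differentiable (by simp) s).hasDerivAt.ofReal_comp
  set b := √(R ^ 2 + 1)
  have hb : 0 < b := Real.sqrt_pos.mpr (by positivity)
  have hb2 : b ^ 2 = R ^ 2 + 1 := Real.sq_sqrt (by positivity)
  have hz0 : ∀ s, b ^ 2 < s → θ s = 0 := fun s hs =>
    Real.smoothTransition.zero_of_nonpos (by linarith)
  have hz1 : ∀ s, b ^ 2 < s → deriv θ s = 0 := by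
    intro s hs
    have : θ =ᶠ[𝓝 s] fun _ => 0 := by
      filter_upwards [Ioi_mem_nhds hs] with t ht using hz0 t ht
    rw [this.deriv_eq, deriv_const]
  have hz2 : ∀ s, b ^ 2 < s → deriv (deriv θ) s = 0 := by
    intro s hs
    have : deriv θ =ᶠ[𝓝 s] fun _ => 0 := by
      filter_upwards [Ioi_mem_nhds hs] with t ht using hz1 t ht
    rw [this.deriv_eq, deriv_const]
  obtain ⟨M₁, hM₁⟩ := isCompact_Icc.exists_bound_of_continuousOn (s := Icc 0 (b ^ 2))
    (hθs'.continuous.continuousOn)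
  obtain ⟨M₂, hM₂⟩ := isCompact_Icc.exists_bound_of_continuousOn (s := Icc 0 (b ^ 2))
    (hθs''.continuous.continuousOn)
  have hM : ∃ M, 0 ≤ M ∧ ∀ s, 0 < s → s ≤ b ^ 2 → ‖(θ s : ℂ)‖ ≤ M ∧ ‖((deriv θ s : ℝ) : ℂ)‖ ≤ M ∧
      ‖((deriv (deriv θ) s : ℝ) : ℂ)‖ ≤ M := by
    refine ⟨max 1 (max M₁ M₂), by positivity, fun s h1 h2 => ⟨?_, ?_, ?_⟩⟩
    · rw [Complex.norm_real, Real.norm_eq_abs, abs_of_nonneg (Real.smoothTransition.nonneg _)]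
      exact (Real.smoothTransition.le_one _).trans (le_max_left _ _)
    · rw [Complex.norm_real]
      exact (hM₁ s ⟨h1.le, h2⟩).trans ((le_max_left _ _).trans (le_max_right _ _))
    · rw [Complex.norm_real]
      exact (hM₂ s ⟨h1.le, h2⟩).trans ((le_max_right _ _).trans (le_max_right _ _))
  obtain ⟨M, hM0, hM⟩ := hM
  obtain ⟨C₀, hC₀, h0⟩ := exists_norm_phiSq_le_rpow hn hk (b ^ 2)
  obtain ⟨C₁, hC₁, h1⟩ := exists_norm_phiSq'_le hn hk (b ^ 2)
  obtain ⟨C₂, hC₂, h2⟩ := exists_norm_phiSq''_le hn hk (b ^ 2)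
  set B := b ^ 2
  have hB : 0 < B := by positivity
  set a := ((n : ℝ) - 1) / 2 with ha
  set D := (n : ℝ) / 2 + 1 with hD
  -- The three summands are what `bound₀`, `bound₁` and `bound₂` require. The powers of B come from
  -- trading a weaker singularity for a stronger one on (0, B].
  set K₁ := M * C₀ + (4 * B * M * C₀ + 8 * M * C₁ * B ^ (a - (D - 2)) + 2 * n * M * C₀ +
    M * (k ^ 2 * C₀)) + (M * C₀ * B ^ (D - a) + 2 * M * C₁ * B ^ (D - (D - 1)) + M * C₂) with hK₁
  refine ⟨fun s => θ s * phiSq n k s, fun s => ((deriv θ s : ℝ) : ℂ) * phiSq n k s + θ s * phiSq' n k s,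
    fun s => (((deriv (deriv θ) s : ℝ) : ℂ) * phiSq n k s + ((deriv θ s : ℝ) : ℂ) * phiSq' n k s) +
      (((deriv θ s : ℝ) : ℂ) * phiSq' n k s + θ s * phiSq'' n k s), b, K₁, ⟨?_, ?_, ?_, hb, by positivity,
      ?_, ?_, ?_, ?_, ?_, ?_⟩, ?_⟩
  · exact (Complex.ofRealCLM.contDiff.comp hθs).contDiffOn.mul (contDiffOn_phiSq n hk)
  · exact fun s hs => (hd1 s).mul (hasDerivAt_phiSq n hk hs)
  · exact fun s hs => ((hd2 s).mul (hasDerivAt_phiSq n hk hs)).add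
      ((hd1 s).mul (hasDerivAt_phiSq' n hk hs))
  · intro s hs
    simp [hz0 s hs]
  · intro s hs
    simp [hz0 s hs, hz1 s hs]
  · intro s hs
    simp [hz0 s hs, hz1 s hs, hz2 s hs]
  · intro s hs hsB
    rw [norm_mul]
    have hle : M * C₀ ≤ K₁ := by
      rw [hK₁, add_assoc]
      exact le_add_of_nonneg_right (by positivity)
    calc _ ≤ M * (C₀ * s ^ (-a)) :=
          mul_le_mul (hM s hs hsB).1 (h0 s hs hsB) (norm_nonneg _) hM0
      _ = M * C₀ * s ^ (-a) := by ring
      _ ≤ K₁ * s ^ (-a) := by gcongr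
  · intro s hs hsB
    obtain ⟨m0, m1, m2⟩ := hM s hs hsB
    -- The differential equation removes the second derivative of the profile. Its first derivative
    -- survives only with a factor s, which lowers the singularity to the admissible order.
    have e : 4 * (s : ℂ) * ((((deriv (deriv θ) s : ℝ) : ℂ) * phiSq n k s + ((deriv θ s : ℝ) : ℂ) * phiSq' n k s) +
        (((deriv θ s : ℝ) : ℂ) * phiSq' n k s + θ s * phiSq'' n k s)) +
        2 * n * (((deriv θ s : ℝ) : ℂ) * phiSq n k s + θ s * phiSq' n k s) =
        4 * s * ((deriv (deriv θ) s : ℝ) : ℂ) * phiSq n k s + 8 * ((deriv θ s : ℝ) : ℂ) * (s * phiSq' n k s) +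
          2 * n * ((deriv θ s : ℝ) : ℂ) * phiSq n k s + -(θ s * (k ^ 2 * phiSq n k s)) := by
      linear_combination (θ s : ℂ) * phiSq_ode n hk hs
    rw [e]
    have p0 := h0 s hs hsB
    have p1 : s * ‖phiSq' n k s‖ ≤ C₁ * B ^ (a - (D - 2)) * s ^ (-a) := by
      calc s * ‖phiSq' n k s‖ ≤ s * (C₁ * s ^ (-((n : ℝ) / 2))) := by
            gcongr
            exact h1 s hs hsB
        _ = C₁ * s ^ (-(D - 2)) := by
            rw [show -(D - 2) = -((n : ℝ) / 2) + 1 by rw [hD]; ring, Real.rpow_add_one hs.ne']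
            ring
        _ ≤ C₁ * (B ^ (a - (D - 2)) * s ^ (-a)) := by
            gcongr
            exact rpow_le_rpow_mul_rpow hs hsB (by rw [ha, hD]; linarith)
        _ = _ := by ring
    have q1 : ‖4 * (s : ℂ) * ((deriv (deriv θ) s : ℝ) : ℂ) * phiSq n k s‖ ≤ 4 * B * M * (C₀ * s ^ (-a)) := by
      rw [norm_mul, norm_mul, norm_mul, Complex.norm_ofNat, Complex.norm_real, Real.norm_eq_abs,
        abs_of_pos hs]
      gcongr
    have q2 : ‖8 * ((deriv θ s : ℝ) : ℂ) * (s * phiSq' n k s)‖ ≤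
        8 * M * (C₁ * B ^ (a - (D - 2)) * s ^ (-a)) := by
      rw [norm_mul, norm_mul, norm_mul, Complex.norm_ofNat, Complex.norm_real s, Real.norm_eq_abs,
        abs_of_pos hs]
      gcongr
    have q3 : ‖2 * (n : ℂ) * ((deriv θ s : ℝ) : ℂ) * phiSq n k s‖ ≤ 2 * n * M * (C₀ * s ^ (-a)) := by
      rw [norm_mul, norm_mul, norm_mul, Complex.norm_ofNat, Complex.norm_natCast]
      gcongr
    have q4 : ‖-(θ s * ((k : ℂ) ^ 2 * phiSq n k s))‖ ≤ M * (k ^ 2 * (C₀ * s ^ (-a))) := by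
      rw [norm_neg, norm_mul, norm_mul, norm_pow, Complex.norm_real k, Real.norm_eq_abs, sq_abs]
      gcongr
    have hle : 4 * B * M * C₀ + 8 * M * C₁ * B ^ (a - (D - 2)) + 2 * n * M * C₀ +
        M * (k ^ 2 * C₀) ≤ K₁ := by
      have t1 : 0 ≤ M * C₀ := by positivity
      have t2 : 0 ≤ M * C₀ * B ^ (D - a) + 2 * M * C₁ * B ^ (D - (D - 1)) + M * C₂ := by positivity
      rw [hK₁]
      linarith
    refine (norm_add_le_of_le (norm_add_le_of_le (norm_add_le_of_le q1 q2) q3) q4).trans ?_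
    refine le_trans (le_of_eq ?_) (mul_le_mul_of_nonneg_right hle (by positivity))
    ring
  · intro s hs hsB
    obtain ⟨m0, m1, m2⟩ := hM s hs hsB
    have p0 : ‖phiSq n k s‖ ≤ C₀ * (B ^ (D - a) * s ^ (-D)) :=
      (h0 s hs hsB).trans (mul_le_mul_of_nonneg_left
        (rpow_le_rpow_mul_rpow hs hsB (by rw [ha, hD]; linarith)) hC₀)
    have p1 : ‖phiSq' n k s‖ ≤ C₁ * (B ^ (D - (D - 1)) * s ^ (-D)) := by
      refine (h1 s hs hsB).trans (mul_le_mul_of_nonneg_left ?_ hC₁)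
      rw [show (n : ℝ) / 2 = D - 1 by rw [hD]; ring]
      exact rpow_le_rpow_mul_rpow hs hsB (by linarith)
    have p2 := h2 s hs hsB
    have q1 : ‖((deriv (deriv θ) s : ℝ) : ℂ) * phiSq n k s‖ ≤ M * (C₀ * (B ^ (D - a) * s ^ (-D))) := by
      rw [norm_mul]
      gcongr
    have q2 : ‖((deriv θ s : ℝ) : ℂ) * phiSq' n k s‖ ≤ M * (C₁ * (B ^ (D - (D - 1)) * s ^ (-D))) := by
      rw [norm_mul]
      gcongr
    have q3 : ‖(θ s : ℂ) * phiSq'' n k s‖ ≤ M * (C₂ * s ^ (-D)) := by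
      rw [norm_mul]
      gcongr
    have hle : M * C₀ * B ^ (D - a) + 2 * M * C₁ * B ^ (D - (D - 1)) + M * C₂ ≤ K₁ := by
      have t1 : 0 ≤ M * C₀ := by positivity
      have t2 : 0 ≤ 4 * B * M * C₀ + 8 * M * C₁ * B ^ (a - (D - 2)) + 2 * n * M * C₀ +
        M * (k ^ 2 * C₀) := by positivity
      rw [hK₁]
      linarith
    refine (norm_add_le_of_le (norm_add_le_of_le q1 q2) (norm_add_le_of_le q2 q3)).trans ?_
    refine le_trans (le_of_eq ?_) (mul_le_mul_of_nonneg_right hle (by positivity))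
    ring
  · intro s hs
    have : θ s = 1 := Real.smoothTransition.one_of_one_le (by linarith)
    simp [this]

/-- A compactly supported integrable kernel that agrees with the fundamental solution near the
origin and whose Fourier transform decays like `|ξ|^{-2}`. -/
theorem exists_truncated_kernel {n : ℕ} (hn : 2 ≤ n) {k : ℝ} (hk : 0 < k) (R : ℝ) :
    ∃ K : E n → ℂ, Integrable K ∧ HasCompactSupport K ∧ (∀ x, K (-x) = K x) ∧
      (∀ x y, x ≠ y → ‖x - y‖ ≤ R → K (x - y) = Phi k x y) ∧
      ∃ D, 0 ≤ D ∧ ∀ ξ : E n, (1 + ‖(2 * Real.pi) • ξ‖ ^ 2) * ‖𝓕 K ξ‖ ≤ D := by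
  obtain ⟨g₀, g₁, g₂, b, C, h, hg⟩ := exists_isRadialParametrix_phiSq hn hk R
  refine ⟨fun x => g₀ (‖x‖ ^ 2), h.integrable_comp hn, ?_, fun x => by simp only [norm_neg], ?_,
    h.exists_norm_fourier_le hn⟩
  · simpa using h.hasCompactSupport_regularization (n := n) 0
  · intro x y hxy hR
    rw [Phi_eq_phiSq hk hxy]
    exact hg _ (by gcongr)

section

/-! ### The action of elements of Sobolev spaces on Schwartz functions -/

variable {n : ℕ}

theorem continuous_weight (n : ℕ) (s : ℝ) : Continuous (weight n s) :=
  (weight_hasTemperateGrowth n s).1.continuous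

theorem conj_weight (n : ℕ) (s : ℝ) (η : E n) : conj (weight n s η) = weight n s η := by
  simp [weight]

theorem weight_neg_mul (n : ℕ) (s : ℝ) (η : E n) : weight n (-s) η * weight n s η = 1 := by
  have := congrFun (weight_mul n (-s) s) η
  rwa [neg_add_cancel, weight_zero] at this

theorem fourier_dist {s : ℝ} (u : H n s) (g : 𝓢(E n, ℂ)) :
    𝓕 u.dist g = ∫ η, fourierFun u η * g η := by
  have h := congrArg (mulWeight n (-s)) (weightedFourier_spec u)
  rw [mulWeight_mulWeight, add_neg_cancel, mulWeight_zero] at h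
  rw [← h, mulWeight, TemperedDistribution.smulLeftCLM_apply_apply, Lp.toTemperedDistribution_apply]
  refine integral_congr_ae (Eventually.of_forall fun η => ?_)
  simp only [SchwartzMap.smulLeftCLM_apply_apply (weight_hasTemperateGrowth n (-s)), smul_eq_mul,
    fourierFun]
  ring

theorem dist_apply {s : ℝ} (u : H n s) (ψ : 𝓢(E n, ℂ)) :
    u.dist ψ = ∫ η, fourierFun u η * (𝓕⁻ ψ) η := by
  rw [← fourier_dist, TemperedDistribution.fourier_apply, FourierTransform.fourier_fourierInv_eq]

theorem dist_injective {s : ℝ} {u v : H n s} (h : ∀ ψ, u.dist ψ = v.dist ψ) : u = v :=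
  Subtype.ext (ContinuousLinearMap.ext h)

theorem dist_ofSchwartz (s : ℝ) (v ψ : 𝓢(E n, ℂ)) :
    (ofSchwartz n s v).dist ψ = ∫ x, ψ x * v x :=
  SchwartzMap.toTemperedDistributionCLM_apply_apply volume v ψ

theorem weightedFourier_ofSchwartz (s : ℝ) (v : 𝓢(E n, ℂ)) :
    weightedFourier (ofSchwartz n s v) = (SchwartzMap.smulLeftCLM ℂ (weight n s) (𝓕 v)).toLp 2 := by
  apply coe_L2_injective
  rw [weightedFourier_spec]
  change mulWeight n s (𝓕 (v : 𝓢'(E n, ℂ))) = _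
  rw [Lp.toTemperedDistribution_toLp_eq, TemperedDistribution.fourier_toTemperedDistributionCLM_eq]
  ext g
  simp only [mulWeight, TemperedDistribution.smulLeftCLM_apply_apply,
    SchwartzMap.toTemperedDistributionCLM_apply_apply]
  refine integral_congr_ae (Eventually.of_forall fun x => ?_)
  simp only [SchwartzMap.smulLeftCLM_apply_apply (weight_hasTemperateGrowth n s), smul_eq_mul]
  ring

theorem coeFn_weightedFourier_ofSchwartz (s : ℝ) (v : 𝓢(E n, ℂ)) :
    (weightedFourier (ofSchwartz n s v) : L2 n) =ᵐ[volume] fun η => weight n s η * 𝓕 v η := by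
  rw [weightedFourier_ofSchwartz]
  filter_upwards [SchwartzMap.coeFn_toLp (SchwartzMap.smulLeftCLM ℂ (weight n s) (𝓕 v)) 2 volume]
    with η hη
  rw [hη, SchwartzMap.smulLeftCLM_apply_apply (weight_hasTemperateGrowth n s), smul_eq_mul]

theorem fourierFun_ofSchwartz (s : ℝ) (v : 𝓢(E n, ℂ)) :
    fourierFun (ofSchwartz n s v) =ᵐ[volume] fun η => 𝓕 v η := by
  filter_upwards [coeFn_weightedFourier_ofSchwartz s v] with η hη
  rw [fourierFun, hη, ← mul_assoc, weight_neg_mul, one_mul]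

/-- Schwartz functions are dense in L², and both the inverse weight and the inverse Fourier
transform preserve them. -/
theorem denseRange_ofSchwartz (n : ℕ) (s : ℝ) : DenseRange (ofSchwartz n s) := by
  have h1 : DenseRange (SchwartzMap.toLpCLM ℝ ℂ 2 (volume : Measure (E n))) :=
    SchwartzMap.denseRange_toLpCLM (by simp)
  have h2 : DenseRange ((weightedFourierIsometry n s).symm ∘
      SchwartzMap.toLpCLM ℝ ℂ 2 (volume : Measure (E n))) :=
    (weightedFourierIsometry n s).symm.surjective.denseRange.comp h1
      (weightedFourierIsometry n s).symm.continuous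
  refine h2.mono ?_
  rintro _ ⟨g, rfl⟩
  refine ⟨𝓕⁻ (SchwartzMap.smulLeftCLM ℂ (weight n (-s)) g), ?_⟩
  apply (weightedFourierIsometry n s).injective
  change weightedFourier _ = weightedFourierIsometry n s ((weightedFourierIsometry n s).symm _)
  rw [LinearIsometryEquiv.apply_symm_apply, weightedFourier_ofSchwartz,
    FourierTransform.fourier_fourierInv_eq, SchwartzMap.smulLeftCLM_smulLeftCLM_apply
    (weight_hasTemperateGrowth n _) (weight_hasTemperateGrowth n _), weight_mul, add_neg_cancel,
    weight_zero, SchwartzMap.smulLeftCLM_const, one_smul]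
  rfl

/-! ### The duality pairing -/

theorem pairing_eq_inner {s t : ℝ} (hst : s + t = 0) (u : H n s) (v : H n t) :
    pairing u v = inner ℂ (weightedFourier v : L2 n) (weightedFourier u) := by
  obtain rfl : t = -s := by linarith
  rw [L2.inner_def]
  refine integral_congr_ae (Eventually.of_forall fun η => ?_)
  simp only [fourierFun, map_mul, RCLike.inner_apply, conj_weight, neg_neg]
  linear_combination ((weightedFourier u : L2 n) η *
    conj ((weightedFourier v : L2 n) η)) * weight_neg_mul n s η

theorem conj_pairing {s t : ℝ} (u : H n s) (v : H n t) : conj (pairing u v) = pairing v u := by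
  rw [pairing, ← integral_conj]
  refine integral_congr_ae (Eventually.of_forall fun η => ?_)
  simp only [map_mul, Complex.conj_conj]
  ring

theorem norm_weightedFourier {s : ℝ} (u : H n s) : ‖(weightedFourier u : L2 n)‖ = ‖u‖ := rfl

/-- The complex conjugate of a Schwartz function. -/
def conjSchwartz (ψ : 𝓢(E n, ℂ)) : 𝓢(E n, ℂ) :=
  SchwartzMap.postcompCLM (𝕜 := ℝ) (Complex.conjCLE : ℂ →L[ℝ] ℂ) ψ

theorem conjSchwartz_apply (ψ : 𝓢(E n, ℂ)) (x : E n) : conjSchwartz ψ x = conj (ψ x) := rfl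

theorem conj_fourier_conjSchwartz (ψ : 𝓢(E n, ℂ)) (η : E n) :
    conj (𝓕 (conjSchwartz ψ) η) = 𝓕⁻ ψ η := by
  rw [SchwartzMap.fourier_coe, SchwartzMap.fourierInv_coe, Real.fourier_eq, Real.fourierInv_eq,
    ← integral_conj]
  refine integral_congr_ae (Eventually.of_forall fun x => ?_)
  simp only [Circle.smul_def, conjSchwartz_apply, smul_eq_mul, map_mul, Complex.conj_conj,
    ← Circle.coe_inv_eq_conj, ← AddChar.map_neg_eq_inv, neg_neg]

/-- Distributions act bilinearly and the pairing is sesquilinear, whence the conjugate. The formula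
makes u ↦ u(ψ) continuous in the Sobolev norm, which is the basis of the density arguments. -/
theorem dist_eq_pairing {s : ℝ} (t : ℝ) (u : H n s) (ψ : 𝓢(E n, ℂ)) :
    u.dist ψ = pairing u (ofSchwartz n t (conjSchwartz ψ)) := by
  rw [dist_apply, pairing]
  refine integral_congr_ae ?_
  filter_upwards [fourierFun_ofSchwartz t (conjSchwartz ψ)] with η hη
  rw [hη, conj_fourier_conjSchwartz]

theorem continuous_dist_apply {s : ℝ} (ψ : 𝓢(E n, ℂ)) : Continuous fun u : H n s => u.dist ψ := by
  have h : (fun u : H n s => u.dist ψ) = fun u => inner ℂ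
      (weightedFourier (ofSchwartz n (-s) (conjSchwartz ψ)) : L2 n)
      (weightedFourierIsometry n s u) := by
    funext u
    rw [dist_eq_pairing (-s), pairing_eq_inner (add_neg_cancel s)]
    rfl
  rw [h]
  exact continuous_const.inner (weightedFourierIsometry n s).continuous

/-! ### The norm of `H¹(ℝⁿ)` in terms of derivatives -/

theorem norm_weight_sq (n : ℕ) (η : E n) : ‖weight n 1 η‖ ^ 2 = 1 + ‖(2 * Real.pi) • η‖ ^ 2 := by
  rw [weight, Complex.norm_real, Real.norm_eq_abs, sq_abs, ← Real.rpow_natCast,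
    ← Real.rpow_mul (by positivity)]
  norm_num

theorem norm_sq_toLp_two (f : 𝓢(E n, ℂ)) : ‖f.toLp 2 volume‖ ^ 2 = ∫ x, ‖f x‖ ^ 2 := by
  have h := (SchwartzMap.inner_toL2_toL2_eq f f volume).symm.trans
    (inner_self_eq_norm_sq_to_K (𝕜 := ℂ) (f.toLp 2 (volume : Measure (E n))))
  have h2 : ∫ x, inner ℂ (f x) (f x) = ((∫ x, ‖f x‖ ^ 2 : ℝ) : ℂ) := by
    rw [← integral_complex_ofReal]
    refine integral_congr_ae (Eventually.of_forall fun x => ?_)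
    simp only [inner_self_eq_norm_sq_to_K]
    norm_cast
  rw [h2] at h
  refine Complex.ofReal_injective ?_
  rw [Complex.ofReal_pow]
  exact h.symm

theorem integrable_norm_sq (f : 𝓢(E n, ℂ)) : Integrable fun x => ‖f x‖ ^ 2 :=
  (f.memLp 2 volume).integrable_norm_pow (by simp)

-- Plancherel applied to v and to its partial derivatives. Multiplication by smooth functions is
-- hard to see through Fourier weights and easy in this form of the norm.
open LineDeriv in
theorem norm_sq_ofSchwartz (v : 𝓢(E n, ℂ)) :
    ‖ofSchwartz n 1 v‖ ^ 2 = (∫ x, ‖v x‖ ^ 2) +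
      ∑ i, ∫ x, ‖(∂_{EuclideanSpace.basisFun (Fin n) ℝ i} v : 𝓢(E n, ℂ)) x‖ ^ 2 := by
  have h1 : ∀ i (η : E n), ‖𝓕 (∂_{EuclideanSpace.basisFun (Fin n) ℝ i} v : 𝓢(E n, ℂ)) η‖ ^ 2 =
      (2 * Real.pi * η i) ^ 2 * ‖𝓕 v η‖ ^ 2 := by
    intro i η
    have hg : (fun x : E n => inner ℝ x (EuclideanSpace.basisFun (Fin n) ℝ i)).HasTemperateGrowth := by
      fun_prop
    rw [SchwartzMap.fourier_lineDerivOp_eq, smul_apply, SchwartzMap.smulLeftCLM_apply_apply hg,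
      norm_smul, norm_smul]
    simp [EuclideanSpace.inner_single_right, mul_pow]
    ring
  rw [← norm_weightedFourier, weightedFourier_ofSchwartz, norm_sq_toLp_two]
  rw [← SchwartzMap.integral_norm_sq_fourier v, Finset.sum_congr rfl fun i _ =>
    (SchwartzMap.integral_norm_sq_fourier
      (∂_{EuclideanSpace.basisFun (Fin n) ℝ i} v : 𝓢(E n, ℂ))).symm]
  have h2 := fun i => integrable_norm_sq (𝓕 (∂_{EuclideanSpace.basisFun (Fin n) ℝ i} v : 𝓢(E n, ℂ)))
  rw [← integral_finsetSum _ fun i _ => h2 i, ← integral_add (integrable_norm_sq _)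
    (integrable_finsetSum _ fun i _ => h2 i)]
  refine integral_congr_ae (Eventually.of_forall fun η => ?_)
  simp only [h1, SchwartzMap.smulLeftCLM_apply_apply (weight_hasTemperateGrowth n 1), norm_smul,
    mul_pow, norm_weight_sq, EuclideanSpace.norm_sq_eq]
  rw [Finset.mul_sum, add_mul, one_mul, Finset.sum_mul]
  congr 1
  refine Finset.sum_congr rfl fun i _ => ?_
  simp [mul_pow]

end

section

variable {n : ℕ}

/-! ### Multiplication by Schwartz functions -/

/-- The product of two Schwartz functions. -/
def mulSchwartz (χ v : 𝓢(E n, ℂ)) : 𝓢(E n, ℂ) := SchwartzMap.smulLeftCLM ℂ χ v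

theorem mulSchwartz_apply (χ v : 𝓢(E n, ℂ)) (x : E n) : mulSchwartz χ v x = χ x * v x :=
  SchwartzMap.smulLeftCLM_apply_apply χ.hasTemperateGrowth v x

theorem coe_mulSchwartz (χ v : 𝓢(E n, ℂ)) : ⇑(mulSchwartz χ v) = fun x => χ x * v x :=
  funext (mulSchwartz_apply χ v)

open LineDeriv in
theorem lineDerivOp_mulSchwartz (χ v : 𝓢(E n, ℂ)) (m x : E n) :
    (∂_{m} (mulSchwartz χ v) : 𝓢(E n, ℂ)) x =
      χ x * (∂_{m} v : 𝓢(E n, ℂ)) x + (∂_{m} χ : 𝓢(E n, ℂ)) x * v x := by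
  simp only [SchwartzMap.lineDerivOp_apply_eq_fderiv]
  rw [coe_mulSchwartz, fderiv_fun_mul χ.differentiableAt v.differentiableAt]
  simp
  ring

open LineDeriv in
theorem lineDerivOp_sub_apply (f g : 𝓢(E n, ℂ)) (m x : E n) :
    (∂_{m} (f - g) : 𝓢(E n, ℂ)) x = (∂_{m} f : 𝓢(E n, ℂ)) x - (∂_{m} g : 𝓢(E n, ℂ)) x := by
  simp only [SchwartzMap.lineDerivOp_apply_eq_fderiv]
  exact congrArg (· m) (fderiv_sub f.differentiableAt g.differentiableAt)

-- Leibniz' rule with the suprema of χ and of its first derivatives; cross terms are absorbed by (a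
-- + b)² ≤ 2a² + 2b².
open LineDeriv in
theorem exists_norm_ofSchwartz_mulSchwartz_le (χ : 𝓢(E n, ℂ)) :
    ∃ C, 0 ≤ C ∧ ∀ v : 𝓢(E n, ℂ), ‖ofSchwartz n 1 (mulSchwartz χ v)‖ ≤ C * ‖ofSchwartz n 1 v‖ := by
  set e := EuclideanSpace.basisFun (Fin n) ℝ
  set M := SchwartzMap.seminorm ℂ 0 0 χ
  set N : Fin n → ℝ := fun i => SchwartzMap.seminorm ℂ 0 0 (∂_{e i} χ : 𝓢(E n, ℂ))
  have hM0 : 0 ≤ M := apply_nonneg _ _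
  refine ⟨√(2 * M ^ 2 + 2 * ∑ i, N i ^ 2), Real.sqrt_nonneg _, fun v => ?_⟩
  have hS : 0 ≤ ∑ i, N i ^ 2 := Finset.sum_nonneg fun i _ => sq_nonneg _
  have hK : 0 ≤ 2 * M ^ 2 + 2 * ∑ i, N i ^ 2 :=
    add_nonneg (mul_nonneg zero_le_two (sq_nonneg M)) (mul_nonneg zero_le_two hS)
  refine (sq_le_sq₀ (norm_nonneg _)  (mul_nonneg (Real.sqrt_nonneg _) (norm_nonneg _))).mp ?_
  rw [mul_pow, Real.sq_sqrt hK, norm_sq_ofSchwartz, norm_sq_ofSchwartz]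
  set A := ∫ x, ‖v x‖ ^ 2
  set D : Fin n → ℝ := fun i => ∫ x, ‖(∂_{e i} v : 𝓢(E n, ℂ)) x‖ ^ 2
  have hA : 0 ≤ A := integral_nonneg fun x => by positivity
  have hD : ∀ i, 0 ≤ D i := fun i => integral_nonneg fun x => by positivity
  have h1 : ∫ x, ‖mulSchwartz χ v x‖ ^ 2 ≤ M ^ 2 * A := by
    rw [← integral_const_mul]
    refine integral_mono (integrable_norm_sq _) ((integrable_norm_sq v).const_mul _) fun x => ?_
    simp only [mulSchwartz_apply, norm_mul, mul_pow]
    gcongr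
    exact SchwartzMap.norm_le_seminorm ℂ χ x
  have h2 : ∀ i, ∫ x, ‖(∂_{e i} (mulSchwartz χ v) : 𝓢(E n, ℂ)) x‖ ^ 2 ≤
      2 * M ^ 2 * D i + 2 * N i ^ 2 * A := by
    intro i
    rw [← integral_const_mul, ← integral_const_mul, ← integral_add
      ((integrable_norm_sq _).const_mul _) ((integrable_norm_sq _).const_mul _)]
    refine integral_mono (integrable_norm_sq _) (((integrable_norm_sq _).const_mul _).add
      ((integrable_norm_sq _).const_mul _)) fun x => ?_
    simp only [lineDerivOp_mulSchwartz]
    have b1 := SchwartzMap.norm_le_seminorm ℂ χ x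
    have b2 := SchwartzMap.norm_le_seminorm ℂ (∂_{e i} χ : 𝓢(E n, ℂ)) x
    calc ‖χ x * (∂_{e i} v : 𝓢(E n, ℂ)) x + (∂_{e i} χ : 𝓢(E n, ℂ)) x * v x‖ ^ 2
        ≤ (M * ‖(∂_{e i} v : 𝓢(E n, ℂ)) x‖ + N i * ‖v x‖) ^ 2 := by
          gcongr
          refine (norm_add_le _ _).trans ?_
          rw [norm_mul, norm_mul]
          gcongr
      _ ≤ _ := by
          nlinarith [sq_nonneg (M * ‖(∂_{e i} v : 𝓢(E n, ℂ)) x‖ - N i * ‖v x‖)]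
  have h3 : ∑ i, ∫ x, ‖(∂_{e i} (mulSchwartz χ v) : 𝓢(E n, ℂ)) x‖ ^ 2 ≤
      2 * M ^ 2 * ∑ i, D i + 2 * (∑ i, N i ^ 2) * A := by
    refine (Finset.sum_le_sum fun i _ => h2 i).trans (le_of_eq ?_)
    rw [Finset.sum_add_distrib, ← Finset.mul_sum, ← Finset.sum_mul, ← Finset.mul_sum]
  have hDs : 0 ≤ ∑ i, D i := Finset.sum_nonneg fun i _ => hD i
  nlinarith [mul_nonneg hS hDs, mul_nonneg (sq_nonneg M) hA]

/-- The product χw is defined by extending multiplication from the dense Schwartz functions; the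
identity against ψ passes to the limit because both sides are continuous in w. -/
theorem exists_mul_schwartz (χ : 𝓢(E n, ℂ)) (w : H n 1) :
    ∃ v : H n 1, ∀ ψ, v.dist ψ = w.dist (mulSchwartz χ ψ) := by
  obtain ⟨C, -, hC⟩ := exists_norm_ofSchwartz_mulSchwartz_le χ
  set m : 𝓢(E n, ℂ) →ₗ[ℂ] H n 1 := ofSchwartz n 1 ∘ₗ (SchwartzMap.smulLeftCLM ℂ χ).toLinearMap
  have hm : ∃ C, ∀ v, ‖m v‖ ≤ C * ‖ofSchwartz n 1 v‖ := ⟨C, hC⟩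
  refine ⟨m.extendOfNorm (ofSchwartz n 1) w, fun ψ => ?_⟩
  refine (denseRange_ofSchwartz n 1).induction_on
    (p := fun w => (m.extendOfNorm (ofSchwartz n 1) w).dist ψ = w.dist (mulSchwartz χ ψ)) w ?_ ?_
  · exact isClosed_eq ((continuous_dist_apply ψ).comp (ContinuousLinearMap.continuous _))
      (continuous_dist_apply _)
  · intro v
    rw [LinearMap.extendOfNorm_eq (denseRange_ofSchwartz n 1) hm]
    change (ofSchwartz n 1 (mulSchwartz χ v)).dist ψ = _
    rw [dist_ofSchwartz, dist_ofSchwartz]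
    refine integral_congr_ae (Eventually.of_forall fun x => ?_)
    simp only [mulSchwartz_apply]
    ring

/-! ### Fourier multipliers of order `-2` -/

/-- Passing from the weight of H⁻¹ to that of H¹ costs exactly 1 + |2πη|², which the decay of m
compensates. -/
theorem exists_fourier_multiplier {m : E n → ℂ} (hm : AEStronglyMeasurable m) {D : ℝ}
    (hD : ∀ η, (1 + ‖(2 * Real.pi) • η‖ ^ 2) * ‖m η‖ ≤ D) (φ : H n (-1)) :
    ∃ w : H n 1, fourierFun w =ᵐ[volume] fun η => m η * fourierFun φ η := by
  have hw2 : ∀ η, ‖weight n 2 η‖ = 1 + ‖(2 * Real.pi) • η‖ ^ 2 := by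
    intro η
    rw [weight, Complex.norm_real, Real.norm_eq_abs, abs_of_nonneg (by positivity)]
    norm_num
  have hmem : MemLp (fun η => weight n 2 η * m η * (weightedFourier φ : L2 n) η) 2 := by
    refine MemLp.of_le_mul (c := D) (Lp.memLp (weightedFourier φ : L2 n)) ?_ ?_
    · exact ((continuous_weight n 2).aestronglyMeasurable.mul hm).mul (Lp.aestronglyMeasurable _)
    · refine Eventually.of_forall fun η => ?_
      rw [norm_mul, norm_mul, hw2]
      exact mul_le_mul_of_nonneg_right (hD η) (norm_nonneg _)
  refine ⟨weightedFourier.symm hmem.toLp, ?_⟩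
  filter_upwards [hmem.coeFn_toLp] with η hη
  rw [fourierFun, LinearEquiv.apply_symm_apply, hη, fourierFun, neg_neg]
  have h := congrFun (weight_mul n (-1) 2) η
  norm_num at h
  linear_combination (m η * (weightedFourier φ : L2 n) η) * h

/-! ### Locality -/

-- Each point of the support of s has a neighbourhood on which φ vanishes. Finitely many cover the
-- compact support, and a smooth partition of unity splits s into pieces on which φ is zero.
open Distribution in
theorem apply_eq_zero_of_hasCompactSupport (φ : 𝓢'(E n, ℂ)) {s : 𝓢(E n, ℂ)}
    (hs : HasCompactSupport s)
    (h : Disjoint (tsupport s) (dsupport (φ : 𝓢(E n, ℂ) → ℂ))) : φ s = 0 := by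
  have h1 : ∀ x : tsupport s, ∃ U : Set (E n),
      IsVanishingOn (φ : 𝓢(E n, ℂ) → ℂ) U ∧ IsOpen U ∧ (x : E n) ∈ U := fun x =>
    (notMem_dsupport_iff _).mp (disjoint_left.mp h x.2)
  choose U hU1 hU2 hU3 using h1
  obtain ⟨t, ht⟩ := hs.isCompact.elim_finite_subcover U hU2
    fun x hx => mem_iUnion.mpr ⟨⟨x, hx⟩, hU3 _⟩
  obtain ⟨ρ, hρ⟩ := SmoothPartitionOfUnity.exists_isSubordinate (modelWithCornersSelf ℝ (E n))
    (isClosed_tsupport s) (fun i : t => U i) (fun i => hU2 i) (by simpa [iUnion_subtype] using ht)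
  have hsm : ∀ i, ContDiff ℝ (↑(⊤ : ℕ∞)) fun x => ((ρ i x : ℝ) : ℂ) * s x := fun i =>
    (Complex.ofRealCLM.contDiff.comp (ρ i).contMDiff.contDiff).mul s.smooth'
  have hcs : ∀ i, HasCompactSupport fun x => ((ρ i x : ℝ) : ℂ) * s x := fun i => hs.mul_left
  have hsum : s = ∑ i : t, (hcs i).toSchwartzMap (hsm i) := by
    ext x
    rw [sum_apply]
    change s x = ∑ i : t, ((ρ i x : ℝ) : ℂ) * s x
    rw [← Finset.sum_mul]
    by_cases hx : x ∈ tsupport s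
    · have h2 := ρ.sum_eq_one hx
      rw [finsum_eq_sum_of_fintype] at h2
      rw [← Complex.ofReal_sum, h2]
      simp
    · rw [image_eq_zero_of_notMem_tsupport hx, mul_zero]
  rw [hsum, map_sum]
  refine Finset.sum_eq_zero fun i _ => hU1 i _ ?_
  refine (tsupport_mul_subset_left (f := fun x => ((ρ i x : ℝ) : ℂ)) (g := s)).trans ?_
  refine subset_trans ?_ (hρ i)
  exact closure_mono fun x hx => by
    rw [Function.mem_support] at hx ⊢
    exact_mod_cast hx

/-- A smooth function on `ℝⁿ` that is `1` on the unit ball. -/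
def stdBump (n : ℕ) : ContDiffBump (0 : E n) := ⟨1, 2, one_pos, one_lt_two⟩

theorem hasCompactSupport_scaled_bump (n m : ℕ) :
    HasCompactSupport fun x : E n => ((stdBump n (((m : ℝ) + 1)⁻¹ • x) : ℝ) : ℂ) := by
  have h1 : HasCompactSupport fun x : E n => ((stdBump n x : ℝ) : ℂ) :=
    (stdBump n).hasCompactSupport.comp_left (g := fun r : ℝ => (r : ℂ)) Complex.ofReal_zero
  exact h1.comp_smul (inv_ne_zero (by positivity))

theorem contDiff_scaled_bump (n m : ℕ) : ContDiff ℝ (↑(⊤ : ℕ∞))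
    fun x : E n => ((stdBump n (((m : ℝ) + 1)⁻¹ • x) : ℝ) : ℂ) :=
  Complex.ofRealCLM.contDiff.comp ((stdBump n).contDiff.comp (contDiff_const_smul _))

/-- A cut-off function that is `1` on the ball of radius `m + 1`. -/
def ballCutoff (n m : ℕ) : 𝓢(E n, ℂ) :=
  (hasCompactSupport_scaled_bump n m).toSchwartzMap (contDiff_scaled_bump n m)

theorem ballCutoff_apply (m : ℕ) (x : E n) :
    ballCutoff n m x = ((stdBump n (((m : ℝ) + 1)⁻¹ • x) : ℝ) : ℂ) := rfl

theorem norm_ballCutoff_le (m : ℕ) (x : E n) : ‖ballCutoff n m x‖ ≤ 1 := by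
  rw [ballCutoff_apply, Complex.norm_real, Real.norm_eq_abs, abs_of_nonneg (stdBump n).nonneg]
  exact (stdBump n).le_one

theorem eventually_ballCutoff (x : E n) :
    ∀ᶠ m : ℕ in atTop, ∀ᶠ y in 𝓝 x, ballCutoff n m y = 1 := by
  filter_upwards [eventually_gt_atTop (Nat.ceil ‖x‖)] with m hm
  have hx : ‖x‖ < m := (Nat.le_ceil _).trans_lt (by exact_mod_cast hm)
  filter_upwards [(continuous_norm.tendsto x).eventually (Iio_mem_nhds hx)] with y hy
  rw [ballCutoff_apply, (stdBump n).one_of_mem_closedBall, Complex.ofReal_one]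
  rw [mem_closedBall_zero_iff, norm_smul, norm_inv, Real.norm_eq_abs,
    abs_of_pos (by positivity : (0 : ℝ) < (m : ℝ) + 1)]
  change _ ≤ (1 : ℝ)
  rw [inv_mul_le_one₀ (by positivity)]
  linarith [show ‖y‖ < m from hy]

-- Dilating the bump by m + 1 ≥ 1 only shrinks its gradient, so a single bound serves all m.
open LineDeriv in
theorem exists_norm_lineDerivOp_ballCutoff_le (n : ℕ) : ∃ C, 0 ≤ C ∧ ∀ (e : E n), ‖e‖ ≤ 1 →
    ∀ (m : ℕ) (x : E n), ‖(∂_{e} (ballCutoff n m) : 𝓢(E n, ℂ)) x‖ ≤ C := by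
  have hs : ContDiff ℝ (↑(⊤ : ℕ∞)) fun x : E n => ((stdBump n x : ℝ) : ℂ) :=
    Complex.ofRealCLM.contDiff.comp (stdBump n).contDiff
  have h1 : HasCompactSupport fun x : E n => ((stdBump n x : ℝ) : ℂ) :=
    (stdBump n).hasCompactSupport.comp_left (g := fun r : ℝ => (r : ℂ)) Complex.ofReal_zero
  obtain ⟨C, hC⟩ := (h1.fderiv ℝ).exists_bound_of_continuous (hs.continuous_fderiv (by simp))
  have hC0 : 0 ≤ C := (norm_nonneg _).trans (hC 0)
  refine ⟨C, hC0, fun e he m x => ?_⟩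
  rw [SchwartzMap.lineDerivOp_apply_eq_fderiv]
  have h2 : fderiv ℝ (ballCutoff n m) x = ((m : ℝ) + 1)⁻¹ •
      fderiv ℝ (fun x : E n => ((stdBump n x : ℝ) : ℂ)) (((m : ℝ) + 1)⁻¹ • x) :=
    fderiv_comp_smul (f := fun x : E n => ((stdBump n x : ℝ) : ℂ)) (((m : ℝ) + 1)⁻¹)
  rw [h2, smul_apply, norm_smul, norm_inv, Real.norm_eq_abs,
    abs_of_pos (by positivity : (0 : ℝ) < (m : ℝ) + 1)]
  calc ((m : ℝ) + 1)⁻¹ * ‖_‖ ≤ 1 * (C * 1) := by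
        gcongr
        · exact inv_le_one_of_one_le₀ (by linarith [Nat.cast_nonneg (α := ℝ) m])
        · refine (ContinuousLinearMap.le_opNorm _ _).trans ?_
          gcongr
          exact hC _
    _ = C := by ring

-- Dominated convergence in each term of the derivative form of the norm: near any given point the
-- cut-off is eventually 1, so its derivative eventually vanishes there.
open LineDeriv in
theorem tendsto_ofSchwartz_ballCutoff (v : 𝓢(E n, ℂ)) :
    Tendsto (fun m => ofSchwartz n 1 (mulSchwartz (ballCutoff n m) v)) atTop
      (𝓝 (ofSchwartz n 1 v)) := by
  set e := EuclideanSpace.basisFun (Fin n) ℝ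
  obtain ⟨C, hC0, hC⟩ := exists_norm_lineDerivOp_ballCutoff_le n
  rw [tendsto_iff_norm_sub_tendsto_zero]
  have h0 : Tendsto (fun m => ‖ofSchwartz n 1 (mulSchwartz (ballCutoff n m) v) -
      ofSchwartz n 1 v‖ ^ 2) atTop (𝓝 0) := by
    simp only [← map_sub, norm_sq_ofSchwartz]
    rw [show (0 : ℝ) = (∫ _ : E n, (0 : ℝ)) + ∑ _ : Fin n, ∫ _ : E n, (0 : ℝ) by simp]
    refine Tendsto.add ?_ (tendsto_finsetSum _ fun i _ => ?_)
    · refine tendsto_integral_of_dominated_convergence (fun x => 4 * ‖v x‖ ^ 2)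
        (fun m => (integrable_norm_sq _).aestronglyMeasurable)
        ((integrable_norm_sq v).const_mul 4) (fun m => Eventually.of_forall fun x => ?_)
        (Eventually.of_forall fun x => ?_)
      · rw [Real.norm_eq_abs, abs_of_nonneg (by positivity), sub_apply, mulSchwartz_apply]
        have : ‖ballCutoff n m x * v x - v x‖ ≤ 2 * ‖v x‖ := by
          refine (norm_sub_le _ _).trans ?_
          rw [norm_mul]
          nlinarith [norm_ballCutoff_le m x, norm_nonneg (v x)]
        calc _ ≤ (2 * ‖v x‖) ^ 2 := by gcongr
          _ = _ := by ring
      · refine tendsto_const_nhds.congr' ?_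
        filter_upwards [eventually_ballCutoff x] with m hm
        rw [sub_apply, mulSchwartz_apply, hm.self_of_nhds]
        simp
    · refine tendsto_integral_of_dominated_convergence
        (fun x => 8 * ‖(∂_{e i} v : 𝓢(E n, ℂ)) x‖ ^ 2 + 2 * C ^ 2 * ‖v x‖ ^ 2)
        (fun m => (integrable_norm_sq _).aestronglyMeasurable)
        (((integrable_norm_sq _).const_mul _).add ((integrable_norm_sq v).const_mul _))
        (fun m => Eventually.of_forall fun x => ?_) (Eventually.of_forall fun x => ?_)
      · rw [Real.norm_eq_abs, abs_of_nonneg (by positivity), lineDerivOp_sub_apply,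
          lineDerivOp_mulSchwartz]
        have h1 := norm_ballCutoff_le m x
        have h2 := hC (e i) (e.norm_eq_one i).le m x
        have : ‖ballCutoff n m x * (∂_{e i} v : 𝓢(E n, ℂ)) x +
            (∂_{e i} (ballCutoff n m) : 𝓢(E n, ℂ)) x * v x - (∂_{e i} v : 𝓢(E n, ℂ)) x‖ ≤
            2 * ‖(∂_{e i} v : 𝓢(E n, ℂ)) x‖ + C * ‖v x‖ := by
          refine (norm_sub_le _ _).trans ((add_le_add_left (norm_add_le _ _) _).trans ?_)
          rw [norm_mul, norm_mul]
          nlinarith [norm_nonneg ((∂_{e i} v : 𝓢(E n, ℂ)) x), norm_nonneg (v x)]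
        calc _ ≤ (2 * ‖(∂_{e i} v : 𝓢(E n, ℂ)) x‖ + C * ‖v x‖) ^ 2 := by gcongr
          _ ≤ _ := by nlinarith [sq_nonneg (2 * ‖(∂_{e i} v : 𝓢(E n, ℂ)) x‖ - C * ‖v x‖)]
      · refine tendsto_const_nhds.congr' ?_
        filter_upwards [eventually_ballCutoff x] with m hm
        have h1 : (∂_{e i} (ballCutoff n m) : 𝓢(E n, ℂ)) x = 0 := by
          rw [SchwartzMap.lineDerivOp_apply_eq_fderiv]
          have : (ballCutoff n m : E n → ℂ) =ᶠ[𝓝 x] fun _ => (1 : ℂ) := hm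
          rw [this.fderiv_eq]
          simp
        rw [lineDerivOp_sub_apply, lineDerivOp_mulSchwartz, hm.self_of_nhds, h1]
        simp
  have h1 := h0.sqrt
  simpa using h1

theorem conjSchwartz_mulSchwartz_ballCutoff (m : ℕ) (s : 𝓢(E n, ℂ)) :
    conjSchwartz (mulSchwartz (ballCutoff n m) s) =
      mulSchwartz (ballCutoff n m) (conjSchwartz s) := by
  ext x
  simp only [conjSchwartz_apply, mulSchwartz_apply, map_mul, ballCutoff_apply, Complex.conj_ofReal]

-- Here s need not have compact support. Its truncations do, φ vanishes on them, and they converge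
-- in H¹, to which φ extends continuously.
open Distribution in
theorem dist_eq_zero_of_disjoint (φ : H n (-1)) {s : 𝓢(E n, ℂ)}
    (h : Disjoint (tsupport s) (dsupport (φ.dist : 𝓢(E n, ℂ) → ℂ))) : φ.dist s = 0 := by
  have h1 : ∀ m, φ.dist (mulSchwartz (ballCutoff n m) s) = 0 := by
    intro m
    apply apply_eq_zero_of_hasCompactSupport
    · rw [coe_mulSchwartz]
      exact (hasCompactSupport_scaled_bump n m).mul_right
    · rw [coe_mulSchwartz]
      exact h.mono_left (tsupport_mul_subset_right)
  have h2 : Tendsto (fun m => pairing φ (ofSchwartz n 1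
      (mulSchwartz (ballCutoff n m) (conjSchwartz s)))) atTop
      (𝓝 (pairing φ (ofSchwartz n 1 (conjSchwartz s)))) := by
    simp only [pairing_eq_inner (neg_add_cancel (1 : ℝ))]
    exact (((weightedFourierIsometry n 1).continuous.tendsto _).comp
      (tendsto_ofSchwartz_ballCutoff (conjSchwartz s))).inner tendsto_const_nhds
  rw [dist_eq_pairing 1]
  refine tendsto_nhds_unique h2 ?_
  simp only [← conjSchwartz_mulSchwartz_ballCutoff, ← dist_eq_pairing, h1]
  exact tendsto_const_nhds

-- This makes the choice inside `evalNearSupport` immaterial for elements of H⁻¹.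
open Distribution in
theorem dist_congr_near_dsupport (φ : H n (-1)) {s t : 𝓢(E n, ℂ)}
    (h : ∀ᶠ x in 𝓝ˢ (dsupport (φ.dist : 𝓢(E n, ℂ) → ℂ)), s x = t x) : φ.dist s = φ.dist t := by
  rw [← sub_eq_zero, ← map_sub]
  apply dist_eq_zero_of_disjoint
  rw [disjoint_right]
  intro x hx hxs
  have h1 : ⇑(s - t) =ᶠ[𝓝 x] 0 := by
    filter_upwards [(eventually_nhdsSet_iff_forall.mp h) x hx] with y hy
    simp [hy]
  exact (notMem_tsupport_iff_eventuallyEq.mpr h1) hxs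

end

/-! ### The trace operator and its adjoint -/

section TraceAdjoint

variable {n : ℕ} {μ : Measure (E n)} [IsFiniteMeasure μ]

theorem trace_ofSchwartz (h : TraceBounded μ) (v : 𝓢(E n, ℂ)) :
    trace μ (ofSchwartz n 1 v) = v.toLp 2 μ := by
  obtain ⟨C, -, hC⟩ := h
  exact LinearMap.extendOfNorm_eq (denseRange_ofSchwartz n 1) ⟨C, hC⟩ v

theorem pairing_traceAdj (f : Lp ℂ 2 μ) (v : H n 1) :
    pairing (traceAdj μ f) v = inner ℂ (trace μ v) f :=
  pairing_ofAntidual _ v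

theorem pairing_traceAdj_right (u : H n 1) (f : Lp ℂ 2 μ) :
    pairing u (traceAdj μ f) = l2inner μ (trace μ u) f := by
  rw [← conj_pairing, pairing_traceAdj, inner_conj_symm, l2inner]

omit [IsFiniteMeasure μ] in
theorem l2inner_eq_integral (f g : Lp ℂ 2 μ) : l2inner μ f g = ∫ x, f x * conj (g x) ∂μ := by
  rw [l2inner, L2.inner_def]
  simp only [RCLike.inner_apply]

theorem dist_traceAdj (h : TraceBounded μ) (f : Lp ℂ 2 μ) (s : 𝓢(E n, ℂ)) :
    (traceAdj μ f).dist s = ∫ x, s x * f x ∂μ := by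
  rw [dist_eq_pairing 1, pairing_traceAdj, trace_ofSchwartz h, L2.inner_def]
  refine integral_congr_ae ?_
  filter_upwards [SchwartzMap.coeFn_toLp (conjSchwartz s) 2 μ] with x hx
  rw [hx, RCLike.inner_apply, conjSchwartz_apply, Complex.conj_conj, mul_comm]

omit [IsFiniteMeasure μ] in
theorem measure_compl_eq_zero {Γ : Set (E n)} (hμ : μ.support = Γ) : μ Γᶜ = 0 :=
  hμ ▸ Measure.measure_compl_support

omit [IsFiniteMeasure μ] in
theorem ae_mem_of_support {Γ : Set (E n)} (hμ : μ.support = Γ) : ∀ᵐ x ∂μ, x ∈ Γ :=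
  mem_ae_iff.mpr (measure_compl_eq_zero hμ)

theorem traceAdj_mem_HGamma {Γ : Set (E n)} (hμ : μ.support = Γ) (h : TraceBounded μ)
    (f : Lp ℂ 2 μ) : traceAdj μ f ∈ HGamma Γ := by
  intro x hx
  by_contra hxΓ
  have hΓ : IsClosed Γ := hμ ▸ Measure.isClosed_support
  refine (Distribution.notMem_dsupport_iff x).mpr ⟨Γᶜ, fun s hs => ?_, hΓ.isOpen_compl, hxΓ⟩ hx
  rw [dist_traceAdj h]
  refine integral_eq_zero_of_ae ?_
  filter_upwards [ae_mem_of_support hμ] with y hy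
  have : y ∉ tsupport s := fun hys => hs hys hy
  simp [image_eq_zero_of_notMem_tsupport this]

/-- The kernel of the bounded operator T is closed and contains every test function supported off Γ,
since μ lives on Γ. -/
theorem trace_eq_zero_of_mem_HTilde {Γ : Set (E n)} (hμ : μ.support = Γ) (h : TraceBounded μ)
    {v : H n 1} (hv : v ∈ HTilde Γᶜ) : trace μ v = 0 := by
  have h1 : HTilde Γᶜ ≤ LinearMap.ker (trace μ).toLinearMap := by
    refine Submodule.topologicalClosure_minimal _ (Submodule.span_le.mpr ?_)
      (trace μ).isClosed_ker
    rintro _ ⟨s, -, hs, rfl⟩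
    change trace μ _ = 0
    rw [trace_ofSchwartz h, Lp.eq_zero_iff_ae_eq_zero]
    filter_upwards [ae_mem_of_support hμ, SchwartzMap.coeFn_toLp s 2 μ] with y hy hys
    have : y ∉ tsupport s := fun h => hs h hy
    simp [hys, image_eq_zero_of_notMem_tsupport this]
  exact h1 hv

/-- The defect v - Pv lies in the double orthogonal complement of the closed space `HTilde Γᶜ`, that
is, in this space itself, where the trace vanishes. -/
theorem trace_projV1 {Γ : Set (E n)} (hμ : μ.support = Γ) (h : TraceBounded μ) (v : H n 1) :
    trace μ (projV1 Γ v) = trace μ v := by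
  have h1 : v - projV1 Γ v ∈ (V1 Γ)ᗮ := Submodule.sub_starProjection_mem_orthogonal v
  have h2 : (V1 Γ)ᗮ = HTilde Γᶜ := by
    rw [V1, Submodule.orthogonal_orthogonal_eq_closure]
    exact IsClosed.submodule_topologicalClosure_eq (Submodule.isClosed_topologicalClosure _)
  have h3 := trace_eq_zero_of_mem_HTilde hμ h (h2 ▸ h1)
  rw [map_sub, sub_eq_zero] at h3
  exact h3.symm

theorem adjHH_embedHHDual (f : Lp ℂ 2 μ) : adjHH μ (embedHHDual μ f) = traceAdj μ f := by
  unfold adjHH traceAdj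
  congr 1

theorem formA_traceAdj {Γ : Set (E n)} (hμ : μ.support = Γ) (h : TraceBounded μ) (k : ℝ)
    (χ : 𝓢(E n, ℂ)) (f g : Lp ℂ 2 μ) :
    formA k Γ χ (traceAdj μ f) (traceAdj μ g) =
      l2inner μ (trace μ (cutoffNewton k χ (traceAdj μ f).dist)) g := by
  rw [formA, pairing_traceAdj_right, opA, trace_projV1 hμ h]

end TraceAdjoint

/-! ### Elements of Sobolev spaces given by integrable functions -/

section Representative

variable {n : ℕ}

theorem continuous_fourier_of_integrable {W : E n → ℂ} (hW : Integrable W) :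
    Continuous (𝓕 W) :=
  VectorFourier.fourierIntegral_continuous Real.continuous_fourierChar continuous_inner hW

theorem norm_fourier_le_integral_norm (W : E n → ℂ) (η : E n) : ‖𝓕 W η‖ ≤ ∫ x, ‖W x‖ :=
  VectorFourier.norm_fourierIntegral_le_integral_norm _ _ _ _ _

/-- Both functions are locally integrable and represent the Fourier transform of the same
distribution; testing with smooth functions of compact support forces them to agree almost
everywhere. -/
theorem fourierFun_eq_fourier {s : ℝ} {w : H n s} {W : E n → ℂ} (hW : Integrable W)
    (h : ∀ ψ : 𝓢(E n, ℂ), w.dist ψ = ∫ x, W x * ψ x) : fourierFun w =ᵐ[volume] 𝓕 W := by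
  refine ae_eq_of_integral_contDiff_smul_eq
    (LocallyIntegrable.continuous_mul (continuous_weight n (-s))
      ((Lp.memLp (weightedFourier w : L2 n)).locallyIntegrable one_le_two))
    (continuous_fourier_of_integrable hW).locallyIntegrable fun g hg hgc => ?_
  have hgc' : HasCompactSupport fun x => ((g x : ℝ) : ℂ) :=
    hgc.comp_left (g := fun r : ℝ => (r : ℂ)) Complex.ofReal_zero
  set G : 𝓢(E n, ℂ) := hgc'.toSchwartzMap (Complex.ofRealCLM.contDiff.comp hg)
  have hG : ∀ x, G x = (g x : ℂ) := fun x => rfl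
  have h1 := fourier_dist w G
  rw [TemperedDistribution.fourier_apply, h] at h1
  have h2 := VectorFourier.integral_fourierIntegral_smul_eq_flip (L := innerₗ (E n))
    Real.continuous_fourierChar continuous_inner hW
    (G.integrable (μ := volume))
  rw [flip_innerₗ] at h2
  have h3 : ∀ F : E n → ℂ, ∫ x, g x • F x = ∫ x, F x * G x := fun F => by
    refine integral_congr_ae (Eventually.of_forall fun x => ?_)
    simp only [hG, Complex.real_smul, mul_comm]
  rw [h3, h3, ← h1]
  exact h2.symm

-- It serves twice: with W the truncated kernel, to move the potential onto test functions, and with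
-- ψ a mollifier, to smooth elements of H¹.
open scoped Convolution in
theorem exists_schwartz_convolution {W : E n → ℂ} (hW : Integrable W) (hWc : HasCompactSupport W)
    {ψ : 𝓢(E n, ℂ)} (hψ : HasCompactSupport ψ) : ∃ s : 𝓢(E n, ℂ), HasCompactSupport s ∧
      (∀ x, s x = ∫ y, W (x - y) * ψ y) ∧ ∀ η, 𝓕 s η = 𝓕 W η * 𝓕 ψ η := by
  have h1 : HasCompactSupport (ψ ⋆[ContinuousLinearMap.mul ℝ ℂ, volume] W) :=
    hψ.convolution _ hWc
  have h2 : ContDiff ℝ (↑(⊤ : ℕ∞)) (ψ ⋆[ContinuousLinearMap.mul ℝ ℂ, volume] W) :=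
    hψ.contDiff_convolution_left _ ψ.smooth' hW.locallyIntegrable
  refine ⟨h1.toSchwartzMap h2, h1, fun x => ?_, fun η => ?_⟩
  · refine integral_congr_ae (Eventually.of_forall fun y => ?_)
    exact mul_comm _ _
  · rw [SchwartzMap.fourier_coe, SchwartzMap.fourier_coe, mul_comm]
    exact Real.fourier_mul_convolution_eq ψ.integrable hW η

/-- Bump functions supported in balls of radius `1 / (m + 1)`. -/
def shrinkingBump (n m : ℕ) : ContDiffBump (0 : E n) :=
  ⟨1 / (m + 2), 1 / (m + 1), by positivity, by gcongr; norm_num⟩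

theorem tendsto_rOut_shrinkingBump (n : ℕ) :
    Tendsto (fun m => (shrinkingBump n m).rOut) atTop (𝓝 0) :=
  tendsto_one_div_add_atTop_nhds_zero_nat

theorem hasCompactSupport_ofReal_normed (m : ℕ) :
    HasCompactSupport fun x : E n => (((shrinkingBump n m).normed volume x : ℝ) : ℂ) :=
  (shrinkingBump n m).hasCompactSupport_normed.comp_left (g := fun r : ℝ => (r : ℂ))
    Complex.ofReal_zero

/-- The mollifier `shrinkingBump`, of integral `1`, as a Schwartz function. -/
def mollifier (n m : ℕ) : 𝓢(E n, ℂ) :=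
  (hasCompactSupport_ofReal_normed m).toSchwartzMap
    (Complex.ofRealCLM.contDiff.comp (shrinkingBump n m).contDiff_normed)

theorem mollifier_apply (m : ℕ) (x : E n) :
    mollifier n m x = (((shrinkingBump n m).normed volume x : ℝ) : ℂ) := rfl

theorem norm_fourier_mollifier_le (m : ℕ) (η : E n) : ‖𝓕 (mollifier n m) η‖ ≤ 1 := by
  rw [SchwartzMap.fourier_coe]
  refine (norm_fourier_le_integral_norm _ η).trans (le_of_eq ?_)
  rw [← (shrinkingBump n m).integral_normed (μ := volume)]
  refine integral_congr_ae (Eventually.of_forall fun x => ?_)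
  simp only [mollifier_apply, Complex.norm_real, Real.norm_eq_abs]
  exact abs_of_nonneg ((shrinkingBump n m).nonneg_normed x)

theorem tendsto_integral_mollifier {W : E n → ℂ} (hW : AEStronglyMeasurable W) {x : E n}
    (hx : ContinuousAt W x) :
    Tendsto (fun m => ∫ y, W (x - y) * mollifier n m y) atTop (𝓝 (W x)) := by
  refine (ContDiffBump.convolution_tendsto_right (μ := volume) (g := fun _ => W) (k := fun _ => x)
    (tendsto_rOut_shrinkingBump n) (Eventually.of_forall fun _ => hW)
    (hx.tendsto.comp tendsto_snd) tendsto_const_nhds).congr fun m => ?_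
  refine integral_congr_ae (Eventually.of_forall fun y => ?_)
  simp only [mollifier_apply, ContinuousLinearMap.lsmul_apply, Complex.real_smul, mul_comm]

theorem tendsto_fourier_mollifier (η : E n) :
    Tendsto (fun m => 𝓕 (mollifier n m) η) atTop (𝓝 1) := by
  have hc : Continuous fun x : E n => ((Real.fourierChar (inner ℝ x η) : Circle) : ℂ) := by
    simp only [Real.fourierChar_apply]
    fun_prop
  have h := tendsto_integral_mollifier hc.aestronglyMeasurable (hc.continuousAt (x := 0))
  simp only [inner_zero_left, AddChar.map_zero_eq_one, Circle.coe_one] at h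
  refine h.congr fun m => ?_
  rw [SchwartzMap.fourier_coe, Real.fourier_eq]
  refine integral_congr_ae (Eventually.of_forall fun y => ?_)
  simp only [zero_sub, inner_neg_left, Circle.smul_def, smul_eq_mul]

theorem norm_sq_eq_integral (f : L2 n) : ‖f‖ ^ 2 = ∫ x, ‖f x‖ ^ 2 := by
  have h := inner_self_eq_norm_sq_to_K (𝕜 := ℂ) f
  rw [L2.inner_def] at h
  simp only [inner_self_eq_norm_sq_to_K] at h
  have h2 : ∫ x, ((‖f x‖ : ℝ) : ℂ) ^ 2 = ((∫ x, ‖f x‖ ^ 2 : ℝ) : ℂ) := by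
    rw [← integral_complex_ofReal]
    simp
  refine Complex.ofReal_injective ?_
  rw [Complex.ofReal_pow, ← h2]
  exact h.symm

/-- An element of `H¹(ℝⁿ)` that is given by an integrable function of compact support is the limit
of its mollifications. -/
theorem exists_schwartz_tendsto {w : H n 1} {W : E n → ℂ} (hW : Integrable W)
    (hWc : HasCompactSupport W) (h : ∀ ψ : 𝓢(E n, ℂ), w.dist ψ = ∫ x, W x * ψ x) :
    ∃ s : ℕ → 𝓢(E n, ℂ), (∀ m x, s m x = ∫ y, W (x - y) * mollifier n m y) ∧
      Tendsto (fun m => ofSchwartz n 1 (s m)) atTop (𝓝 w) := by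
  choose s _ hs hsF using fun m =>
    exists_schwartz_convolution hW hWc (ψ := mollifier n m) (hasCompactSupport_ofReal_normed m)
  refine ⟨s, hs, ?_⟩
  rw [tendsto_iff_norm_sub_tendsto_zero]
  have h0 : Tendsto (fun m => ‖ofSchwartz n 1 (s m) - w‖ ^ 2) atTop (𝓝 0) := by
    -- Mollification multiplies the Fourier transform by that of the mollifier, so the error is the
    -- factor (mollifier transform - 1). It is at most 2 in modulus and tends to 0 pointwise.
    have h1 : ∀ m, ‖ofSchwartz n 1 (s m) - w‖ ^ 2 =
        ∫ η, ‖𝓕 (mollifier n m) η - 1‖ ^ 2 * ‖(weightedFourier w : L2 n) η‖ ^ 2 := by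
      intro m
      rw [← norm_weightedFourier, norm_sq_eq_integral, map_sub]
      refine integral_congr_ae ?_
      filter_upwards [Lp.coeFn_sub (weightedFourier (ofSchwartz n 1 (s m)) : L2 n)
        (weightedFourier w), coeFn_weightedFourier_ofSchwartz 1 (s m),
        fourierFun_eq_fourier hW h] with η h1 h2 h3
      have h4 : (weightedFourier w : L2 n) η = weight n 1 η * 𝓕 W η := by
        rw [← h3, fourierFun, ← mul_assoc, mul_comm (weight n 1 η), weight_neg_mul, one_mul]
      rw [h1, Pi.sub_apply, h2, hsF, h4, ← mul_pow, ← norm_mul]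
      congr 2
      ring
    simp only [h1]
    rw [show (0 : ℝ) = ∫ _ : E n, (0 : ℝ) by simp]
    have hi : Integrable fun η => ‖(weightedFourier w : L2 n) η‖ ^ 2 :=
      (Lp.memLp (weightedFourier w : L2 n)).integrable_norm_pow (by simp)
    refine tendsto_integral_of_dominated_convergence
      (fun η => 4 * ‖(weightedFourier w : L2 n) η‖ ^ 2) (fun m => ?_) (hi.const_mul 4)
      (fun m => Eventually.of_forall fun η => ?_) (Eventually.of_forall fun η => ?_)
    · have : Continuous fun η => ‖𝓕 (mollifier n m) η - 1‖ ^ 2 :=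
        (((𝓕 (mollifier n m) : 𝓢(E n, ℂ)).continuous.sub continuous_const).norm.pow 2)
      exact this.aestronglyMeasurable.mul hi.aestronglyMeasurable
    · rw [Real.norm_eq_abs, abs_of_nonneg (by positivity)]
      have : ‖𝓕 (mollifier n m) η - 1‖ ≤ 2 := by
        refine (norm_sub_le _ _).trans ?_
        rw [norm_one]
        linarith [norm_fourier_mollifier_le m η]
      have h2 : ‖𝓕 (mollifier n m) η - 1‖ ^ 2 ≤ 2 ^ 2 := by gcongr
      nlinarith [sq_nonneg ‖(weightedFourier w : L2 n) η‖]
    · have := (((tendsto_fourier_mollifier η).sub_const 1).norm.pow 2).mul_const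
        (‖(weightedFourier w : L2 n) η‖ ^ 2)
      simpa using this
  simpa using h0.sqrt

/-- The trace of an element of `H¹(ℝⁿ)` that is given by a function continuous at the points of the
support of the measure is the restriction of that function. -/
theorem trace_eq_of_continuousAt {μ : Measure (E n)} [IsFiniteMeasure μ] {Γ : Set (E n)}
    (hμ : μ.support = Γ) (htr : TraceBounded μ) {w : H n 1} {W : E n → ℂ} (hW : Integrable W)
    (hWc : HasCompactSupport W) (h : ∀ ψ : 𝓢(E n, ℂ), w.dist ψ = ∫ x, W x * ψ x)
    (hΓ : ∀ x ∈ Γ, ContinuousAt W x) : trace μ w =ᵐ[μ] W := by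
  obtain ⟨s, hs, hsw⟩ := exists_schwartz_tendsto hW hWc h
  have h1 : Tendsto (fun m => (s m).toLp 2 μ) atTop (𝓝 (trace μ w)) := by
    simp only [← trace_ofSchwartz htr]
    exact ((trace μ).continuous.tendsto w).comp hsw
  -- L²(μ) convergence yields a subsequence converging μ-almost everywhere. Its limit must be the
  -- pointwise limit W, which exists at each point of Γ by continuity there.
  obtain ⟨ns, hns, hae⟩ := (tendstoInMeasure_of_tendsto_Lp h1).exists_seq_tendsto_ae
  have h2 : ∀ᵐ x ∂μ, ∀ m, ((s m).toLp 2 μ : Lp ℂ 2 μ) x = s m x :=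
    ae_all_iff.mpr fun m => SchwartzMap.coeFn_toLp (s m) 2 μ
  filter_upwards [hae, h2, ae_mem_of_support hμ] with x hx h2x hxΓ
  refine tendsto_nhds_unique hx ?_
  simp only [h2x, hs]
  exact (tendsto_integral_mollifier hW.aestronglyMeasurable (hΓ x hxΓ)).comp hns.tendsto_atTop

end Representative

/-! ### The Newtonian potential of a compactly supported element of `H⁻¹(ℝⁿ)` -/

section Newton

variable {n : ℕ}

theorem Phi_comm (k : ℝ) (x y : E n) : Phi k x y = Phi k y x := by
  simp only [Phi, norm_sub_rev x y]

theorem evalNearSupport_eq (φ : H n (-1)) {g : E n → ℂ} {s : 𝓢(E n, ℂ)}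
    (h : ∀ᶠ x in 𝓝ˢ (Distribution.dsupport (φ.dist : 𝓢(E n, ℂ) → ℂ)), s x = g x) :
    evalNearSupport φ.dist g = φ.dist s := by
  have hex : ∃ s : 𝓢(E n, ℂ),
      ∀ᶠ x in 𝓝ˢ (Distribution.dsupport (φ.dist : 𝓢(E n, ℂ) → ℂ)), s x = g x := ⟨s, h⟩
  rw [evalNearSupport, dif_pos hex]
  apply dist_congr_near_dsupport
  filter_upwards [hex.choose_spec, h] with x h1 h2
  rw [h1, h2]

theorem ae_ne_point (hn : 2 ≤ n) (x : E n) : ∀ᵐ y : E n, x ≠ y := by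
  have : Nonempty (Fin n) := ⟨⟨0, by omega⟩⟩
  have : Nontrivial (E n) := inferInstance
  filter_upwards [Measure.ae_ne volume x] with y hy using hy.symm

theorem newtonFun_eq_truncated (hn : 2 ≤ n) {k R a b : ℝ} {K : E n → ℂ}
    (hK : ∀ x y, x ≠ y → ‖x - y‖ ≤ R → K (x - y) = Phi k x y) (hab : a + b ≤ R) {x : E n}
    (hx : ‖x‖ ≤ a) {ψ : E n → ℂ} (hψ : ∀ y, ψ y ≠ 0 → ‖y‖ ≤ b) :
    ∫ y, K (x - y) * ψ y = newtonFun k ψ x := by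
  refine integral_congr_ae ?_
  filter_upwards [ae_ne_point hn x] with y hxy
  by_cases hy : ψ y = 0
  · simp [hy]
  · have hy' := hψ y hy
    rw [hK x y hxy ((norm_sub_le x y).trans (by linarith))]

/-- Γ lies strictly inside the ball of radius a, so K * ψ agrees with the potential of ψ on a
neighbourhood of the support of φ. K * ψ is therefore an admissible choice in `evalNearSupport`. -/
theorem newton_eq_dist (hn : 2 ≤ n) {k R a b : ℝ} {K : E n → ℂ}
    (hK : ∀ x y, x ≠ y → ‖x - y‖ ≤ R → K (x - y) = Phi k x y) (hab : a + b ≤ R)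
    {Γ : Set (E n)} (hΓ : ∀ x ∈ Γ, ‖x‖ < a) {ψ : E n → ℂ} (hψ : ∀ y, ψ y ≠ 0 → ‖y‖ ≤ b)
    {s : 𝓢(E n, ℂ)} (hs : ∀ x, s x = ∫ y, K (x - y) * ψ y) {φ : H n (-1)} (hφ : φ ∈ HGamma Γ) :
    newton k φ.dist ψ = φ.dist s := by
  apply evalNearSupport_eq
  rw [eventually_nhdsSet_iff_forall]
  intro x hx
  filter_upwards [(continuous_norm.tendsto x).eventually (Iio_mem_nhds (hΓ x (hφ hx)))] with y hy
  rw [hs, newtonFun_eq_truncated hn hK hab (le_of_lt hy) hψ]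

theorem exists_norm_bound_of_hasCompactSupport {ψ : E n → ℂ} (hψ : HasCompactSupport ψ) :
    ∃ b, ∀ y, ψ y ≠ 0 → ‖y‖ ≤ b := by
  obtain ⟨b, hb⟩ := hψ.isCompact.isBounded.exists_norm_le
  exact ⟨b, fun y hy => hb y (subset_tsupport ψ hy)⟩

theorem exists_norm_lt_of_isCompact {Γ : Set (E n)} (hΓ : IsCompact Γ) :
    ∃ a, ∀ x ∈ Γ, ‖x‖ < a := by
  obtain ⟨a, ha⟩ := hΓ.isBounded.exists_norm_le
  exact ⟨a + 1, fun x hx => (ha x hx).trans_lt (lt_add_one a)⟩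

theorem fourier_even {K : E n → ℂ} (hK : ∀ x, K (-x) = K x) (η : E n) : 𝓕 K (-η) = 𝓕 K η := by
  rw [← Real.fourierInv_eq_fourier_neg, Real.fourierInv_eq_fourier_comp_neg]
  simp only [hK]

/-- On test functions supported in a fixed ball the Newtonian potential of `φ ∈ H⁻¹_Γ` is an element
of `H¹(ℝⁿ)`. -/
theorem exists_newton_mem_H1 (hn : 2 ≤ n) {k : ℝ} (hk : 0 < k) {Γ : Set (E n)} (hΓ : IsCompact Γ)
    (b : ℝ) {φ : H n (-1)} (hφ : φ ∈ HGamma Γ) :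
    ∃ w : H n 1, ∀ ψ : 𝓢(E n, ℂ), HasCompactSupport ψ → (∀ y, ψ y ≠ 0 → ‖y‖ ≤ b) →
      newton k φ.dist ψ = w.dist ψ := by
  obtain ⟨a, ha⟩ := exists_norm_lt_of_isCompact hΓ
  obtain ⟨K, hKi, hKc, hKe, hK, D, -, hD⟩ := exists_truncated_kernel hn hk (a + b)
  obtain ⟨w, hw⟩ := exists_fourier_multiplier
    (continuous_fourier_of_integrable hKi).aestronglyMeasurable hD φ
  refine ⟨w, fun ψ hψc hψ => ?_⟩
  obtain ⟨s, -, hs, hsF⟩ := exists_schwartz_convolution hKi hKc hψc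
  rw [newton_eq_dist hn hK le_rfl ha hψ hs hφ, dist_apply, dist_apply]
  refine integral_congr_ae ?_
  filter_upwards [hw] with η hη
  -- The inverse transform of K * ψ at η is K̂(-η) times that of ψ. As K is even, this is the
  -- multiplier K̂(η) that defines w.
  have h1 : ∀ v : 𝓢(E n, ℂ), 𝓕⁻ v η = 𝓕 v (-η) := fun v => by
    rw [SchwartzMap.fourier_coe, SchwartzMap.fourierInv_coe, Real.fourierInv_eq_fourier_neg]
  rw [hη, h1, h1, hsF, fourier_even hKe]
  ring

theorem exists_isCutoffNewton (hn : 2 ≤ n) {k : ℝ} (hk : 0 < k) {Γ : Set (E n)}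
    (hΓ : IsCompact Γ) {χ : 𝓢(E n, ℂ)} (hχ : HasCompactSupport χ) {φ : H n (-1)}
    (hφ : φ ∈ HGamma Γ) : ∃ v : H n 1, IsCutoffNewton k χ φ.dist v := by
  obtain ⟨b, hb⟩ := exists_norm_bound_of_hasCompactSupport hχ
  obtain ⟨w, hw⟩ := exists_newton_mem_H1 hn hk hΓ b hφ
  obtain ⟨v, hv⟩ := exists_mul_schwartz χ w
  refine ⟨v, fun ψ => ?_⟩
  rw [hv, ← coe_mulSchwartz, hw]
  · rw [coe_mulSchwartz]
    exact hχ.mul_right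
  · intro y hy
    rw [mulSchwartz_apply] at hy
    exact hb y (left_ne_zero_of_mul hy)

theorem isCutoffNewton_cutoffNewton {k : ℝ} {χ : 𝓢(E n, ℂ)} {φ : 𝓢'(E n, ℂ)}
    (h : ∃ v : H n 1, IsCutoffNewton k χ φ v) : IsCutoffNewton k χ φ (cutoffNewton k χ φ) := by
  rw [cutoffNewton, dif_pos h]
  exact h.choose_spec

/-- A single Schwartz function represents the potential of ψ for all φ in H⁻¹_Γ. This restores
linearity in φ, hidden by the choice in `newton`, and the bound ‖K‖₁ sup|ψ|, uniform over Γ,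
prepares Fubini's theorem. -/
theorem exists_dual_newton (hn : 2 ≤ n) {k : ℝ} (hk : 0 < k) {Γ : Set (E n)} (hΓ : IsCompact Γ)
    {ψ : 𝓢(E n, ℂ)} (hψ : HasCompactSupport ψ) :
    ∃ s : 𝓢(E n, ℂ), (∀ x ∈ Γ, Integrable (fun y => Phi k x y * ψ y) ∧ s x = newtonFun k ψ x) ∧
      (∃ C, ∀ x ∈ Γ, ∫ y, ‖Phi k x y * ψ y‖ ≤ C) ∧
      ∀ φ ∈ HGamma Γ, newton k φ.dist ψ = φ.dist s := by
  obtain ⟨a, ha⟩ := exists_norm_lt_of_isCompact hΓ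
  obtain ⟨b, hb⟩ := exists_norm_bound_of_hasCompactSupport hψ
  obtain ⟨K, hKi, hKc, -, hK, -⟩ := exists_truncated_kernel hn hk (a + b)
  obtain ⟨s, -, hs, -⟩ := exists_schwartz_convolution hKi hKc hψ
  obtain ⟨M, hM⟩ := hψ.exists_bound_of_continuous ψ.continuous
  have hae : ∀ x ∈ Γ, (fun y => K (x - y) * ψ y) =ᵐ[volume] fun y => Phi k x y * ψ y := by
    intro x hx
    filter_upwards [ae_ne_point hn x] with y hxy
    by_cases hy : ψ y = 0
    · simp [hy]
    · rw [hK x y hxy ((norm_sub_le x y).trans (by linarith [hb y hy, ha x hx]))]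
  have hint : ∀ x, Integrable fun y => K (x - y) * ψ y := fun x =>
    (hKi.comp_sub_left x).mul_bdd ψ.continuous.aestronglyMeasurable (Eventually.of_forall hM)
  refine ⟨s, fun x hx => ⟨(hint x).congr (hae x hx), ?_⟩, ⟨(∫ y, ‖K y‖) * M, fun x hx => ?_⟩,
    fun φ hφ => newton_eq_dist hn hK le_rfl ha hb hs hφ⟩
  · rw [hs, newtonFun_eq_truncated hn hK le_rfl (ha x hx).le hb]
  · have h0 : ∫ y, ‖Phi k x y * ψ y‖ = ∫ y, ‖K (x - y) * ψ y‖ :=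
      integral_congr_ae ((hae x hx).symm.fun_comp norm)
    rw [h0]
    have h1 : ∫ y, ‖K (x - y) * ψ y‖ ≤ ∫ y, ‖K (x - y)‖ * M := by
      refine integral_mono (hint x).norm ((hKi.comp_sub_left x).norm.mul_const M) fun y => ?_
      rw [norm_mul]
      exact mul_le_mul_of_nonneg_left (hM y) (norm_nonneg _)
    rw [integral_mul_const, integral_sub_left_eq_self (fun y => ‖K y‖) volume x] at h1
    exact h1

end Newton

/-! ### Single-layer type potentials of measures -/

section Potential

variable {n : ℕ}

theorem continuousOn_Phi {k : ℝ} (hk : 0 < k) :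
    ContinuousOn (fun p : E n × E n => Phi k p.1 p.2) {p | p.1 ≠ p.2} := by
  have h : ContinuousOn (fun p : E n × E n => phiSq n k (‖p.1 - p.2‖ ^ 2)) {p | p.1 ≠ p.2} := by
    refine (contDiffOn_phiSq n hk).continuousOn.comp (by fun_prop) fun p hp => ?_
    have : 0 < ‖p.1 - p.2‖ := norm_pos_iff.mpr (sub_ne_zero.mpr hp)
    exact pow_pos this 2
  exact h.congr fun p hp => Phi_eq_phiSq hk hp

/-- On the diagonal the formula takes one constant value, so Φ is a piecewise function on an open
set and its complement, continuous on the former. -/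
theorem measurable_Phi {k : ℝ} (hk : 0 < k) :
    Measurable fun p : E n × E n => Phi k p.1 p.2 := by
  classical
  have hs : MeasurableSet {p : E n × E n | p.1 ≠ p.2} :=
    (isOpen_ne_fun continuous_fst continuous_snd).measurableSet
  have h := (continuousOn_Phi (n := n) hk).measurable_piecewise
    (g := fun _ => Phi k (0 : E n) 0) continuousOn_const hs
  convert h using 1
  funext p
  by_cases hp : p.1 ≠ p.2
  · rw [piecewise_eq_of_mem _ _ _ hp]
  · rw [piecewise_eq_of_notMem _ _ _ hp]
    rw [not_not] at hp
    simp [Phi, hp]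

variable {μ : Measure (E n)} [IsFiniteMeasure μ]

/-- The Newtonian potential of the adjoint trace of `f` is the function `∫ Φ(·, y) f(y) dμ(y)`. -/
theorem newton_traceAdj (hn : 2 ≤ n) {k : ℝ} (hk : 0 < k) {Γ : Set (E n)} (hΓ : IsCompact Γ)
    (hμ : μ.support = Γ) (htr : TraceBounded μ) (f : Lp ℂ 2 μ) {ψ : 𝓢(E n, ℂ)}
    (hψ : HasCompactSupport ψ) :
    Integrable (fun x => (∫ y, Phi k x y * f y ∂μ) * ψ x) ∧
    newton k (traceAdj μ f).dist ψ = ∫ x, (∫ y, Phi k x y * f y ∂μ) * ψ x := by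
  obtain ⟨s, hs, ⟨C, hC⟩, hφ⟩ := exists_dual_newton hn hk hΓ hψ
  have hf : Integrable f μ := (Lp.memLp f).integrable one_le_two
  have hm : AEStronglyMeasurable (fun p : E n × E n => Phi k p.1 p.2 * ψ p.2 * f p.1)
      (μ.prod volume) :=
    ((measurable_Phi hk).aestronglyMeasurable.mul
      (ψ.continuous.comp continuous_snd).aestronglyMeasurable).mul hf.aestronglyMeasurable.comp_fst
  -- The slice at x in Γ has L¹ norm at most C|f(x)|, which is μ-integrable because μ is finite and
  -- f is in L².
  have hi : Integrable (fun p : E n × E n => Phi k p.1 p.2 * ψ p.2 * f p.1) (μ.prod volume) := by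
    refine (integrable_prod_iff hm).mpr ⟨?_, ?_⟩
    · filter_upwards [ae_mem_of_support hμ] with x hx
      exact (hs x hx).1.mul_const _
    · refine (hf.norm.const_mul C).mono' hm.norm.integral_prod_right' ?_
      filter_upwards [ae_mem_of_support hμ] with x hx
      simp only [norm_mul _ (f x), integral_mul_const]
      rw [Real.norm_eq_abs, abs_of_nonneg
        (mul_nonneg (integral_nonneg fun _ => norm_nonneg _) (norm_nonneg _))]
      exact mul_le_mul_of_nonneg_right (hC x hx) (norm_nonneg _)
  have he : ∀ y, ∫ x, Phi k x y * ψ y * f x ∂μ = (∫ x, Phi k y x * f x ∂μ) * ψ y := by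
    intro y
    rw [← integral_mul_const]
    refine integral_congr_ae (Eventually.of_forall fun x => ?_)
    simp only [Phi_comm k x y]
    ring
  refine ⟨hi.integral_prod_right.congr (Eventually.of_forall he), ?_⟩
  rw [hφ _ (traceAdj_mem_HGamma hμ htr f), dist_traceAdj htr]
  calc ∫ x, s x * f x ∂μ = ∫ x, (∫ y, Phi k x y * ψ y * f x) ∂μ := by
        refine integral_congr_ae ?_
        filter_upwards [ae_mem_of_support hμ] with x hx
        rw [(hs x hx).2, newtonFun, ← integral_mul_const]
    _ = ∫ y, ∫ x, Phi k x y * ψ y * f x ∂μ :=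
        integral_integral_swap (f := fun x y => Phi k x y * ψ y * f x) hi
    _ = _ := by simp only [he]

theorem sum_smul_traceAdj {ι : Type*} [Fintype ι] (c : ι → ℂ) (f : ι → Lp ℂ 2 μ) :
    ∑ j, c j • traceAdj μ (f j) = traceAdj μ (∑ j, c j • f j) := by
  have h : ∀ (g : Lp ℂ 2 μ) ψ, (traceAdj μ g).dist ψ =
      inner ℂ (trace μ (ofSchwartz n 1 (conjSchwartz ψ))) g := fun g ψ => by
    rw [dist_eq_pairing 1, pairing_traceAdj]
  refine dist_injective fun ψ => ?_
  rw [h, inner_sum, map_sum, sum_apply]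
  refine Finset.sum_congr rfl fun j _ => ?_
  rw [map_smul, smul_apply, h, inner_smul_right, smul_eq_mul]

theorem newton_sum_traceAdj (hn : 2 ≤ n) {k : ℝ} (hk : 0 < k) {Γ : Set (E n)} (hΓ : IsCompact Γ)
    (hμ : μ.support = Γ) (htr : TraceBounded μ) {ι : Type*} [Fintype ι] (c : ι → ℂ)
    (f : ι → Lp ℂ 2 μ) {ψ : 𝓢(E n, ℂ)} (hψ : HasCompactSupport ψ) :
    newton k (∑ j, c j • traceAdj μ (f j)).dist ψ =
      ∑ j, c j * newton k (traceAdj μ (f j)).dist ψ := by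
  obtain ⟨s, -, -, hφ⟩ := exists_dual_newton hn hk hΓ hψ
  rw [hφ _ (sum_smul_traceAdj c f ▸ traceAdj_mem_HGamma hμ htr _), map_sum, sum_apply]
  refine Finset.sum_congr rfl fun j _ => ?_
  rw [hφ _ (traceAdj_mem_HGamma hμ htr _), map_smul, smul_apply, smul_eq_mul]

/-! ### Integrals of continuous kernels against the measure. -/

section Kernel

variable {Γ V : Set (E n)} {κ : E n → E n → ℂ} {f : E n → ℂ}

omit [IsFiniteMeasure μ] in
theorem integrable_kernel_mul (hΓ : IsCompact Γ) (hμ : μ.support = Γ) {x : E n}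
    (hκ : ContinuousOn (κ x) Γ) (hf : Integrable f μ) : Integrable (fun y => κ x y * f y) μ := by
  have hr : μ.restrict Γ = μ := Measure.restrict_eq_self_of_ae_mem (ae_mem_of_support hμ)
  have hf' : IntegrableOn f Γ μ := by rwa [IntegrableOn, hr]
  have h := hf'.continuousOn_mul hκ hΓ
  rwa [IntegrableOn, hr] at h

omit [IsFiniteMeasure μ] in
theorem continuousOn_integral_kernel (hΓ : IsCompact Γ) (hμ : μ.support = Γ) (hV : IsOpen V)
    (hκ : ContinuousOn (fun p : E n × E n => κ p.1 p.2) (V ×ˢ Γ)) (hf : Integrable f μ) :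
    ContinuousOn (fun x => ∫ y, κ x y * f y ∂μ) V := by
  intro x₀ hx₀
  obtain ⟨r, hr, hrV⟩ := Metric.nhds_basis_closedBall.mem_iff.mp (hV.mem_nhds hx₀)
  have hsub : Metric.closedBall x₀ r ×ˢ Γ ⊆ V ×ˢ Γ := prod_mono hrV Subset.rfl
  obtain ⟨C, hC⟩ := ((isCompact_closedBall x₀ r).prod hΓ).exists_bound_of_continuousOn (hκ.mono hsub)
  refine ContinuousAt.continuousWithinAt ?_
  have hmem : ∀ᶠ x in 𝓝 x₀, x ∈ Metric.closedBall x₀ r := Metric.closedBall_mem_nhds x₀ hr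
  refine continuousAt_of_dominated (bound := fun y => C * ‖f y‖) ?_ ?_ (hf.norm.const_mul C) ?_
  · filter_upwards [hmem] with x hx
    have h1 : ContinuousOn (κ x) Γ :=
      hκ.comp (f := fun y => (x, y)) (by fun_prop) fun y hy => ⟨hrV hx, hy⟩
    exact (integrable_kernel_mul hΓ hμ h1 hf).aestronglyMeasurable
  · filter_upwards [hmem] with x hx
    filter_upwards [ae_mem_of_support hμ] with y hy
    rw [norm_mul]
    exact mul_le_mul_of_nonneg_right (hC (x, y) ⟨hx, hy⟩) (norm_nonneg _)
  · filter_upwards [ae_mem_of_support hμ] with y hy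
    have h1 : ContinuousOn (fun x => κ x y) V :=
      hκ.comp (f := fun x => (x, y)) (by fun_prop) fun x hx => ⟨hx, hy⟩
    exact (h1.continuousAt (hV.mem_nhds hx₀)).mul continuousAt_const

end Kernel

omit [IsFiniteMeasure μ] in
theorem integrable_Phi_mul {k : ℝ} (hk : 0 < k) {Γ : Set (E n)} (hΓ : IsCompact Γ)
    (hμ : μ.support = Γ) {f : E n → ℂ} (hf : Integrable f μ) {x : E n} (hx : x ∉ Γ) :
    Integrable (fun y => Phi k x y * f y) μ :=
  integrable_kernel_mul hΓ hμ ((continuousOn_Phi hk).comp (f := fun y => (x, y)) (by fun_prop)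
    fun y hy (h : x = y) => hx (h ▸ hy)) hf

omit [IsFiniteMeasure μ] in
theorem continuousOn_potential {k : ℝ} (hk : 0 < k) {Γ : Set (E n)} (hΓ : IsCompact Γ)
    (hμ : μ.support = Γ) {f : E n → ℂ} (hf : Integrable f μ) :
    ContinuousOn (fun x => ∫ y, Phi k x y * f y ∂μ) Γᶜ :=
  continuousOn_integral_kernel hΓ hμ hΓ.isClosed.isOpen_compl
    ((continuousOn_Phi hk).mono fun p hp => by
      intro h
      exact hp.1 (h ▸ hp.2)) hf

end Potential

/-- A distribution on an open set is given by at most one continuous function. -/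
theorem eqOn_of_integral_mul_eq {n : ℕ} {G : Set (E n)} (hG : IsOpen G) {u v : E n → ℂ}
    (hu : ContinuousOn u G) (hv : ContinuousOn v G)
    (h : ∀ ψ : 𝓢(E n, ℂ), HasCompactSupport ψ → tsupport ψ ⊆ G →
      ∫ x, u x * ψ x = ∫ x, v x * ψ x) : EqOn u v G := by
  have h1 : ∀ᵐ x, x ∈ G → (u - v) x = 0 := by
    refine hG.ae_eq_zero_of_integral_contDiff_smul_eq_zero
      ((hu.sub hv).locallyIntegrableOn hG.measurableSet) fun g hg hgc hgs => ?_
    have hgc' : HasCompactSupport fun x => ((g x : ℝ) : ℂ) :=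
      hgc.comp_left (g := fun r : ℝ => (r : ℂ)) Complex.ofReal_zero
    set ψ : 𝓢(E n, ℂ) := hgc'.toSchwartzMap (Complex.ofRealCLM.contDiff.comp hg)
    have hψs : tsupport ψ ⊆ G := by
      refine (closure_mono fun x hx => ?_).trans hgs
      rw [Function.mem_support] at hx ⊢
      exact fun h0 => hx (by change ((g x : ℝ) : ℂ) = 0; simp [h0])
    have hint : ∀ {w : E n → ℂ}, ContinuousOn w G → Integrable fun x => w x * ψ x := fun hw => by
      rw [← integrableOn_iff_integrable_of_support_subset
        ((Function.support_mul_subset_right _ _).trans (subset_tsupport ψ))]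
      exact ((hw.mono hψs).mul ψ.continuous.continuousOn).integrableOn_compact hgc'.isCompact
    calc ∫ x, g x • (u - v) x = ∫ x, (u x * ψ x - v x * ψ x) := by
          refine integral_congr_ae (Eventually.of_forall fun x => ?_)
          simp only [Pi.sub_apply, Complex.real_smul]
          change (g x : ℂ) * _ = u x * (g x : ℂ) - v x * (g x : ℂ)
          ring
      _ = 0 := by rw [integral_sub (hint hu) (hint hv), h ψ hgc' hψs, sub_self]
  refine Measure.eqOn_open_of_ae_eq (μ := volume) ((ae_restrict_iff' hG.measurableSet).mpr ?_) hG hu hv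
  filter_upwards [h1] with x hx hxG
  exact sub_eq_zero.mp (hx hxG)

/-! ### Measures with uniformly small singular integrals -/

section UniformlySmall

variable {n : ℕ}

theorem one_le_singSize_sub_one {r : ℝ} (hn : 2 ≤ n) (hr : 0 < r) (hr' : r ≤ 1 / 4) :
    1 ≤ if n = 2 then |Real.log r| else r ^ (2 - (n : ℝ)) := by
  split_ifs with h2
  · have h1 : Real.log r ≤ -1 := by
      rw [Real.log_le_iff_le_exp hr]
      linarith [Real.exp_neg_one_gt_d9]
    rw [abs_of_nonpos (by linarith)]
    linarith
  · refine Real.one_le_rpow_of_pos_of_le_one_of_nonpos hr (by linarith) ?_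
    have : (2 : ℝ) ≤ n := by exact_mod_cast hn
    linarith

theorem exists_enorm_Phi_le (hn : 2 ≤ n) {k : ℝ} (hk : 0 < k) : ∃ A : ℝ, ∀ x y : E n,
    ‖x - y‖ ≤ 1 / 4 → ‖Phi k x y‖ₑ ≤ ENNReal.ofReal A * singFun n ‖x - y‖ := by
  obtain ⟨C, hC0, hC⟩ := exists_norm_phiSq_le hn hk (1 / 4)
  -- For r ≤ 1/4 the singular function is at least 1, so 1 + F_n ≤ 2F_n. The extra 1 keeps the
  -- constant positive, so that on the diagonal the right side is ∞ even if C = 0.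
  refine ⟨2 * C + 1, fun x y hxy => ?_⟩
  rcases eq_or_ne x y with rfl | hne
  · have : ENNReal.ofReal (2 * C + 1) ≠ 0 := by
      rw [Ne, ENNReal.ofReal_eq_zero, not_le]
      linarith
    simp [singFun, ENNReal.mul_top this]
  · have hr : 0 < ‖x - y‖ := norm_pos_iff.mpr (sub_ne_zero.mpr hne)
    have h1 := one_le_singSize_sub_one hn hr hxy
    have h2 := hC _ hr hxy
    rw [← Phi_eq_phiSq hk hne, singSize] at h2
    have h3 : singFun n ‖x - y‖ =
        ENNReal.ofReal (if n = 2 then |Real.log ‖x - y‖| else ‖x - y‖ ^ (2 - (n : ℝ))) := by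
      rw [singFun, if_neg hr.ne']
      split_ifs <;> rfl
    rw [h3, ← ENNReal.ofReal_mul (by linarith), ← ofReal_norm]
    refine ENNReal.ofReal_le_ofReal (h2.trans ?_)
    nlinarith

variable {μ : Measure (E n)} [IsFiniteMeasure μ]

omit [IsFiniteMeasure μ] in
theorem UniformlySmallPotential.tendsto_iSup_lintegral_Phi (h : UniformlySmallPotential μ)
    (hn : 2 ≤ n) {k : ℝ} (hk : 0 < k) :
    Tendsto (fun r : ℝ => ⨆ x : E n, ∫⁻ y in Metric.closedBall x r, ‖Phi k x y‖ₑ ∂μ)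
      (𝓝[>] 0) (𝓝 0) := by
  obtain ⟨A, hA⟩ := exists_enorm_Phi_le hn hk
  have h1 := ENNReal.Tendsto.const_mul h (Or.inr (ENNReal.ofReal_ne_top (r := A)))
  rw [mul_zero] at h1
  refine tendsto_of_tendsto_of_tendsto_of_le_of_le' tendsto_const_nhds h1
    (Eventually.of_forall fun _ => zero_le) ?_
  filter_upwards [nhdsWithin_le_nhds (Iio_mem_nhds (by norm_num : (0 : ℝ) < 1 / 4))] with r hr
  refine iSup_le fun x => ?_
  calc ∫⁻ y in Metric.closedBall x r, ‖Phi k x y‖ₑ ∂μ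
      ≤ ∫⁻ y in Metric.closedBall x r, ENNReal.ofReal A * singFun n ‖x - y‖ ∂μ := by
        refine setLIntegral_mono' Metric.isClosed_closedBall.measurableSet fun y hy => ?_
        refine hA x y ?_
        rw [Metric.mem_closedBall, dist_comm, dist_eq_norm] at hy
        exact hy.trans (le_of_lt hr)
    _ = ENNReal.ofReal A * ∫⁻ y in Metric.closedBall x r, singFun n ‖x - y‖ ∂μ :=
        lintegral_const_mul' _ _ ENNReal.ofReal_ne_top
    _ ≤ _ := by
        gcongr
        exact le_iSup (fun x => ∫⁻ y in Metric.closedBall x r, singFun n ‖x - y‖ ∂μ) x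

/-- A radius r is fixed at which the near part is below 1 uniformly in x. Pairs at distance at least
r form a compact set avoiding the diagonal, on which Φ is bounded. -/
theorem UniformlySmallPotential.exists_lintegral_Phi_le (h : UniformlySmallPotential μ)
    (hn : 2 ≤ n) {k : ℝ} (hk : 0 < k) {Γ S : Set (E n)} (hΓ : IsCompact Γ)
    (hμ : μ.support = Γ) (hS : IsCompact S) :
    ∃ B, B < ∞ ∧ ∀ x ∈ S, ∫⁻ y, ‖Phi k x y‖ₑ ∂μ ≤ B := by
  have h1 := (h.tendsto_iSup_lintegral_Phi hn hk).eventually (Iio_mem_nhds one_pos)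
  obtain ⟨r, hr, hr0⟩ := (h1.and self_mem_nhdsWithin).exists
  have hr0' : 0 < r := hr0
  have hK : IsCompact ((S ×ˢ Γ) ∩ {p : E n × E n | r ≤ dist p.1 p.2}) :=
    (hS.prod hΓ).inter_right (isClosed_le continuous_const (continuous_fst.dist continuous_snd))
  obtain ⟨C, hC⟩ := hK.exists_bound_of_continuousOn ((continuousOn_Phi (n := n) hk).mono
    fun p hp hpe => by
      have h2 : r ≤ dist p.1 p.2 := hp.2
      rw [hpe, dist_self] at h2
      linarith)
  refine ⟨1 + ENNReal.ofReal C * μ univ, by finiteness, fun x hx => ?_⟩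
  rw [← lintegral_add_compl _ (Metric.isClosed_closedBall (x := x) (ε := r)).measurableSet]
  refine add_le_add ((le_iSup (fun x => ∫⁻ y in Metric.closedBall x r, ‖Phi k x y‖ₑ ∂μ) x).trans
    (le_of_lt hr)) ?_
  calc ∫⁻ y in (Metric.closedBall x r)ᶜ, ‖Phi k x y‖ₑ ∂μ
      ≤ ∫⁻ _ in (Metric.closedBall x r)ᶜ, ENNReal.ofReal C ∂μ := by
        refine lintegral_mono_ae ?_
        filter_upwards [ae_restrict_mem Metric.isClosed_closedBall.measurableSet.compl,
          ae_restrict_of_ae (ae_mem_of_support hμ)] with y hy hyΓ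
        rw [← ofReal_norm]
        refine ENNReal.ofReal_le_ofReal (hC (x, y) ⟨⟨hx, hyΓ⟩, ?_⟩)
        rw [mem_compl_iff, Metric.mem_closedBall, not_le, dist_comm] at hy
        exact hy.le
    _ ≤ ENNReal.ofReal C * μ univ := by
        rw [setLIntegral_const]
        gcongr
        exact subset_univ _

theorem UniformlySmallPotential.integrable_Phi (h : UniformlySmallPotential μ) (hn : 2 ≤ n)
    {k : ℝ} (hk : 0 < k) {Γ : Set (E n)} (hΓ : IsCompact Γ) (hμ : μ.support = Γ) (x : E n) :
    Integrable (fun y => Phi k x y) μ := by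
  obtain ⟨B, hB, hx⟩ := h.exists_lintegral_Phi_le hn hk hΓ hμ (isCompact_singleton (x := x))
  exact ⟨((measurable_Phi hk).comp measurable_prodMk_left).aestronglyMeasurable,
    (hx x rfl).trans_lt hB⟩

theorem UniformlySmallPotential.integrable_prod_Phi (h : UniformlySmallPotential μ) (hn : 2 ≤ n)
    {k : ℝ} (hk : 0 < k) {Γ : Set (E n)} (hΓ : IsCompact Γ) (hμ : μ.support = Γ) :
    Integrable (fun p : E n × E n => Phi k p.1 p.2) (μ.prod μ) := by
  obtain ⟨B, hB, hx⟩ := h.exists_lintegral_Phi_le hn hk hΓ hμ hΓ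
  refine ⟨(measurable_Phi hk).aestronglyMeasurable, ?_⟩
  rw [HasFiniteIntegral, lintegral_prod _ (measurable_Phi hk).enorm.aemeasurable]
  calc ∫⁻ x, ∫⁻ y, ‖Phi k x y‖ₑ ∂μ ∂μ ≤ ∫⁻ _, B ∂μ := by
        refine lintegral_mono_ae ?_
        filter_upwards [ae_mem_of_support hμ] with x hxΓ using hx x hxΓ
    _ < ∞ := by
        rw [lintegral_const]
        finiteness

theorem UniformlySmallPotential.integrable_Phi_mul_mul (h : UniformlySmallPotential μ)
    (hn : 2 ≤ n) {k : ℝ} (hk : 0 < k) {Γ : Set (E n)} (hΓ : IsCompact Γ) (hμ : μ.support = Γ)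
    {f g : E n → ℂ} (hf : MemLp f ∞ μ) (hg : MemLp g ∞ μ) :
    Integrable (fun p : E n × E n => Phi k p.1 p.2 * f p.2 * conj (g p.1)) (μ.prod μ) :=
  ((h.integrable_prod_Phi hn hk hΓ hμ).mul_of_top_left (hf.comp_snd μ)).mul_of_top_left
    (hg.star.comp_fst μ)

/-- A continuous function of the distance that removes the singularity of the fundamental
solution. -/
def nearCutoff (δ t : ℝ) : ℝ := max 0 (min 1 (2 * t / δ - 1))

theorem continuous_nearCutoff (δ : ℝ) : Continuous (nearCutoff δ) := by
  unfold nearCutoff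
  fun_prop

theorem nearCutoff_of_le {δ t : ℝ} (hδ : 0 < δ) (ht : t ≤ δ / 2) : nearCutoff δ t = 0 := by
  refine max_eq_left ((min_le_right _ _).trans ?_)
  rw [sub_nonpos, div_le_one hδ]
  linarith

theorem nearCutoff_of_ge {δ t : ℝ} (hδ : 0 < δ) (ht : δ ≤ t) : nearCutoff δ t = 1 := by
  have : 1 ≤ 2 * t / δ - 1 := by
    rw [le_sub_iff_add_le, le_div_iff₀ hδ]
    linarith
  rw [nearCutoff, min_eq_left this, max_eq_right zero_le_one]

theorem abs_one_sub_nearCutoff_le (δ t : ℝ) : |1 - nearCutoff δ t| ≤ 1 := by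
  have h1 : 0 ≤ nearCutoff δ t := le_max_left _ _
  have h2 : nearCutoff δ t ≤ 1 := max_le zero_le_one (min_le_left _ _)
  rw [abs_le]
  constructor <;> linarith

/-- Near the diagonal the factor vanishes identically, whatever the value of Φ there. -/
theorem continuous_nearCutoff_mul_Phi {k δ : ℝ} (hk : 0 < k) (hδ : 0 < δ) :
    Continuous fun p : E n × E n => ((nearCutoff δ ‖p.1 - p.2‖ : ℝ) : ℂ) * Phi k p.1 p.2 := by
  rw [continuous_iff_continuousAt]
  intro p
  by_cases hp : p.1 = p.2
  · have hc : Continuous fun p : E n × E n => ‖p.1 - p.2‖ := by fun_prop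
    refine (continuousAt_const (y := (0 : ℂ))).congr ?_
    filter_upwards [(hc.tendsto p).eventually
      (Iio_mem_nhds (by simp only [hp, sub_self, norm_zero]; positivity : ‖p.1 - p.2‖ < δ / 2))]
      with q hq
    rw [nearCutoff_of_le hδ (le_of_lt hq), Complex.ofReal_zero, zero_mul]
  · have h1 : Continuous fun p : E n × E n => ((nearCutoff δ ‖p.1 - p.2‖ : ℝ) : ℂ) :=
      Complex.continuous_ofReal.comp ((continuous_nearCutoff δ).comp (by fun_prop))
    exact h1.continuousAt.mul ((continuousOn_Phi hk).continuousAt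
      ((isOpen_ne_fun continuous_fst continuous_snd).mem_nhds hp))

/-- Potentials of bounded densities are continuous on the whole space. -/
theorem UniformlySmallPotential.continuous_potential (h : UniformlySmallPotential μ) (hn : 2 ≤ n)
    {k : ℝ} (hk : 0 < k) {Γ : Set (E n)} (hΓ : IsCompact Γ) (hμ : μ.support = Γ)
    {f : E n → ℂ} (hf : MemLp f ∞ μ) : Continuous fun x => ∫ y, Phi k x y * f y ∂μ := by
  have hfi : Integrable f μ := hf.integrable (by simp)
  have hcont : ∀ δ : ℝ, 0 < δ → Continuous fun x =>
      ∫ y, (((nearCutoff δ ‖x - y‖ : ℝ) : ℂ) * Phi k x y) * f y ∂μ := fun δ hδ => by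
    rw [← continuousOn_univ]
    exact continuousOn_integral_kernel
      (κ := fun x y => ((nearCutoff δ ‖x - y‖ : ℝ) : ℂ) * Phi k x y) hΓ hμ isOpen_univ
      (continuous_nearCutoff_mul_Phi hk hδ).continuousOn hfi
  set F := eLpNormEssSup f μ
  have hF : F < ∞ := by simpa using hf.2
  -- The two kernels differ only at distance below δ, and there by at most |Φ|. The error is thus
  -- the essential supremum of f times a small local integral, uniformly in x.
  have hdiff : ∀ δ : ℝ, 0 < δ → ∀ x, edist (∫ y, Phi k x y * f y ∂μ)
      (∫ y, (((nearCutoff δ ‖x - y‖ : ℝ) : ℂ) * Phi k x y) * f y ∂μ) ≤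
      F * ⨆ x : E n, ∫⁻ y in Metric.closedBall x δ, ‖Phi k x y‖ₑ ∂μ := by
    intro δ hδ x
    have hκ : Continuous fun y : E n => ((nearCutoff δ ‖x - y‖ : ℝ) : ℂ) * Phi k x y := by
      have hp : Continuous fun y : E n => (x, y) := by fun_prop
      simpa only [Function.comp_def] using (continuous_nearCutoff_mul_Phi (n := n) hk hδ).comp hp
    have hi₁ : Integrable (fun y => Phi k x y * f y) μ :=
      (h.integrable_Phi hn hk hΓ hμ x).mul_of_top_left hf
    have hi₂ : Integrable (fun y => ((nearCutoff δ ‖x - y‖ : ℝ) : ℂ) * Phi k x y * f y) μ :=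
      integrable_kernel_mul (κ := fun x y => ((nearCutoff δ ‖x - y‖ : ℝ) : ℂ) * Phi k x y)
        hΓ hμ hκ.continuousOn hfi
    rw [edist_eq_enorm_sub, ← integral_sub hi₁ hi₂]
    calc _ ≤ ∫⁻ y, (Metric.closedBall x δ).indicator (fun y => F * ‖Phi k x y‖ₑ) y ∂μ := by
          refine (enorm_integral_le_lintegral_enorm _).trans (lintegral_mono_ae ?_)
          filter_upwards [enorm_ae_le_eLpNormEssSup f μ] with y hy
          rw [show Phi k x y * f y - ((nearCutoff δ ‖x - y‖ : ℝ) : ℂ) * Phi k x y * f y =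
            ((1 - nearCutoff δ ‖x - y‖ : ℝ) : ℂ) * (f y * Phi k x y) by push_cast; ring]
          by_cases hxy : y ∈ Metric.closedBall x δ
          · rw [indicator_of_mem hxy, enorm_mul, enorm_mul]
            have h1 : ‖((1 - nearCutoff δ ‖x - y‖ : ℝ) : ℂ)‖ₑ ≤ 1 := by
              rw [← ofReal_norm, Complex.norm_real, Real.norm_eq_abs]
              exact ENNReal.ofReal_le_one.mpr (abs_one_sub_nearCutoff_le _ _)
            calc _ ≤ 1 * (F * ‖Phi k x y‖ₑ) := by gcongr
              _ = _ := one_mul _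
          · rw [indicator_of_notMem hxy]
            rw [Metric.mem_closedBall, not_le, dist_comm, dist_eq_norm] at hxy
            rw [nearCutoff_of_ge hδ hxy.le]
            simp
      _ = F * ∫⁻ y in Metric.closedBall x δ, ‖Phi k x y‖ₑ ∂μ := by
          rw [lintegral_indicator Metric.isClosed_closedBall.measurableSet,
            lintegral_const_mul' _ _ hF.ne]
      _ ≤ _ := by
          gcongr
          exact le_iSup (fun x => ∫⁻ y in Metric.closedBall x δ, ‖Phi k x y‖ₑ ∂μ) x
  have hlim := ENNReal.Tendsto.const_mul (h.tendsto_iSup_lintegral_Phi hn hk) (Or.inr hF.ne)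
  rw [mul_zero] at hlim
  have hunif : TendstoUniformly
      (fun δ x => ∫ y, (((nearCutoff δ ‖x - y‖ : ℝ) : ℂ) * Phi k x y) * f y ∂μ)
      (fun x => ∫ y, Phi k x y * f y ∂μ) (𝓝[>] 0) := by
    rw [EMetric.tendstoUniformly_iff]
    intro ε hε
    filter_upwards [hlim.eventually (Iio_mem_nhds hε), self_mem_nhdsWithin] with δ hδ hδ0 x
    exact (hdiff δ hδ0 x).trans_lt hδ
  refine hunif.continuous (Eventually.frequently ?_)
  filter_upwards [self_mem_nhdsWithin] with δ hδ using hcont δ hδ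

end UniformlySmall

/-! ### Traces of cut-off functions -/

section CutoffTraces

variable {n : ℕ} {μ : Measure (E n)} [IsFiniteMeasure μ] {Γ : Set (E n)} {χ : 𝓢(E n, ℂ)}

theorem IsCutoff.eq_one (hχ : IsCutoff Γ χ) {x : E n} (hx : x ∈ Γ) : χ x = 1 :=
  ((eventually_nhdsSet_iff_forall.mp hχ.2) x hx).self_of_nhds

/-- Fubini identifies the distribution χ𝒜T*f with χ times the potential, a continuous function of
compact support. The trace is then its restriction to Γ, where χ = 1. -/
theorem trace_cutoffNewton_eq_potential (hn : 2 ≤ n) {k : ℝ} (hk : 0 < k) (hΓ : IsCompact Γ)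
    (hμ : μ.support = Γ) (htr : TraceBounded μ) (hχ : IsCutoff Γ χ)
    (h : UniformlySmallPotential μ) {f : Lp ℂ 2 μ} (hf : MemLp f ∞ μ) :
    trace μ (cutoffNewton k χ (traceAdj μ f).dist) =ᵐ[μ] fun x => ∫ y, Phi k x y * f y ∂μ := by
  have hp := h.continuous_potential hn hk hΓ hμ hf
  have hc : Continuous fun x => χ x * ∫ y, Phi k x y * f y ∂μ := χ.continuous.mul hp
  have hcs : HasCompactSupport fun x => χ x * ∫ y, Phi k x y * f y ∂μ := hχ.1.mul_right
  have hv := isCutoffNewton_cutoffNewton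
    (exists_isCutoffNewton hn hk hΓ hχ.1 (traceAdj_mem_HGamma hμ htr f))
  have htrace := trace_eq_of_continuousAt hμ htr (hc.integrable_of_hasCompactSupport hcs) hcs
    (w := cutoffNewton k χ (traceAdj μ f).dist) (fun ψ => ?_) fun x _ => hc.continuousAt
  · filter_upwards [htrace, ae_mem_of_support hμ] with x hx hxΓ
    rw [hx, hχ.eq_one hxΓ, one_mul]
  · rw [hv ψ, ← coe_mulSchwartz, (newton_traceAdj hn hk hΓ hμ htr f (ψ := mulSchwartz χ ψ) ?_).2]
    · refine integral_congr_ae (Eventually.of_forall fun x => ?_)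
      simp only [mulSchwartz_apply]
      ring
    · rw [coe_mulSchwartz]
      exact hχ.1.mul_right

/-- χu is in L² with compact support, hence integrable, and it is continuous at the points of Γ, so
the trace is its restriction; χ = 1 there. -/
theorem trace_cutoff_eq (hμ : μ.support = Γ) (htr : TraceBounded μ) (hχ : IsCutoff Γ χ)
    {u : E n → ℂ} (hu : MemH1loc u) (hΓ : ∀ x ∈ Γ, ContinuousAt u x) :
    trace μ (hu.cutoff hχ.1) =ᵐ[μ] u := by
  obtain ⟨hmem, -⟩ := hu χ hχ.1
  have hcs : HasCompactSupport fun x => χ x * u x := hχ.1.mul_right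
  have hint : Integrable fun x => χ x * u x := by
    rw [← integrableOn_iff_integrable_of_support_subset
      ((Function.support_mul_subset_left χ u).trans (subset_tsupport χ))]
    have : IsFiniteMeasure (volume.restrict (tsupport χ)) :=
      ⟨by simpa using hχ.1.isCompact.measure_lt_top⟩
    exact (hmem.restrict (tsupport χ)).integrable one_le_two
  have htrace := trace_eq_of_continuousAt hμ htr hint hcs (w := hu.cutoff hχ.1) (fun ψ => ?_)
    fun x hx => χ.continuous.continuousAt.mul (hΓ x hx)
  · filter_upwards [htrace, ae_mem_of_support hμ] with x hx hxΓ
    rw [hx, hχ.eq_one hxΓ, one_mul]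
  · change (hmem.toLp : 𝓢'(E n, ℂ)) ψ = _
    rw [Lp.toTemperedDistribution_apply]
    refine integral_congr_ae ?_
    filter_upwards [hmem.coeFn_toLp] with x hx
    rw [hx, smul_eq_mul, mul_comm]

end CutoffTraces

end Scattering

end

/-! ### Assembly of the proposition. -/

open Scattering

theorem proposition4p3
    -- the obstacle `O`, the wavenumber `k`, and the compact set `Γ`
    {n : ℕ} (hn : 2 ≤ n) (k : ℝ) (hk : 0 < k) (O Γ : Set (E n)) (hO : IsCompact O)
    (hΩ : IsConnected Oᶜ) (hΓ : IsCompact Γ) (hOΓ : frontier O ⊆ Γ) (hΓO : Γ ⊆ O)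
    -- the incident field; near `O` it is a continuous solution of the Helmholtz equation
    (uinc : E n → ℂ) (huinc : MemH1loc uinc) (U : Set (E n)) (hU : IsOpen U) (hOU : O ⊆ U)
    (hcont : ContinuousOn uinc U) (hhelm : HelmholtzOn k U uinc)
    -- the measure
    (μ : Measure (E n)) [IsFiniteMeasure μ] (hμ : μ.support = Γ) (htrace : TraceBounded μ)
    -- the cut-off function, the mesh, and the basis of the finite element space
    (χ : 𝓢(E n, ℂ)) (hχ : IsCutoff Γ χ) {M : ℕ} (T : Fin M → Set (E n)) (hT : IsMesh μ Γ T)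
    (f : Module.Basis (Fin M) ℂ (meshSpace μ T)) :
    -- the operators below are defined
    (∀ φ ∈ HGamma Γ, ∃ v : H n 1, IsCutoffNewton k χ φ.dist v) ∧
    (∀ h : Lp ℂ 2 μ, traceAdj μ h ∈ HGamma Γ) ∧
    -- the Galerkin matrix
    (∀ i j, formA k Γ χ (traceAdj μ (f j)) (traceAdj μ (f i)) =
      l2inner μ (opAA μ k Γ χ (embedHHDual μ (f j))) (f i)) ∧
    -- the right-hand side
    (∀ i, pairing (rhsG Γ huinc hχ) (traceAdj μ (f i)) =
        l2inner μ (trace μ (rhsG Γ huinc hχ)) (f i) ∧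
      IntegrableOn (fun x => uinc x * conj ((f i : Lp ℂ 2 μ) x)) Γ μ ∧
      l2inner μ (trace μ (rhsG Γ huinc hχ)) (f i) =
        -∫ x in Γ, uinc x * conj ((f i : Lp ℂ 2 μ) x) ∂μ) ∧
    -- the approximate field `u_N = 𝒜 φ_N` on `Ω`, where `φ_N = ∑ c_j Tr̃* f_j`
    (∀ c : Fin M → ℂ,
      (∀ j, ∀ x ∈ Oᶜ, IntegrableOn (fun y => Phi k x y * (f j : Lp ℂ 2 μ) y) Γ μ) ∧
      (∃ u : E n → ℂ, IsContinuousRepOn k (∑ j, c j • traceAdj μ (f j)).dist Oᶜ u) ∧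
      ∀ u : E n → ℂ, IsContinuousRepOn k (∑ j, c j • traceAdj μ (f j)).dist Oᶜ u →
        ∀ x ∈ Oᶜ, u x = ∑ j, c j * ∫ y in Γ, Phi k x y * (f j : Lp ℂ 2 μ) y ∂μ) ∧
    -- the Galerkin matrix as double integrals
    (UniformlySmallPotential μ → ∀ i j,
      Integrable (fun p : E n × E n =>
        Phi k p.1 p.2 * (f j : Lp ℂ 2 μ) p.2 * conj ((f i : Lp ℂ 2 μ) p.1))
        ((μ.restrict Γ).prod (μ.restrict Γ)) ∧
      formA k Γ χ (traceAdj μ (f j)) (traceAdj μ (f i)) =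
        ∫ x in Γ, ∫ y in Γ,
          Phi k x y * (f j : Lp ℂ 2 μ) y * conj ((f i : Lp ℂ 2 μ) x) ∂μ ∂μ) := by
  have hr : μ.restrict Γ = μ := Measure.restrict_eq_self_of_ae_mem (ae_mem_of_support hμ)
  have hfi : ∀ j, Integrable (f j : Lp ℂ 2 μ) μ := fun j =>
    (Lp.memLp (f j : Lp ℂ 2 μ)).integrable one_le_two
  have hOΓc : Oᶜ ⊆ Γᶜ := compl_subset_compl.mpr hΓO
  have hcΓ : ∀ x ∈ Γ, ContinuousAt uinc x := fun x hx =>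
    hcont.continuousAt (hU.mem_nhds (hOU (hΓO hx)))
  refine ⟨fun φ hφ => exists_isCutoffNewton hn hk hΓ hχ.1 hφ,
    traceAdj_mem_HGamma hμ htrace, fun i j => ?_, fun i => ⟨?_, ?_, ?_⟩,
    fun c => ⟨fun j x hx => ?_, ?_⟩, fun hsmall i j => ⟨?_, ?_⟩⟩
  -- On L²(Γ, μ) the adjoint defined on ℍ* coincides with T*; after this replacement both sides
  -- agree by definition.
  · rw [formA, pairing_traceAdj_right, ← adjHH_embedHHDual (f j : Lp ℂ 2 μ)]
    rfl
  · exact pairing_traceAdj_right _ _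
  · have hconj : Integrable (fun x => conj ((f i : Lp ℂ 2 μ) x)) μ :=
      RCLike.conjCLE.integrable_comp_iff.mpr (hfi i)
    -- The kernel does not depend on its first argument, so the point 0 is a dummy.
    have h := integrable_kernel_mul (κ := fun _ => uinc) (x := 0) hΓ hμ
      (fun x hx => (hcΓ x hx).continuousWithinAt) hconj
    rwa [IntegrableOn, hr]
  · rw [rhsG, map_neg, trace_projV1 hμ htrace, hr, l2inner_eq_integral, ← integral_neg]
    refine integral_congr_ae ?_
    filter_upwards [Lp.coeFn_neg (trace μ (huinc.cutoff hχ.1)),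
      trace_cutoff_eq hμ htrace hχ huinc hcΓ] with x h1 h2
    rw [h1, Pi.neg_apply, h2, neg_mul]
  · rw [IntegrableOn, hr]
    exact integrable_Phi_mul hk hΓ hμ (hfi j) (hOΓc hx)
  · rw [hr]
    have hpot : ContinuousOn
        (fun x => ∑ j, c j * ∫ y, Phi k x y * (f j : Lp ℂ 2 μ) y ∂μ) Oᶜ :=
      continuousOn_finsetSum _ fun j _ => continuousOn_const.mul
        ((continuousOn_potential hk hΓ hμ (hfi j)).mono hOΓc)
    have hnewton : ∀ ψ : 𝓢(E n, ℂ), HasCompactSupport ψ →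
        newton k (∑ j, c j • traceAdj μ (f j)).dist ψ =
          ∫ x, (∑ j, c j * ∫ y, Phi k x y * (f j : Lp ℂ 2 μ) y ∂μ) * ψ x := by
      intro ψ hψ
      have h := fun j => newton_traceAdj hn hk hΓ hμ htrace (f j) hψ
      simp only [newton_sum_traceAdj hn hk hΓ hμ htrace c (fun j => (f j : Lp ℂ 2 μ)) hψ,
        (h _).2, Finset.sum_mul, mul_assoc]
      rw [integral_finsetSum _ fun j _ => (h j).1.const_mul (c j)]
      simp only [integral_const_mul]
    -- The sum of potentials is one continuous representative; any other agrees with it on the open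
    -- set Ω.
    refine ⟨⟨_, hpot, fun ψ hψ _ => hnewton ψ hψ⟩, fun u hu x hx => ?_⟩
    exact eqOn_of_integral_mul_eq hO.isClosed.isOpen_compl hu.1 hpot
      (fun ψ hψ hψs => (hu.2 ψ hψ hψs).symm.trans (hnewton ψ hψ)) hx
  · rw [hr]
    exact hsmall.integrable_Phi_mul_mul hn hk hΓ hμ (f j).2.1 (f i).2.1
  · rw [hr, formA_traceAdj hμ htrace, l2inner_eq_integral]
    refine integral_congr_ae ?_
    filter_upwards [trace_cutoffNewton_eq_potential hn hk hΓ hμ htrace hχ hsmall (f j).2.1]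
      with x hx
    rw [hx, integral_mul_const]
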